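/- A \emph{network} is a locally finite graph $G=(V,E)$ (multiple edges and self-loops allowed) with positive edge conductances $(c_e)_{e\in E}$; $c(v)$ denotes the total conductance of the oriented edges emanating from $v$. The random walk on $G$ is the Markov chain that from $v$ crosses an oriented edge emanating from $v$ chosen with probability proportional to its conductance, and $\mathbb{P}_v$ is its law when started from $v$. For $A\subseteq V$ let $\tau_A^+=\min\{t\ge 1: X_t\in A\}$. The network is \emph{transient} if $\mathbb{P}_v(\tau^+_{\{v\}}=\infty)>0$ for every $v\in V$, and the \emph{capacity} of a finite set $A\subseteq V$ is $\operatorname{Cap}(A)=\sum_{v\in A}c(v)\,\mathbb{P}_v(\tau_A^+=\infty)$. For a finite path $w=(w_0,\dots,w_m)$ put $\ell_0=0$ and $\ell_{k+1}=1+\max\{j\le m: w_j=w_{\ell_k}\}$, stopping the first time that this maximum equals $m$; the loop-erasure $\mathsf{LE}(w)$ is the path $(w_{\ell_0},w_{\ell_1},\dots)$. Write $X^n=(X_0,\dots,X_n)$, and write $\operatorname{Cap}$ of a path for the capacity of the set of vertices it visits. (1) Let $G$ be a transient, locally finite network, let $x\in V$, and let $X$ be a random walk on $G$ started from $x$. Then,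 for every $n\ge 0$, \[ \mathbb{E}\bigl[\operatorname{Cap}(\mathsf{LE}(X^n))\bigr]\;\ge\;\frac{1}{256}\,\mathbb{E}\bigl[\operatorname{Cap}(X^n)\bigr]. \] (2) There exist constants $0<c\le C<\infty$ such that, if $X$ is a simple random walk on the lattice $\mathbb{Z}^4$ (nearest-neighbour edges with unit conductances), started from any vertex, then \[ c\,\frac{n}{\log n}\;\le\;\mathbb{E}\bigl[\operatorname{Cap}(\mathsf{LE}(X^n))\bigr]\;\le\;C\,\frac{n}{\log n}\qquad\text{for every } n\ge 2 . \] -/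

import Mathlib

open MeasureTheory ProbabilityTheory

/-- A locally finite network with vertex set `V`. Multiple edges and self-loops are allowed.
`E` is the set of *oriented* edges: `e` goes from `src e` to `tgt e`, and `rev e` is the same edge
with the opposite orientation. A self-loop may be counted as one oriented edge (`rev e = e`)
or as two. -/
structure Network (V E : Type*) where
  src : E → V
  tgt : E → V
  rev : E → E
  rev_rev : ∀ e, rev (rev e) = e
  src_rev : ∀ e, src (rev e) = tgt e
  /-- the conductance of an edge -/
  cond : E → ℝ
  cond_pos : ∀ e, 0 < cond e
  cond_rev : ∀ e, cond (rev e) = cond e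
  /-- local finiteness -/
  finite_out : ∀ v, {e | src e = v}.Finite

namespace Network

variable {V E : Type*} (G : Network V E)

/-- The oriented edges emanating from `v`. -/
noncomputable def out (v : V) : Finset E := (G.finite_out v).toFinset

/-- `c(v)`, the total conductance of the oriented edges emanating from `v`. -/
noncomputable def vertexCond (v : V) : ℝ := ∑ e ∈ G.out v, G.cond e

theorem vertexCond_pos {v : V} (h : (G.out v).Nonempty) : 0 < G.vertexCond v :=
  Finset.sum_pos (fun e _ => G.cond_pos e) h

variable [MeasurableSpace V]

open Classical in
/-- The law of one step of the random walk from `v`: an oriented edge emanating from `v` is chosen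
with probability proportional to its conductance and crossed. (At an isolated vertex, which a
transient network does not have, the walk stays put.) -/
noncomputable def stepLaw (v : V) : Measure V :=
  if (G.out v).Nonempty then
    ∑ e ∈ G.out v, ENNReal.ofReal (G.cond e / G.vertexCond v) • Measure.dirac (G.tgt e)
  else Measure.dirac v

instance (v : V) : IsProbabilityMeasure (G.stepLaw v) := by
  unfold stepLaw
  split_ifs with h
  · constructor
    have hpos := G.vertexCond_pos h
    simp only [Measure.coe_finsetSum, Finset.sum_apply, Measure.smul_apply, measure_univ,
      smul_eq_mul, mul_one]
    rw [← ENNReal.ofReal_sum_of_nonneg fun e _ => (div_pos (G.cond_pos e) hpos).le,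
      ← Finset.sum_div]
    change ENNReal.ofReal (G.vertexCond v / G.vertexCond v) = 1
    rw [div_self hpos.ne', ENNReal.ofReal_one]
  · infer_instance

variable [DiscreteMeasurableSpace V]

/-- The transition kernel of the random walk, the next step being given the past up to
time `n`. -/
noncomputable def stepKernel (n : ℕ) : Kernel ((i : Finset.Iic n) → (fun _ : ℕ => V) i) V :=
  Kernel.comap (⟨G.stepLaw, Measurable.of_discrete⟩ : Kernel V V)
    (fun h => h ⟨n, Finset.mem_Iic.2 le_rfl⟩) (measurable_pi_apply _)

instance (n : ℕ) : IsMarkovKernel (G.stepKernel n) :=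
  ⟨fun h => inferInstanceAs
    (IsProbabilityMeasure (G.stepLaw (h ⟨n, Finset.mem_Iic.2 le_rfl⟩)))⟩

/-- The law `P_x`, on trajectories `ℕ → V`, of the random walk on `G` started from `x`. -/
noncomputable def walkLaw (x : V) : Measure (ℕ → V) :=
  Kernel.traj (X := fun _ : ℕ => V) G.stepKernel 0 (fun _ => x)

/-- `P_x(τ_A⁺ = ∞)`, the probability that the walk started from `x` does not visit `A` at any
positive time. -/
noncomputable def escapeProb (A : Set V) (x : V) : ℝ :=
  (G.walkLaw x).real {w | ∀ t, 1 ≤ t → w t ∉ A}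

/-- The network is transient: from every vertex, the walk has a positive probability of
never returning. -/
def IsTransient : Prop := ∀ v, 0 < G.escapeProb {v} v

/-- The capacity `∑_{x ∈ A} c(x) P_x(τ_A⁺ = ∞)` of a finite set `A` of vertices. -/
noncomputable def capacity (A : Finset V) : ℝ :=
  ∑ x ∈ A, G.vertexCond x * G.escapeProb (A : Set V) x

end Network

section LoopErasure

variable {V : Type*}

open Classical in
/-- The set of vertices visited by the path `w` stopped at time `m`. -/
noncomputable def pathVertices (w : ℕ → V) (m : ℕ) : Finset V :=
  (Finset.range (m + 1)).image w

open Classical in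
/-- `max {k ≤ m : w k = w i}`, for `i ≤ m`. -/
noncomputable def lastVisit (w : ℕ → V) (m i : ℕ) : ℕ :=
  Nat.findGreatest (fun k => w k = w i) m

/-- The times `ℓ_k` of the loop-erasure of the path `w` stopped at time `m`: `ℓ_0 = 0` and
`ℓ_{k+1} = 1 + max {j ≤ m : w j = w ℓ_k}`, the sequence terminating (value `none`) the first time
that this maximum equals `m`. -/
noncomputable def loopErasureTime (w : ℕ → V) (m : ℕ) : ℕ → Option ℕ
  | 0 => some 0
  | k + 1 => (loopErasureTime w m k).bind fun l =>
      if lastVisit w m l = m then none else some (1 + lastVisit w m l)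

/-- The `k`-th vertex `w ℓ_k` of the loop-erasure of the path `w` stopped at time `m`
(`none` after its end). -/
noncomputable def loopErasure (w : ℕ → V) (m k : ℕ) : Option V :=
  (loopErasureTime w m k).map w

open Classical in
/-- The set of vertices of the loop-erasure of the path `w` stopped at time `m`. -/
noncomputable def loopErasureVertices (w : ℕ → V) (m : ℕ) : Finset V :=
  (pathVertices w m).filter fun v => ∃ k, loopErasure w m k = some v

end LoopErasure

/-- The endpoint of the oriented lattice edge that leaves `x` in direction `i`, forwards or
backwards. -/
def latticeStep {d : ℕ} (x : Fin d → ℤ) (i : Fin d) (b : Bool) : Fin d → ℤ :=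
  x + Pi.single i (if b then 1 else -1)

theorem latticeStep_not {d : ℕ} (x : Fin d → ℤ) (i : Fin d) (b : Bool) :
    latticeStep (latticeStep x i b) i (!b) = x := by
  cases b <;> simp [latticeStep, add_assoc, ← Pi.single_add]

/-- The hypercubic lattice `ℤ^d` with nearest-neighbour edges and unit conductances. -/
def latticeNetwork (d : ℕ) : Network (Fin d → ℤ) ((Fin d → ℤ) × Fin d × Bool) where
  src e := e.1
  tgt e := latticeStep e.1 e.2.1 e.2.2
  rev e := (latticeStep e.1 e.2.1 e.2.2, e.2.1, !e.2.2)
  rev_rev e := by simp [latticeStep_not]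
  src_rev _ := rfl
  cond _ := 1
  cond_pos _ := one_pos
  cond_rev _ := rfl
  finite_out v := by
    refine (Set.finite_range fun p : Fin d × Bool => (v, p)).subset ?_
    rintro ⟨x, p⟩ rfl
    exact ⟨p, rfl⟩

/-! Part (1). The estimates are made for the walk that survives each step with probability `lam` and
is stopped on leaving a finite set `W`. There the Green kernel is a finite matrix, and the capacity
of `A` is the Dirichlet energy of its equilibrium potential. By Cauchy–Schwarz, a measure carried by
`A` with mass M and energy I forces Cap(A) ≥ 2tM - t²I for every t (`le_killedCap`). So it suffices
to put on the loop-erasure a random measure whose mean mass is at least a constant times C = E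
Cap(X^n) and whose mean energy is at most a constant times C.

The starting point is the equilibrium measure of the path, listed by times of first visit. Its
charge at time m depends on the whole path; it is replaced by its conditional expectation a_m(X_m)
given X_m, which keeps the mean mass C. For the energy I of the new measure, symmetry leaves the
pairs m ≤ j. The conditional mean of the sum over j ≥ m, given the walk up to time m, depends on X_m
only, so a_m(X_m) may be turned back into the original charge. What results is the pairing of the
equilibrium measure with the maximal function of the martingales E[Φ(v) | F_m], where Φ is the
potential of the new measure. The Dirichlet form is a positive combination of squares, so Doob's L²
inequality bounds the energy of the maximal function by 4I on average. Cauchy–Schwarz then gives I ≤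
4√(CI), that is I ≤ 16C (`pathExp_dirForm_meanPotential_le`).

Each charge at X_m is then swept onto the initial piece of LE(X^m) that ends at the lowest point
which X visits from time m on. This piece survives in LE(X^n)
(`loopErasurePrefix_survivingIndex_subset`), and sweeping does not raise the energy. The swept mass
is the probability that an independent copy of the continuation reaches at least as low as the
actual one, which by symmetry is at least 1/2 on average (`half_le_pathExp_hitProb`). Removing the
killing (`le_pathExp_capacity`) gives the constant 1/64, better than required.

Part (2). The lower bound combines part (1) with the energy of the occupation measure of the walk on
ℤ⁴: since P^kG ≤ const/(k+1), this energy has mean O(n log n). For the upper bound, last-exit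
decomposition gives ∑_v esc(v) G(v-u) ≤ 1 for every u (`sum_escapeProb_mul_latticeGreen_le`); sum
this over u = X_0, ..., X_{3n}. Seen from a path vertex X_m, the Green function summed along the
future has mean of order log n and variance O(log n), so by Chebyshev all but a mean fraction
O(1/log n) of the times m are good. The escape probabilities at good vertices add up to O(n/log n),
and the bad ones are counted trivially. -/

namespace Network

/-! ### Finite path averages, hitting probabilities, Doob's inequality -/

variable {V E : Type*} (G : Network V E)

/-- The average of `f` over the neighbours of `v`: the transition operator of the random walk. -/
noncomputable def avg (f : V → ℝ) (v : V) : ℝ :=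
  (∑ e ∈ G.out v, G.cond e * f (G.tgt e)) / G.vertexCond v

theorem vertexCond_nonneg (v : V) : 0 ≤ G.vertexCond v :=
  Finset.sum_nonneg fun e _ => (G.cond_pos e).le

theorem vertexCond_mul_avg (hG : ∀ v, (G.out v).Nonempty) (f : V → ℝ) (v : V) :
    G.vertexCond v * G.avg f v = ∑ e ∈ G.out v, G.cond e * f (G.tgt e) := by
  rw [avg, mul_div_cancel₀ _ (G.vertexCond_pos (hG v)).ne']

theorem avg_le_avg {f g : V → ℝ} {v : V} (h : ∀ e ∈ G.out v, f (G.tgt e) ≤ g (G.tgt e)) :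
    G.avg f v ≤ G.avg g v := by
  refine div_le_div_of_nonneg_right (Finset.sum_le_sum fun e he => ?_) (G.vertexCond_nonneg v)
  exact mul_le_mul_of_nonneg_left (h e he) (G.cond_pos e).le

theorem avg_congr {f g : V → ℝ} {v : V} (h : ∀ e ∈ G.out v, f (G.tgt e) = g (G.tgt e)) :
    G.avg f v = G.avg g v :=
  le_antisymm (G.avg_le_avg fun e he => (h e he).le) (G.avg_le_avg fun e he => (h e he).ge)

theorem avg_const (hG : ∀ v, (G.out v).Nonempty) (c : ℝ) (v : V) :
    G.avg (fun _ => c) v = c := by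
  rw [avg, ← Finset.sum_mul]
  exact mul_div_cancel_left₀ _ (G.vertexCond_pos (hG v)).ne'

theorem avg_zero (v : V) : G.avg (fun _ => 0) v = 0 := by simp [avg]

theorem avg_nonneg {f : V → ℝ} (h : ∀ v, 0 ≤ f v) (v : V) : 0 ≤ G.avg f v := by
  rw [← G.avg_zero v]; exact G.avg_le_avg fun e _ => h _

theorem avg_add (f g : V → ℝ) (v : V) :
    G.avg (fun u => f u + g u) v = G.avg f v + G.avg g v := by
  simp only [avg, mul_add, Finset.sum_add_distrib, add_div]

theorem avg_const_mul (c : ℝ) (f : V → ℝ) (v : V) :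
    G.avg (fun u => c * f u) v = c * G.avg f v := by
  simp only [avg, mul_left_comm _ c, ← Finset.mul_sum, mul_div_assoc]

theorem avg_sum {ι : Type*} (s : Finset ι) (f : ι → V → ℝ) (v : V) :
    G.avg (fun u => ∑ i ∈ s, f i u) v = ∑ i ∈ s, G.avg (f i) v := by
  classical
  induction s using Finset.induction_on with
  | empty => simpa using G.avg_zero v
  | insert i s hi ih => simp only [Finset.sum_insert hi, avg_add, ih]

theorem avg_sub (f g : V → ℝ) (v : V) :
    G.avg (fun u => f u - g u) v = G.avg f v - G.avg g v := by
  simp only [avg, mul_sub, Finset.sum_sub_distrib, sub_div]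

/-- The conditional expectation, given the walk up to time `m`, of a function of the walk up to
time `m + 1`. -/
noncomputable def stepExp (m : ℕ) (F : (ℕ → V) → ℝ) (w : ℕ → V) : ℝ :=
  G.avg (fun u => F (Function.update w (m + 1) u)) (w m)

/-- The conditional expectation, given the walk up to time `m`, of a function of the walk up to
time `m + k`. -/
noncomputable def pathExp : ℕ → ℕ → ((ℕ → V) → ℝ) → (ℕ → V) → ℝ
  | _, 0, F => F
  | m, k + 1, F => G.stepExp m (pathExp (m + 1) k F)

@[simp] theorem pathExp_zero (m : ℕ) (F : (ℕ → V) → ℝ) : G.pathExp m 0 F = F := by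
  rw [pathExp]

theorem pathExp_succ (m k : ℕ) (F : (ℕ → V) → ℝ) :
    G.pathExp m (k + 1) F = G.stepExp m (G.pathExp (m + 1) k F) := by
  rw [pathExp]

/-- `w` follows edges of the network from time `m` to time `m + k`. -/
def IsPath (m k : ℕ) (w : ℕ → V) : Prop :=
  ∀ i, m ≤ i → i < m + k → ∃ e ∈ G.out (w i), G.tgt e = w (i + 1)

/-- Only continuations of `w` along edges carry weight. Offering both facts to the comparison lets
later arguments use that the walk stays in a finite ball. -/
theorem pathExp_le {m k : ℕ} {F F' : (ℕ → V) → ℝ} {w : ℕ → V}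
    (h : ∀ w', (∀ i ≤ m, w' i = w i) → G.IsPath m k w' → F w' ≤ F' w') :
    G.pathExp m k F w ≤ G.pathExp m k F' w := by
  induction k generalizing m w with
  | zero => exact h w (fun _ _ => rfl) fun i hi hi' => absurd hi' (by omega)
  | succ k ih =>
    rw [pathExp_succ, pathExp_succ]
    refine G.avg_le_avg fun e he => ih fun w' hw' hp => h w' (fun i hi => ?_) fun i hi hi' => ?_
    · rw [hw' i (by omega), Function.update_of_ne (by omega)]
    · rcases hi.eq_or_lt with rfl | hlt
      · refine ⟨e, ?_, ?_⟩
        · rw [hw' _ (by omega), Function.update_of_ne (by omega)]; exact he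
        · rw [hw' _ le_rfl, Function.update_self]
      · exact hp i hlt (by omega)

theorem pathExp_congr {m k : ℕ} {F F' : (ℕ → V) → ℝ} {w : ℕ → V}
    (h : ∀ w', (∀ i ≤ m, w' i = w i) → G.IsPath m k w' → F w' = F' w') :
    G.pathExp m k F w = G.pathExp m k F' w :=
  le_antisymm (G.pathExp_le fun w' h1 h2 => (h w' h1 h2).le)
    (G.pathExp_le fun w' h1 h2 => (h w' h1 h2).ge)

theorem pathExp_const (hG : ∀ v, (G.out v).Nonempty) (m k : ℕ) (c : ℝ) (w : ℕ → V) :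
    G.pathExp m k (fun _ => c) w = c := by
  induction k generalizing m w with
  | zero => rfl
  | succ k ih => simp only [pathExp_succ, stepExp, ih]; exact G.avg_const hG c _

theorem pathExp_zero_fun (m k : ℕ) (w : ℕ → V) : G.pathExp m k (fun _ => 0) w = 0 := by
  induction k generalizing m w with
  | zero => rfl
  | succ k ih => simp only [pathExp_succ, stepExp, ih]; exact G.avg_zero _

theorem pathExp_nonneg {m k : ℕ} {F : (ℕ → V) → ℝ} {w : ℕ → V}
    (h : ∀ w', (∀ i ≤ m, w' i = w i) → G.IsPath m k w' → 0 ≤ F w') :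
    0 ≤ G.pathExp m k F w := by
  rw [← G.pathExp_zero_fun m k w]; exact G.pathExp_le h

theorem pathExp_add (m k : ℕ) (F F' : (ℕ → V) → ℝ) (w : ℕ → V) :
    G.pathExp m k (fun w => F w + F' w) w = G.pathExp m k F w + G.pathExp m k F' w := by
  induction k generalizing m w with
  | zero => rfl
  | succ k ih => simp only [pathExp_succ, stepExp, ih, avg_add]

theorem pathExp_const_mul (m k : ℕ) (c : ℝ) (F : (ℕ → V) → ℝ) (w : ℕ → V) :
    G.pathExp m k (fun w => c * F w) w = c * G.pathExp m k F w := by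
  induction k generalizing m w with
  | zero => rfl
  | succ k ih => simp only [pathExp_succ, stepExp, ih, avg_const_mul]

theorem pathExp_sub (m k : ℕ) (F F' : (ℕ → V) → ℝ) (w : ℕ → V) :
    G.pathExp m k (fun w => F w - F' w) w = G.pathExp m k F w - G.pathExp m k F' w := by
  induction k generalizing m w with
  | zero => rfl
  | succ k ih => simp only [pathExp_succ, stepExp, ih, avg_sub]

theorem pathExp_sum {ι : Type*} (s : Finset ι) (m k : ℕ) (F : ι → (ℕ → V) → ℝ) (w : ℕ → V) :
    G.pathExp m k (fun w => ∑ i ∈ s, F i w) w = ∑ i ∈ s, G.pathExp m k (F i) w := by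
  classical
  induction s using Finset.induction_on with
  | empty => simpa using G.pathExp_zero_fun m k w
  | insert i s hi ih => simp only [Finset.sum_insert hi, pathExp_add, ih]

/-- `F` depends only on the part of the trajectory between the times `a` and `b`. -/
def DependsBetween (a b : ℕ) (F : (ℕ → V) → ℝ) : Prop :=
  ∀ w w' : ℕ → V, (∀ i, a ≤ i → i ≤ b → w i = w' i) → F w = F w'

theorem DependsBetween.mono {a b a' b' : ℕ} {F : (ℕ → V) → ℝ} (h : DependsBetween a b F)
    (ha : a' ≤ a) (hb : b ≤ b') : DependsBetween a' b' F :=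
  fun w w' hw => h w w' fun i hi hi' => hw i (ha.trans hi) (hi'.trans hb)

theorem DependsBetween.pathExp {a m k : ℕ} {F : (ℕ → V) → ℝ} (h : DependsBetween a (m + k) F)
    (ha : a ≤ m) : DependsBetween a m (G.pathExp m k F) := by
  induction k generalizing m with
  | zero => exact h
  | succ k ih =>
    intro w w' hw
    rw [pathExp_succ, stepExp, stepExp, hw m ha le_rfl]
    congr 1
    funext u
    refine ih (m := m + 1) (by rwa [add_right_comm, add_assoc]) (by omega) _ _ fun i hi hi' => ?_
    rcases eq_or_ne i (m + 1) with rfl | hne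
    · simp
    · rw [Function.update_of_ne hne, Function.update_of_ne hne]
      exact hw i hi (by omega)

theorem pathExp_add_steps (m k l : ℕ) (F : (ℕ → V) → ℝ) :
    G.pathExp m (k + l) F = G.pathExp m k (G.pathExp (m + k) l F) := by
  induction k generalizing m with
  | zero => simp
  | succ k ih =>
    rw [add_right_comm, pathExp_succ, pathExp_succ, ih, add_right_comm m 1 k, add_assoc m k 1]

theorem pathExp_mul_left {m k : ℕ} {H F : (ℕ → V) → ℝ} (hH : DependsBetween 0 m H) (w : ℕ → V) :
    G.pathExp m k (fun w => H w * F w) w = H w * G.pathExp m k F w := by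
  rw [← pathExp_const_mul]
  exact G.pathExp_congr fun w' hw' _ => by rw [hH w' w fun i _ hi => hw' i hi]

theorem pathExp_of_dependsBetween (hG : ∀ v, (G.out v).Nonempty) {m k : ℕ} {H : (ℕ → V) → ℝ}
    (hH : DependsBetween 0 m H) (w : ℕ → V) : G.pathExp m k H w = H w := by
  simpa [pathExp_const G hG] using G.pathExp_mul_left (k := k) (F := fun _ => 1) hH w

theorem pathExp_comp_apply (m k : ℕ) (f : V → ℝ) (w : ℕ → V) :
    G.pathExp m k (fun w => f (w (m + k))) w = (G.avg^[k] f) (w m) := by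
  induction k generalizing m w with
  | zero => rfl
  | succ k ih =>
    rw [pathExp_succ, stepExp, Function.iterate_succ_apply']
    refine G.avg_congr fun e _ => ?_
    have := ih (m + 1) (Function.update w (m + 1) (G.tgt e))
    rw [Function.update_self, add_right_comm m 1 k] at this
    exact this

open Classical in
/-- The probability that the walk from `v` visits `A` by time `N`. -/
noncomputable def hitProb (A : Set V) : ℕ → V → ℝ
  | 0, v => if v ∈ A then 1 else 0
  | N + 1, v => if v ∈ A then 1 else G.avg (hitProb A N) v

theorem hitProb_of_mem {A : Set V} (N : ℕ) {v : V} (h : v ∈ A) : G.hitProb A N v = 1 := by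
  cases N <;> simp [hitProb, h]

theorem hitProb_zero_of_notMem {A : Set V} {v : V} (h : v ∉ A) : G.hitProb A 0 v = 0 := by
  simp [hitProb, h]

theorem hitProb_succ_of_notMem {A : Set V} (N : ℕ) {v : V} (h : v ∉ A) :
    G.hitProb A (N + 1) v = G.avg (G.hitProb A N) v := by
  simp [hitProb, h]

theorem hitProb_nonneg (A : Set V) (N : ℕ) (v : V) : 0 ≤ G.hitProb A N v := by
  induction N generalizing v with
  | zero => by_cases h : v ∈ A <;> simp [hitProb, h]
  | succ N ih =>
    by_cases h : v ∈ A
    · simp [hitProb, h]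
    · rw [hitProb_succ_of_notMem G N h]; exact G.avg_nonneg ih v

theorem hitProb_le_one (hG : ∀ v, (G.out v).Nonempty) (A : Set V) (N : ℕ) (v : V) :
    G.hitProb A N v ≤ 1 := by
  induction N generalizing v with
  | zero => by_cases h : v ∈ A <;> simp [hitProb, h]
  | succ N ih =>
    by_cases h : v ∈ A
    · simp [hitProb, h]
    · rw [hitProb_succ_of_notMem G N h, ← G.avg_const hG 1 v]
      exact G.avg_le_avg fun e _ => ih _

theorem hitProb_mono_succ (A : Set V) (N : ℕ) (v : V) :
    G.hitProb A N v ≤ G.hitProb A (N + 1) v := by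
  induction N generalizing v with
  | zero =>
    by_cases h : v ∈ A
    · simp [hitProb, h]
    · rw [hitProb_zero_of_notMem G h]; exact G.hitProb_nonneg A 1 v
  | succ N ih =>
    by_cases h : v ∈ A
    · simp [hitProb, h]
    · rw [hitProb_succ_of_notMem G N h, hitProb_succ_of_notMem G _ h]
      exact G.avg_le_avg fun e _ => ih _

theorem hitProb_mono_steps (A : Set V) (v : V) : Monotone fun N => G.hitProb A N v :=
  monotone_nat_of_le_succ fun N => G.hitProb_mono_succ A N v

-- First-step analysis: off `A` the event over the window from `m` is the event over the window from
-- `m + 1`, which is the recursion of `hitProb`.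
open Classical in
theorem pathExp_hit (hG : ∀ v, (G.out v).Nonempty) (A : Set V) (m N : ℕ) (w : ℕ → V) :
    G.pathExp m N (fun w => if ∃ t, m ≤ t ∧ t ≤ m + N ∧ w t ∈ A then 1 else 0) w =
      G.hitProb A N (w m) := by
  by_cases h : w m ∈ A
  · rw [hitProb_of_mem G N h]
    refine (G.pathExp_congr (F' := fun _ => 1) fun w' hw' _ => ?_).trans (G.pathExp_const hG ..)
    have : w' m ∈ A := by rwa [hw' m le_rfl]
    rw [if_pos ⟨m, le_rfl, by omega, this⟩]
  · induction N generalizing m w with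
    | zero =>
      rw [pathExp_zero, hitProb_zero_of_notMem G h, if_neg]
      rintro ⟨t, h1, h2, h3⟩
      obtain rfl : t = m := by omega
      exact h h3
    | succ N ih =>
      rw [hitProb_succ_of_notMem G N h, pathExp_succ, stepExp]
      refine G.avg_congr fun e _ => ?_
      have key : G.pathExp (m + 1) N
          (fun w => if ∃ t, m ≤ t ∧ t ≤ m + (N + 1) ∧ w t ∈ A then (1 : ℝ) else 0)
            (Function.update w (m + 1) (G.tgt e)) = G.pathExp (m + 1) N
          (fun w => if ∃ t, m + 1 ≤ t ∧ t ≤ m + 1 + N ∧ w t ∈ A then (1 : ℝ) else 0)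
            (Function.update w (m + 1) (G.tgt e)) := by
        refine G.pathExp_congr fun w' hw' _ => ?_
        congr 1
        refine propext ⟨?_, ?_⟩
        · rintro ⟨t, h1, h2, h3⟩
          refine ⟨t, ?_, by omega, h3⟩
          rcases h1.eq_or_lt with rfl | h1
          · rw [hw' m (by omega), Function.update_of_ne (by omega)] at h3
            exact absurd h3 h
          · exact h1
        · rintro ⟨t, h1, h2, h3⟩
          exact ⟨t, by omega, by omega, h3⟩
      rw [key]
      by_cases h' : G.tgt e ∈ A
      · rw [hitProb_of_mem G N h']
        refine (G.pathExp_congr (F' := fun _ => 1) fun w' hw' _ => ?_).trans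
          (G.pathExp_const hG ..)
        have : w' (m + 1) ∈ A := by rw [hw' _ le_rfl, Function.update_self]; exact h'
        rw [if_pos ⟨m + 1, le_rfl, by omega, this⟩]
      · have := ih (m + 1) (Function.update w (m + 1) (G.tgt e)) (by rwa [Function.update_self])
        rwa [Function.update_self] at this

open Classical in
/-- The vertices within distance `n` of `x`. -/
noncomputable def ball (x : V) : ℕ → Finset V
  | 0 => {x}
  | n + 1 => ball x n ∪ (ball x n).biUnion fun v => (G.out v).image G.tgt

theorem self_mem_ball (x : V) (n : ℕ) : x ∈ G.ball x n := by
  induction n with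
  | zero => simp [ball]
  | succ n ih => simp [ball, ih]

theorem ball_mono (x : V) : Monotone (G.ball x) :=
  monotone_nat_of_le_succ fun n => by classical rw [ball]; exact Finset.subset_union_left

theorem tgt_mem_ball_succ {x : V} {n : ℕ} {v : V} (hv : v ∈ G.ball x n) {e : E}
    (he : e ∈ G.out v) : G.tgt e ∈ G.ball x (n + 1) := by
  classical
  rw [ball, Finset.mem_union]
  exact Or.inr (Finset.mem_biUnion.2 ⟨v, hv, Finset.mem_image_of_mem _ he⟩)

theorem IsPath.mem_ball {G : Network V E} {n : ℕ} {w : ℕ → V} (h : G.IsPath 0 n w) {i : ℕ}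
    (hi : i ≤ n) : w i ∈ G.ball (w 0) i := by
  induction i with
  | zero => exact G.self_mem_ball _ _
  | succ i ih =>
    obtain ⟨e, he, hte⟩ := h i (by omega) (by omega)
    rw [← hte]
    exact G.tgt_mem_ball_succ (ih (by omega)) he

/-- Doob's maximal inequality in `L²`. -/
theorem pathExp_iSup_sq_le (hG : ∀ v, (G.out v).Nonempty) {n : ℕ} {F : (ℕ → V) → ℝ}
    (hF : DependsBetween 0 n F) (x : ℕ → V) :
    G.pathExp 0 n (fun w => ((Finset.range (n + 1)).sup' Finset.nonempty_range_add_one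
      fun m => |G.pathExp m (n - m) F w|) ^ 2) x ≤ 4 * G.pathExp 0 n (fun w => F w ^ 2) x := by
  let S : ℕ → (ℕ → V) → ℝ := fun m w => |G.pathExp m (n - m) F w|
  let T : ℕ → (ℕ → V) → ℝ := fun m w =>
    (Finset.range (m + 1)).sup' Finset.nonempty_range_add_one fun m => S m w
  have hSd : ∀ m ≤ n, DependsBetween 0 m (S m) := fun m hm w w' hw => by
    have := DependsBetween.pathExp G (m := m) (k := n - m) (a := 0)
      (by rwa [Nat.add_sub_cancel' hm]) m.zero_le w w' hw
    simp only [S, this]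
  have hTd : ∀ m ≤ n, DependsBetween 0 m (T m) := fun m hm w w' hw => by
    refine Finset.sup'_congr _ rfl fun i hi => ?_
    have hi' : i ≤ m := by simpa [Nat.lt_succ_iff] using hi
    exact hSd i (hi'.trans hm) w w' fun j hj hj' => hw j hj (hj'.trans hi')
  have hTs : ∀ m w, T (m + 1) w = max (T m w) (S (m + 1) w) := fun m w => by
    simp only [T]
    rw [Finset.sup'_congr _ Finset.range_add_one fun _ _ => rfl,
      Finset.sup'_insert Finset.nonempty_range_add_one, max_comm]
  have hS0 : ∀ m w, 0 ≤ S m w := fun m w => abs_nonneg _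
  have hT0 : ∀ m w, 0 ≤ T m w := fun m w =>
    (hS0 0 w).trans (Finset.le_sup' (fun m => S m w) (by simp))
  -- The absolute value of a martingale is a submartingale.
  have hSub : ∀ m, m + 1 ≤ n → ∀ w, S m w ≤ G.pathExp m (n - m) (S (m + 1)) w := by
    intro m hm w
    have e1 : n - m = 1 + (n - (m + 1)) := by omega
    have hd := hSd (m + 1) hm
    have e2 : G.pathExp m (n - m) (S (m + 1)) w = G.pathExp m 1 (S (m + 1)) w := by
      rw [e1, pathExp_add_steps]
      exact G.pathExp_congr fun w' _ _ => G.pathExp_of_dependsBetween hG hd w'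
    rw [e2]
    simp only [S]
    rw [e1, pathExp_add_steps, abs_le]
    constructor
    · rw [neg_le, ← neg_one_mul, ← pathExp_const_mul]
      exact G.pathExp_le fun w' _ _ => by rw [neg_one_mul]; exact neg_le_abs _
    · exact G.pathExp_le fun w' _ _ => le_abs_self _
  have key : ∀ m ≤ n, G.pathExp 0 n (fun w => T m w ^ 2) x ≤
      2 * G.pathExp 0 n (fun w => T m w * S m w) x := by
    intro m hm
    induction m with
    | zero =>
      rw [← pathExp_const_mul]
      refine G.pathExp_le fun w _ _ => ?_
      have : T 0 w = S 0 w := by simp [T]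
      rw [this]
      nlinarith [hS0 0 w]
    | succ m ih =>
      have h1 : G.pathExp 0 n (fun w => T m w * S m w) x ≤
          G.pathExp 0 n (fun w => T m w * S (m + 1) w) x := by
        have e : n = m + (n - m) := by omega
        have e3 : ∀ F' : (ℕ → V) → ℝ,
            G.pathExp 0 n F' = G.pathExp 0 m (G.pathExp m (n - m) F') := fun F' => by
          conv_lhs => rw [e]
          rw [pathExp_add_steps, zero_add]
        rw [e3, e3]
        refine G.pathExp_le fun w _ _ => ?_
        rw [G.pathExp_mul_left (hTd m (by omega)), G.pathExp_mul_left (hTd m (by omega)),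
          G.pathExp_of_dependsBetween hG (hSd m (by omega))]
        exact mul_le_mul_of_nonneg_left (hSub m hm w) (hT0 m w)
      -- If the new value sets the maximum, the inequality is (S - T)² ≥ 0; otherwise it is an
      -- equality. In the mean, the submartingale property makes the last bracket at most the
      -- inductive difference, hence nonpositive.
      have h2 : G.pathExp 0 n (fun w => T (m + 1) w ^ 2) x ≤
          G.pathExp 0 n (fun w => 2 * (T (m + 1) w * S (m + 1) w) +
            (T m w ^ 2 - 2 * (T m w * S (m + 1) w))) x := by
        refine G.pathExp_le fun w _ _ => ?_
        rw [hTs m w]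
        rcases le_total (T m w) (S (m + 1) w) with h | h
        · rw [max_eq_right h]; nlinarith [sq_nonneg (S (m + 1) w - T m w)]
        · rw [max_eq_left h]; nlinarith
      simp only [pathExp_add, pathExp_sub, pathExp_const_mul] at h2
      linarith [ih (by omega)]
  have hfin := key n le_rfl
  -- 2TS ≤ T²/2 + 2S²: half of the left side is absorbed, which produces Doob's factor 4.
  have hle : 2 * G.pathExp 0 n (fun w => T n w * S n w) x ≤
      G.pathExp 0 n (fun w => (1 / 2) * T n w ^ 2 + 2 * S n w ^ 2) x := by
    rw [← pathExp_const_mul]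
    exact G.pathExp_le fun w _ _ => by nlinarith [sq_nonneg (T n w - 2 * S n w)]
  have hSn : G.pathExp 0 n (fun w => S n w ^ 2) x = G.pathExp 0 n (fun w => F w ^ 2) x :=
    G.pathExp_congr fun w _ _ => by simp [S]
  rw [pathExp_add, pathExp_const_mul, pathExp_const_mul, hSn] at hle
  change G.pathExp 0 n (fun w => T n w ^ 2) x ≤ _
  linarith

end Network

/-! ### The law of the walk as a finite path average; escape probabilities -/

namespace Network

variable {V E : Type*} (G : Network V E) [MeasurableSpace V]

theorem integral_stepLaw [DiscreteMeasurableSpace V] (hG : ∀ v, (G.out v).Nonempty) (f : V → ℝ)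
    (v : V) : ∫ u, f u ∂G.stepLaw v = G.avg f v := by
  rw [stepLaw, if_pos (hG v), integral_finsetSum_measure, avg, Finset.sum_div]
  · refine Finset.sum_congr rfl fun e _ => ?_
    rw [integral_smul_measure, integral_dirac, ENNReal.toReal_ofReal, smul_eq_mul]
    · ring
    · exact div_nonneg (G.cond_pos e).le (G.vertexCond_nonneg v)
  · intro e _
    exact (integrable_dirac (by finiteness)).smul_measure ENNReal.ofReal_ne_top

variable [DiscreteMeasurableSpace V]

instance (x : V) : IsProbabilityMeasure (G.walkLaw x) := by
  unfold walkLaw; infer_instance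

theorem walkLaw_map_succ (x : V) (n : ℕ) :
    (G.walkLaw x).map (fun w => (Preorder.frestrictLe n w, w (n + 1))) =
      ((G.walkLaw x).map (Preorder.frestrictLe n)) ⊗ₘ G.stepKernel n := by
  have h := Kernel.partialTraj_compProd_eq_map_traj (X := fun _ : ℕ => V) (κ := G.stepKernel)
    (Nat.zero_le n) (x₀ := fun _ => x)
  rw [← Kernel.traj_map_frestrictLe_apply] at h
  exact h.symm

/-- Disintegrating the last step against `stepKernel` turns it into one `stepExp`, leaving a
function of one step less for the induction. -/
theorem integral_walkLaw_of_measurable (hG : ∀ v, (G.out v).Nonempty) (x : V) (n : ℕ)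
    {f : (Finset.Iic n → V) → ℝ} (hf : Measurable f) {C : ℝ} (hC : ∀ r, |f r| ≤ C) :
    ∫ w, f (Preorder.frestrictLe (π := fun _ => V) n w) ∂G.walkLaw x =
      G.pathExp 0 n (fun w => f (Preorder.frestrictLe (π := fun _ => V) n w)) (fun _ => x) := by
  induction n with
  | zero =>
    rw [pathExp_zero]
    have h1 := integral_map (μ := G.walkLaw x) (f := f)
      (Preorder.measurable_frestrictLe (X := fun _ => V) 0).aemeasurable hf.aestronglyMeasurable
    rw [← h1, walkLaw, Kernel.traj_map_frestrictLe_apply, Kernel.partialTraj_self,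
      Kernel.id_apply, integral_dirac' _ _ hf.stronglyMeasurable]
    rfl
  | succ n ih =>
    let glue : (Finset.Iic n → V) × V → (Finset.Iic (n + 1) → V) := fun p i =>
      if h : i.1 ≤ n then p.1 ⟨i.1, Finset.mem_Iic.2 h⟩ else p.2
    have hglue : Measurable glue := by
      refine measurable_pi_lambda _ fun i => ?_
      by_cases h : i.1 ≤ n
      · simp only [glue, h, dite_true]
        exact (measurable_pi_apply _).comp measurable_fst
      · simp only [glue, h, dite_false]
        exact measurable_snd
    have hgl : ∀ w : ℕ → V, Preorder.frestrictLe (π := fun _ => V) (n + 1) w =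
        glue (Preorder.frestrictLe (π := fun _ => V) n w, w (n + 1)) := by
      intro w
      funext i
      have hi := Finset.mem_Iic.1 i.2
      by_cases h : i.1 ≤ n
      · simp [glue, h]
      · have : i.1 = n + 1 := by omega
        simp [glue, this]
    have hfg : Measurable (f ∘ glue) := hf.comp hglue
    simp_rw [hgl]
    have h1 := integral_map (μ := G.walkLaw x) (f := f ∘ glue)
      (φ := fun w => (Preorder.frestrictLe (π := fun _ => V) n w, w (n + 1)))
      (by fun_prop) hfg.aestronglyMeasurable
    simp only [Function.comp_apply] at h1
    rw [← h1, walkLaw_map_succ, Measure.integral_compProd]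
    swap
    · have hp : IsProbabilityMeasure ((G.walkLaw x).map
          (Preorder.frestrictLe (π := fun _ => V) n)) :=
        Measure.isProbabilityMeasure_map (Preorder.measurable_frestrictLe n).aemeasurable
      exact Integrable.of_bound hfg.aestronglyMeasurable C (ae_of_all _ fun p => hC _)
    have hk : ∀ r : Finset.Iic n → V, ∫ u, f (glue (r, u)) ∂G.stepKernel n r =
        G.avg (fun u => f (glue (r, u))) (r ⟨n, Finset.mem_Iic.2 le_rfl⟩) := fun r =>
      G.integral_stepLaw hG _ _
    have hm : Measurable fun r : Finset.Iic n → V =>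
        ∫ u, f (glue (r, u)) ∂G.stepKernel n r :=
      (StronglyMeasurable.integral_kernel_prod_right' (κ := G.stepKernel n)
        hfg.stronglyMeasurable).measurable
    rw [integral_map (Preorder.measurable_frestrictLe n).aemeasurable hm.aestronglyMeasurable,
      ih hm, pathExp_add_steps]
    · refine G.pathExp_congr fun w _ _ => ?_
      rw [hk, zero_add, pathExp_succ, pathExp_zero, stepExp]
      refine G.avg_congr fun e _ => ?_
      rw [Function.update_self]
      congr 3
      funext i
      have hi := Finset.mem_Iic.1 i.2
      simp only [Preorder.frestrictLe_apply]
      rw [Function.update_of_ne (by omega)]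
    · intro r
      rw [hk]
      have habs : ∀ u, |f (glue (r, u))| ≤ C := fun u => hC _
      rw [abs_le]
      constructor
      · rw [← G.avg_const hG (-C) (r ⟨n, Finset.mem_Iic.2 le_rfl⟩)]
        exact G.avg_le_avg fun e _ => (abs_le.1 (habs _)).1
      · rw [← G.avg_const hG C (r ⟨n, Finset.mem_Iic.2 le_rfl⟩)]
        exact G.avg_le_avg fun e _ => (abs_le.1 (habs _)).2

/-- The expectation of a function of the first `n` steps, for which no measurability is needed
since these take finitely many values. -/
theorem integral_walkLaw (hG : ∀ v, (G.out v).Nonempty) (x : V) {n : ℕ} {F : (ℕ → V) → ℝ}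
    (hF : DependsBetween 0 n F) :
    AEStronglyMeasurable F (G.walkLaw x) ∧
      ∫ w, F w ∂G.walkLaw x = G.pathExp 0 n F (fun _ => x) := by
  classical
  -- By time `n` the walk has stayed in a finite ball, so almost surely its first `n` steps lie in a
  -- finite set of trajectories; off that set `F` may be replaced by 0, which makes it measurable
  -- and bounded.
  let T : Set (Finset.Iic n → V) := Set.pi Set.univ fun _ => (G.ball x n : Set V)
  have hT : T.Finite := Set.Finite.pi fun _ => (G.ball x n).finite_toSet
  have hTm : MeasurableSet T := hT.measurableSet
  have hpath : ∀ w, (∀ i ≤ 0, w i = x) → G.IsPath 0 n w →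
      Preorder.frestrictLe (π := fun _ => V) n w ∈ T := by
    intro w hw hp i _
    have := hp.mem_ball (Finset.mem_Iic.1 i.2)
    rw [hw 0 le_rfl] at this
    exact G.ball_mono x (Finset.mem_Iic.1 i.2) this
  have hmass : ∫ w, T.indicator (fun _ => (1 : ℝ)) (Preorder.frestrictLe (π := fun _ => V) n w)
      ∂G.walkLaw x = 1 := by
    rw [G.integral_walkLaw_of_measurable hG x n (measurable_const.indicator hTm) (C := 1)]
    · refine (G.pathExp_congr (F' := fun _ => 1) fun w hw hp => ?_).trans
        (G.pathExp_const hG ..)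
      rw [Set.indicator_of_mem (hpath w hw hp)]
    · intro r
      by_cases h : r ∈ T <;> simp [h]
  have hae : ∀ᵐ w ∂G.walkLaw x, Preorder.frestrictLe (π := fun _ => V) n w ∈ T := by
    have hpre : MeasurableSet (Preorder.frestrictLe (π := fun _ => V) n ⁻¹' T) :=
      Preorder.measurable_frestrictLe n hTm
    have h1 : (G.walkLaw x).real (Preorder.frestrictLe (π := fun _ => V) n ⁻¹' T) = 1 := by
      rw [← hmass, ← integral_indicator_one hpre]
      rfl
    have h2 : G.walkLaw x (Preorder.frestrictLe (π := fun _ => V) n ⁻¹' T) = 1 := by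
      rw [measureReal_def] at h1
      rw [← ENNReal.ofReal_toReal (measure_ne_top (G.walkLaw x) _), h1, ENNReal.ofReal_one]
    exact (prob_compl_eq_zero_iff hpre).2 h2
  let ext : (Finset.Iic n → V) → ℕ → V := fun r i =>
    if h : i ≤ n then r ⟨i, Finset.mem_Iic.2 h⟩ else x
  have hext : ∀ w, F (ext (Preorder.frestrictLe (π := fun _ => V) n w)) = F w := fun w =>
    hF _ _ fun i _ hi => by simp [ext, hi]
  let f : (Finset.Iic n → V) → ℝ := T.indicator fun r => F (ext r)
  have hf : Measurable f := by
    have : f = fun r => ∑ t ∈ hT.toFinset, Set.indicator {t} (fun _ => F (ext t)) r := by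
      funext r
      by_cases h : r ∈ T
      · rw [Finset.sum_eq_single r]
        · simp [f, h]
        · intro t _ hne; simp [hne.symm]
        · intro h'; exact absurd (hT.mem_toFinset.2 h) h'
      · rw [Finset.sum_eq_zero]
        · simp [f, h]
        · intro t ht
          have : r ≠ t := fun e => h (e ▸ hT.mem_toFinset.1 ht)
          simp [this]
    rw [this]
    exact Finset.measurable_sum _ fun t _ => measurable_const.indicator (measurableSet_singleton t)
  obtain ⟨C, hC⟩ : ∃ C, ∀ r, |f r| ≤ C := by
    refine ⟨∑ t ∈ hT.toFinset, |F (ext t)|, fun r => ?_⟩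
    by_cases h : r ∈ T
    · simp only [f, Set.indicator_of_mem h]
      exact Finset.single_le_sum (f := fun t => |F (ext t)|) (fun _ _ => abs_nonneg _)
        (hT.mem_toFinset.2 h)
    · simp only [f, Set.indicator_of_notMem h, abs_zero]
      exact Finset.sum_nonneg fun _ _ => abs_nonneg _
  have hEq : F =ᵐ[G.walkLaw x] fun w => f (Preorder.frestrictLe (π := fun _ => V) n w) := by
    filter_upwards [hae] with w hw
    simp only [f, Set.indicator_of_mem hw, hext]
  refine ⟨⟨_, (hf.comp (Preorder.measurable_frestrictLe n)).stronglyMeasurable, hEq⟩, ?_⟩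
  rw [integral_congr_ae hEq, G.integral_walkLaw_of_measurable hG x n hf hC]
  refine G.pathExp_congr fun w hw hp => ?_
  simp only [f, Set.indicator_of_mem (hpath w hw hp), hext]

theorem integral_eq_pathExp (hG : ∀ v, (G.out v).Nonempty) {x : V} {Ω : Type*}
    [MeasurableSpace Ω] {P : Measure Ω} {X : ℕ → Ω → V}
    (hX : HasLaw (fun ω t => X t ω) (G.walkLaw x) P) {n : ℕ} {F : (ℕ → V) → ℝ}
    (hF : DependsBetween 0 n F) :
    ∫ ω, F (fun t => X t ω) ∂P = G.pathExp 0 n F (fun _ => x) := by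
  rw [← (G.integral_walkLaw hG x hF).2]
  exact hX.integral_comp (G.integral_walkLaw hG x hF).1

/-- At an isolated vertex `stepLaw` keeps the walk in place, so it would return at time 1. -/
theorem IsTransient.out_nonempty {G : Network V E} (h : G.IsTransient) (v : V) :
    (G.out v).Nonempty := by
  by_contra hv
  refine (h v).ne' ?_
  have h1 : G.walkLaw v ((fun w : ℕ → V => w 1) ⁻¹' {v}ᶜ) = 0 := by
    have e := Kernel.map_traj_succ_self (X := fun _ : ℕ => V) (κ := G.stepKernel) (a := 0)
    have e' := congrArg (fun κ => κ (fun _ => v) {v}ᶜ) e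
    rw [Kernel.map_apply' _ (measurable_pi_apply _) _ (MeasurableSet.of_discrete)] at e'
    refine e'.trans ?_
    change G.stepLaw v {v}ᶜ = 0
    rw [stepLaw, if_neg hv, Measure.dirac_apply' _ MeasurableSet.of_discrete]
    simp
  rw [escapeProb, measureReal_eq_zero_iff]
  refine measure_mono_null (fun w hw => ?_) h1
  exact hw 1 le_rfl

/-- The first step is taken freely, since a visit at time 0 does not count; after it, avoidance is
the complement of hitting within `k` steps. -/
theorem measureReal_avoid (hG : ∀ v, (G.out v).Nonempty) (A : Set V) (v : V) (k : ℕ) :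
    (G.walkLaw v).real {w | ∀ t, 1 ≤ t → t ≤ k + 1 → w t ∉ A} =
      1 - G.avg (G.hitProb A k) v := by
  classical
  have hm : MeasurableSet {w : ℕ → V | ∀ t, 1 ≤ t → t ≤ k + 1 → w t ∉ A} := by
    simp only [Set.ofPred_forall]
    refine MeasurableSet.iInter fun t => MeasurableSet.iInter fun _ => MeasurableSet.iInter
      fun _ => ?_
    exact measurable_pi_apply (X := fun _ : ℕ => V) t (MeasurableSet.of_discrete (s := Aᶜ))
  have hdep : DependsBetween 0 (k + 1)
      ({w : ℕ → V | ∀ t, 1 ≤ t → t ≤ k + 1 → w t ∉ A}.indicator (1 : (ℕ → V) → ℝ)) := by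
    intro w w' h
    have : (∀ t, 1 ≤ t → t ≤ k + 1 → w t ∉ A) ↔ ∀ t, 1 ≤ t → t ≤ k + 1 → w' t ∉ A :=
      forall_congr' fun t => forall_congr' fun _ => forall_congr' fun h2 => by
        rw [h t t.zero_le h2]
    simp [Set.indicator_apply, this]
  rw [← integral_indicator_one hm, (G.integral_walkLaw hG v hdep).2, pathExp_succ, stepExp,
    ← G.avg_const hG 1 v, ← avg_sub]
  refine G.avg_congr fun e _ => ?_
  have := G.pathExp_hit hG A 1 k (Function.update (fun _ => v) 1 (G.tgt e))
  rw [Function.update_self] at this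
  rw [zero_add, ← this, ← G.pathExp_const hG 1 k 1
    (Function.update (fun _ => v) 1 (G.tgt e)), ← pathExp_sub]
  refine G.pathExp_congr fun w _ _ => ?_
  rw [G.pathExp_const hG]
  by_cases h : ∃ t, 1 ≤ t ∧ t ≤ 1 + k ∧ w t ∈ A
  · rw [if_pos h, Set.indicator_of_notMem]
    · simp
    · obtain ⟨t, h1, h2, h3⟩ := h
      exact fun hw => hw t h1 (by omega) h3
  · rw [if_neg h, Set.indicator_of_mem]
    · simp
    · exact fun t h1 h2 h3 => h ⟨t, h1, by omega, h3⟩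

theorem tendsto_escapeProb (hG : ∀ v, (G.out v).Nonempty) (A : Set V) (v : V) :
    Filter.Tendsto (fun k => 1 - G.avg (G.hitProb A k) v) Filter.atTop
      (nhds (G.escapeProb A v)) := by
  have hset : {w : ℕ → V | ∀ t, 1 ≤ t → w t ∉ A} =
      ⋂ k : ℕ, {w | ∀ t, 1 ≤ t → t ≤ k + 1 → w t ∉ A} := by
    ext w
    simp only [Set.mem_ofPred_eq, Set.mem_iInter]
    exact ⟨fun h k t h1 _ => h t h1, fun h t h1 => h t t h1 (by omega)⟩
  simp_rw [← G.measureReal_avoid hG A v]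
  rw [escapeProb, hset]
  refine (ENNReal.tendsto_toReal (measure_ne_top _ _)).comp
    (tendsto_measure_iInter_atTop (fun k => ?_) (fun k l hkl w hw t h1 h2 => ?_)
      ⟨0, measure_ne_top _ _⟩)
  · simp only [Set.ofPred_forall]
    refine (MeasurableSet.iInter fun t => MeasurableSet.iInter fun _ => MeasurableSet.iInter
      fun _ => ?_).nullMeasurableSet
    exact measurable_pi_apply (X := fun _ : ℕ => V) t (MeasurableSet.of_discrete (s := Aᶜ))
  · exact hw t h1 (by omega)

theorem escapeProb_nonneg (A : Set V) (v : V) : 0 ≤ G.escapeProb A v := measureReal_nonneg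

theorem escapeProb_le_one (A : Set V) (v : V) : G.escapeProb A v ≤ 1 := measureReal_le_one

end Network

/-! ### Potential theory of the killed walk in a finite set -/

namespace Network

variable {V E : Type*} (G : Network V E)

theorem mem_out {e : E} {v : V} : e ∈ G.out v ↔ G.src e = v := by simp [out]

theorem tgt_rev (e : E) : G.tgt (G.rev e) = G.src e := by rw [← G.src_rev, G.rev_rev]

/-- The Laplacian of the network in which the walk is killed at each step with probability
`1 - lam`. -/
noncomputable def killedLap (lam : ℝ) (f : V → ℝ) (u : V) : ℝ :=
  G.vertexCond u * f u - lam * ∑ e ∈ G.out u, G.cond e * f (G.tgt e)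

theorem killedLap_add (lam : ℝ) (f g : V → ℝ) (u : V) :
    G.killedLap lam (fun v => f v + g v) u = G.killedLap lam f u + G.killedLap lam g u := by
  simp only [killedLap, mul_add, Finset.sum_add_distrib]; ring

theorem killedLap_const_mul (lam c : ℝ) (f : V → ℝ) (u : V) :
    G.killedLap lam (fun v => c * f v) u = c * G.killedLap lam f u := by
  simp only [killedLap, mul_left_comm _ c, ← Finset.mul_sum]; ring

theorem killedLap_sub (lam : ℝ) (f g : V → ℝ) (u : V) :
    G.killedLap lam (fun v => f v - g v) u = G.killedLap lam f u - G.killedLap lam g u := by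
  simp only [killedLap, mul_sub, Finset.sum_sub_distrib]; ring

theorem killedLap_zero (lam : ℝ) (u : V) : G.killedLap lam (fun _ => 0) u = 0 := by
  simp [killedLap]

theorem killedLap_sum {ι : Type*} (s : Finset ι) (lam : ℝ) (f : ι → V → ℝ) (u : V) :
    G.killedLap lam (fun v => ∑ i ∈ s, f i v) u = ∑ i ∈ s, G.killedLap lam (f i) u := by
  classical
  induction s using Finset.induction_on with
  | empty => simpa using G.killedLap_zero lam u
  | insert i s hi ih => simp only [Finset.sum_insert hi, killedLap_add, ih]

/-- The maximum principle. -/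
theorem nonneg_of_killedLap_nonneg (hG : ∀ v, (G.out v).Nonempty) (W : Finset V) {lam : ℝ}
    (h0 : 0 ≤ lam) (h1 : lam < 1) {A : Set V} {f : V → ℝ} (hoff : ∀ u ∉ W, 0 ≤ f u)
    (hA : ∀ u ∈ W, u ∈ A → 0 ≤ f u) (hQ : ∀ u ∈ W, u ∉ A → 0 ≤ G.killedLap lam f u) (u : V) :
    0 ≤ f u := by
  by_contra! hu
  have huW : u ∈ W := by by_contra h; exact absurd (hoff u h) (not_le.2 hu)
  -- At a negative minimum `v` the neighbours lie no lower, so the killed Laplacian is at most (1 -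
  -- lam) c(v) f(v) < 0. Strictness comes from `lam < 1`.
  obtain ⟨v, hvW, hv⟩ := W.exists_min_image f ⟨u, huW⟩
  have hv0 : f v < 0 := (hv u huW).trans_lt hu
  have hvA : v ∉ A := fun h => absurd (hA v hvW h) (not_le.2 hv0)
  have hge : ∀ z, f v ≤ f z := fun z => by
    by_cases hz : z ∈ W
    · exact hv z hz
    · exact hv0.le.trans (hoff z hz)
  have hsum : G.vertexCond v * f v ≤ ∑ e ∈ G.out v, G.cond e * f (G.tgt e) := by
    rw [vertexCond, Finset.sum_mul]
    exact Finset.sum_le_sum fun e _ => mul_le_mul_of_nonneg_left (hge _) (G.cond_pos e).le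
  have hc := G.vertexCond_pos (hG v)
  have h2 := hQ v hvW hvA
  rw [killedLap] at h2
  have h3 := mul_le_mul_of_nonneg_left hsum h0
  nlinarith [mul_pos hc (mul_pos (sub_pos.2 h1) (neg_pos.2 hv0))]

/-- The Dirichlet problem in the finite set `W` has a solution. -/
theorem exists_killedLap_eq (hG : ∀ v, (G.out v).Nonempty) (W : Finset V) {lam : ℝ}
    (h0 : 0 ≤ lam) (h1 : lam < 1) (A : Set V) (b : V → ℝ) :
    ∃ f : V → ℝ, (∀ u ∉ W, f u = 0) ∧
      ∀ u ∈ W, (u ∈ A → f u = b u) ∧ (u ∉ A → G.killedLap lam f u = b u) := by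
  classical
  let ext : (W → ℝ) → V → ℝ := fun f u => if h : u ∈ W then f ⟨u, h⟩ else 0
  have ext_add : ∀ f g, ext (f + g) = fun v => ext f v + ext g v := fun f g => by
    funext v; by_cases h : v ∈ W <;> simp [ext, h]
  have ext_smul : ∀ (c : ℝ) f, ext (c • f) = fun v => c * ext f v := fun c f => by
    funext v; by_cases h : v ∈ W <;> simp [ext, h]
  let L : (W → ℝ) →ₗ[ℝ] (W → ℝ) :=
    { toFun := fun f u => if (u : V) ∈ A then f u else G.killedLap lam (ext f) u
      map_add' := fun f g => by
        funext u
        by_cases h : (u : V) ∈ A <;> simp [h, ext_add, killedLap_add]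
      map_smul' := fun c f => by
        funext u
        by_cases h : (u : V) ∈ A <;> simp [h, ext_smul, killedLap_const_mul] }
  -- The maximum principle for `f` and `-f` gives uniqueness; in finite dimension, uniqueness gives
  -- existence.
  have key : ∀ f, L f = 0 → ∀ u, 0 ≤ ext f u := by
    intro f hf
    have hz : ∀ u : W, L f u = 0 := fun u => by rw [hf]; rfl
    refine G.nonneg_of_killedLap_nonneg hG W h0 h1 (A := A) (fun u hu => by simp [ext, hu])
      (fun u hu huA => ?_) fun u hu huA => ?_
    · have := hz ⟨u, hu⟩
      simp only [L, LinearMap.coe_mk, AddHom.coe_mk, huA, if_true] at this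
      simp [ext, hu, this]
    · have := hz ⟨u, hu⟩
      simp only [L, LinearMap.coe_mk, AddHom.coe_mk, huA, if_false] at this
      exact this.ge
  have hinj : Function.Injective L := by
    rw [injective_iff_map_eq_zero]
    intro f hf
    funext u
    have p := key f hf u
    have q := key (-f) (by rw [map_neg, hf, neg_zero]) u
    simp only [ext, u.2, dite_true, Subtype.coe_eta, Pi.neg_apply] at p q
    exact le_antisymm (neg_nonneg.1 q) p
  obtain ⟨f, hf⟩ := (LinearMap.injective_iff_surjective.1 hinj) fun u => b u
  refine ⟨ext f, fun u hu => by simp [ext, hu], fun u hu => ⟨fun huA => ?_, fun huA => ?_⟩⟩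
  · have := congrFun hf ⟨u, hu⟩
    simp only [L, LinearMap.coe_mk, AddHom.coe_mk, huA, if_true] at this
    simp [ext, hu, this]
  · have := congrFun hf ⟨u, hu⟩
    simpa only [L, LinearMap.coe_mk, AddHom.coe_mk, huA, if_false] using this

/-- The Dirichlet form of the killed walk in `W`. -/
noncomputable def dirForm (W : Finset V) (lam : ℝ) (f h : V → ℝ) : ℝ :=
  ∑ u ∈ W, f u * G.killedLap lam h u

open Classical in
/-- The rate at which the killed walk leaves `W` or is killed. -/
noncomputable def killRate (W : Finset V) (lam : ℝ) (u : V) : ℝ :=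
  G.vertexCond u - lam * ∑ e ∈ G.out u with G.tgt e ∈ W, G.cond e

open Classical in
/-- The oriented edges inside `W`. -/
noncomputable def innerEdges (W : Finset V) : Finset E :=
  (W.biUnion G.out).filter fun e => G.tgt e ∈ W

theorem mem_innerEdges {W : Finset V} {e : E} :
    e ∈ G.innerEdges W ↔ G.src e ∈ W ∧ G.tgt e ∈ W := by
  classical
  simp [innerEdges, mem_out]

theorem killRate_nonneg (W : Finset V) {lam : ℝ} (h1 : lam ≤ 1) (u : V) :
    0 ≤ G.killRate W lam u := by
  classical
  have h2 : ∑ e ∈ G.out u with G.tgt e ∈ W, G.cond e ≤ G.vertexCond u :=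
    Finset.sum_le_sum_of_subset_of_nonneg (Finset.filter_subset _ _)
      fun e _ _ => (G.cond_pos e).le
  have h3 : 0 ≤ ∑ e ∈ G.out u with G.tgt e ∈ W, G.cond e :=
    Finset.sum_nonneg fun e _ => (G.cond_pos e).le
  rw [killRate]
  nlinarith

open Classical in
theorem sum_innerEdges (W : Finset V) (φ : E → ℝ) :
    ∑ e ∈ G.innerEdges W, φ e = ∑ u ∈ W, ∑ e ∈ G.out u with G.tgt e ∈ W, φ e := by
  have : G.innerEdges W = W.biUnion fun u => (G.out u).filter fun e => G.tgt e ∈ W := by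
    ext e; simp [mem_innerEdges, mem_out]
  rw [this, Finset.sum_biUnion]
  intro u _ v _ huv
  rw [Function.onFun, Finset.disjoint_left]
  intro e he he'
  simp only [Finset.mem_filter, mem_out] at he he'
  exact huv (he.1.symm.trans he'.1)

theorem sum_innerEdges_rev (W : Finset V) (φ : E → ℝ) :
    ∑ e ∈ G.innerEdges W, φ (G.rev e) = ∑ e ∈ G.innerEdges W, φ e := by
  refine Finset.sum_nbij' G.rev G.rev (fun e he => ?_) (fun e he => ?_) (fun e _ => G.rev_rev e)
    (fun e _ => G.rev_rev e) fun e _ => rfl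
  all_goals
    rw [mem_innerEdges] at he ⊢
    rw [G.src_rev, G.tgt_rev]
    exact he.symm

/-- Summation by parts: reversal of the inner edges symmetrises the sum, and the edges leaving `W`,
on whose targets `h` vanishes, join the killing in `killRate`. The result has nonnegative weights
when 0 ≤ `lam` ≤ 1, so for `f = h` it is a sum of squares; symmetry, positivity and the transfer of
Doob's inequality all rest on it. -/
theorem dirForm_eq (W : Finset V) (lam : ℝ) {f h : V → ℝ} (hh : ∀ u ∉ W, h u = 0) :
    G.dirForm W lam f h = ∑ u ∈ W, G.killRate W lam u * (f u * h u) +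
      lam / 2 * ∑ e ∈ G.innerEdges W, G.cond e *
        ((f (G.src e) - f (G.tgt e)) * (h (G.src e) - h (G.tgt e))) := by
  classical
  have e1 : ∀ u ∈ W, f u * G.killedLap lam h u = G.killRate W lam u * (f u * h u) +
      lam * ∑ e ∈ G.out u with G.tgt e ∈ W,
        G.cond e * (f (G.src e) * (h (G.src e) - h (G.tgt e))) := by
    intro u _
    have a1 : ∑ e ∈ G.out u, G.cond e * h (G.tgt e) =
        ∑ e ∈ G.out u with G.tgt e ∈ W, G.cond e * h (G.tgt e) := by
      rw [Finset.sum_filter]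
      refine Finset.sum_congr rfl fun e _ => ?_
      split_ifs with hW
      · rfl
      · rw [hh _ hW, mul_zero]
    have a2 : ∑ e ∈ G.out u with G.tgt e ∈ W,
        G.cond e * (f (G.src e) * (h (G.src e) - h (G.tgt e))) =
        f u * h u * ∑ e ∈ G.out u with G.tgt e ∈ W, G.cond e -
          f u * ∑ e ∈ G.out u with G.tgt e ∈ W, G.cond e * h (G.tgt e) := by
      rw [Finset.mul_sum, Finset.mul_sum, ← Finset.sum_sub_distrib]
      refine Finset.sum_congr rfl fun e he => ?_
      rw [Finset.mem_filter, mem_out] at he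
      rw [he.1]; ring
    rw [killedLap, killRate, a1, a2]; ring
  have e2 : ∑ e ∈ G.innerEdges W, G.cond e * (f (G.src e) * (h (G.src e) - h (G.tgt e))) =
      ∑ e ∈ G.innerEdges W, G.cond e * (f (G.tgt e) * (h (G.tgt e) - h (G.src e))) := by
    rw [← sum_innerEdges_rev]
    refine Finset.sum_congr rfl fun e _ => ?_
    rw [G.cond_rev, G.src_rev, G.tgt_rev]
  have e3 : ∑ e ∈ G.innerEdges W, G.cond e *
        ((f (G.src e) - f (G.tgt e)) * (h (G.src e) - h (G.tgt e))) =
      2 * ∑ e ∈ G.innerEdges W, G.cond e * (f (G.src e) * (h (G.src e) - h (G.tgt e))) := by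
    rw [two_mul]
    nth_rw 2 [e2]
    rw [← Finset.sum_add_distrib]
    refine Finset.sum_congr rfl fun e _ => by ring
  rw [dirForm, Finset.sum_congr rfl e1, Finset.sum_add_distrib, ← Finset.mul_sum,
    ← sum_innerEdges, e3]
  ring

theorem dirForm_comm (W : Finset V) (lam : ℝ) {f h : V → ℝ} (hf : ∀ u ∉ W, f u = 0)
    (hh : ∀ u ∉ W, h u = 0) : G.dirForm W lam f h = G.dirForm W lam h f := by
  rw [dirForm_eq G W lam hh, dirForm_eq G W lam hf]
  simp only [mul_comm (f _) (h _), mul_comm (f _ - f _) (h _ - h _)]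

theorem dirForm_self_nonneg (W : Finset V) {lam : ℝ} (h0 : 0 ≤ lam) (h1 : lam ≤ 1) {f : V → ℝ}
    (hf : ∀ u ∉ W, f u = 0) : 0 ≤ G.dirForm W lam f f := by
  rw [dirForm_eq G W lam hf]
  refine add_nonneg (Finset.sum_nonneg fun u _ =>
    mul_nonneg (G.killRate_nonneg W h1 u) (mul_self_nonneg _))
    (mul_nonneg (by positivity) (Finset.sum_nonneg fun e _ =>
      mul_nonneg (G.cond_pos e).le (mul_self_nonneg _)))

theorem dirForm_sum_right {ι : Type*} (s : Finset ι) (W : Finset V) (lam : ℝ) (f : V → ℝ)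
    (c : ι → ℝ) (h : ι → V → ℝ) : G.dirForm W lam f (fun v => ∑ i ∈ s, c i * h i v) =
      ∑ i ∈ s, c i * G.dirForm W lam f (h i) := by
  simp only [dirForm, killedLap_sum, killedLap_const_mul, Finset.mul_sum]
  rw [Finset.sum_comm]
  exact Finset.sum_congr rfl fun i _ => Finset.sum_congr rfl fun u _ => by ring

theorem dirForm_avg_right (W : Finset V) (lam : ℝ) (f : V → ℝ) (h : V → V → ℝ) (v : V) :
    G.dirForm W lam f (fun z => G.avg (fun u => h u z) v) =
      G.avg (fun u => G.dirForm W lam f (h u)) v := by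
  simp only [avg, Finset.sum_div]
  have := G.dirForm_sum_right (G.out v) W lam f (fun e => G.cond e / G.vertexCond v)
    fun e => h (G.tgt e)
  simp only [div_mul_eq_mul_div] at this
  exact this

/-- The weighted Cauchy–Schwarz inequality. -/
theorem two_mul_dirForm_le (W : Finset V) {lam : ℝ} (h0 : 0 ≤ lam) (h1 : lam ≤ 1) {f h : V → ℝ}
    (hf : ∀ u ∉ W, f u = 0) (hh : ∀ u ∉ W, h u = 0) (t : ℝ) :
    2 * t * G.dirForm W lam f h ≤ G.dirForm W lam f f + t ^ 2 * G.dirForm W lam h h := by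
  have h2 := G.dirForm_self_nonneg W h0 h1 (f := fun u => f u - t * h u)
    fun u hu => by rw [hf u hu, hh u hu]; ring
  have h3 : G.dirForm W lam (fun u => f u - t * h u) (fun u => f u - t * h u) =
      G.dirForm W lam f f - t * G.dirForm W lam f h - t * G.dirForm W lam h f +
        t ^ 2 * G.dirForm W lam h h := by
    simp only [dirForm, killedLap_sub, killedLap_const_mul, Finset.mul_sum,
      ← Finset.sum_sub_distrib, ← Finset.sum_add_distrib]
    exact Finset.sum_congr rfl fun u _ => by ring
  rw [h3, G.dirForm_comm W lam hh hf] at h2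
  linarith

section Potentials

variable (W : Finset V) (lam : ℝ)

open Classical in
/-- The Green kernel of the killed walk in `W`, with pole `v`. -/
noncomputable def green (v : V) : V → ℝ :=
  if h : (∀ v, (G.out v).Nonempty) ∧ 0 ≤ lam ∧ lam < 1 then
    (G.exists_killedLap_eq h.1 W h.2.1 h.2.2 ∅ (Pi.single v 1)).choose else 0

open Classical in
/-- The probability that the killed walk in `W` visits `A`. -/
noncomputable def killedHit (A : Set V) : V → ℝ :=
  if h : (∀ v, (G.out v).Nonempty) ∧ 0 ≤ lam ∧ lam < 1 then
    (G.exists_killedLap_eq h.1 W h.2.1 h.2.2 A (A.indicator 1)).choose else 0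

/-- The capacity for the killed walk in `W`. -/
noncomputable def killedCap (A : Set V) : ℝ :=
  G.dirForm W lam (G.killedHit W lam A) (G.killedHit W lam A)

variable {W lam} (hG : ∀ v, (G.out v).Nonempty) (h0 : 0 ≤ lam) (h1 : lam < 1)

include hG h0 h1

theorem green_spec (v : V) : (∀ u ∉ W, G.green W lam v u = 0) ∧
    (∀ u ∈ W, u ≠ v → G.killedLap lam (G.green W lam v) u = 0) ∧
      (v ∈ W → G.killedLap lam (G.green W lam v) v = 1) := by
  classical
  have hs := (G.exists_killedLap_eq hG W h0 h1 ∅ (Pi.single v 1)).choose_spec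
  have e : G.green W lam v = (G.exists_killedLap_eq hG W h0 h1 ∅ (Pi.single v 1)).choose := by
    rw [green, dif_pos ⟨hG, h0, h1⟩]
  rw [← e] at hs
  refine ⟨hs.1, fun u hu hne => ?_, fun hv => ?_⟩
  · rw [(hs.2 u hu).2 (Set.notMem_empty u), Pi.single_eq_of_ne hne]
  · rw [(hs.2 v hv).2 (Set.notMem_empty v), Pi.single_eq_same]

theorem green_off {u : V} (v : V) (hu : u ∉ W) : G.green W lam v u = 0 :=
  (G.green_spec hG h0 h1 v).1 u hu

theorem killedLap_green_nonneg (v : V) {u : V} (hu : u ∈ W) :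
    0 ≤ G.killedLap lam (G.green W lam v) u := by
  obtain ⟨-, h3, h4⟩ := G.green_spec (W := W) hG h0 h1 v
  rcases eq_or_ne u v with rfl | hne
  · rw [h4 hu]; exact zero_le_one
  · rw [h3 u hu hne]

theorem green_nonneg (v u : V) : 0 ≤ G.green W lam v u :=
  G.nonneg_of_killedLap_nonneg hG W h0 h1 (A := ∅)
    (fun _ hu => (G.green_off hG h0 h1 v hu).ge) (fun _ _ h => h.elim)
    (fun _ hu _ => G.killedLap_green_nonneg hG h0 h1 v hu) u

/-- The reproducing property: pairing with the potential of a measure is integration against that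
measure. All energies below are computed through it. -/
theorem dirForm_green (f : V → ℝ) {v : V} (hv : v ∈ W) :
    G.dirForm W lam f (G.green W lam v) = f v := by
  obtain ⟨-, h3, h4⟩ := G.green_spec (W := W) hG h0 h1 v
  rw [dirForm, Finset.sum_eq_single v]
  · rw [h4 hv, mul_one]
  · intro u hu hne; rw [h3 u hu hne, mul_zero]
  · intro h; exact absurd hv h

theorem green_comm {u v : V} (hu : u ∈ W) (hv : v ∈ W) :
    G.green W lam u v = G.green W lam v u := by
  rw [← G.dirForm_green hG h0 h1 (G.green W lam u) hv,
    ← G.dirForm_green hG h0 h1 (G.green W lam v) hu]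
  exact G.dirForm_comm W lam (fun z hz => G.green_off hG h0 h1 u hz)
    fun z hz => G.green_off hG h0 h1 v hz

theorem killedHit_spec (A : Set V) : (∀ u ∉ W, G.killedHit W lam A u = 0) ∧
    (∀ u ∈ W, u ∈ A → G.killedHit W lam A u = 1) ∧
      (∀ u ∈ W, u ∉ A → G.killedLap lam (G.killedHit W lam A) u = 0) := by
  classical
  have hs := (G.exists_killedLap_eq hG W h0 h1 A (A.indicator 1)).choose_spec
  have e : G.killedHit W lam A =
      (G.exists_killedLap_eq hG W h0 h1 A (A.indicator 1)).choose := by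
    rw [killedHit, dif_pos ⟨hG, h0, h1⟩]
  rw [← e] at hs
  refine ⟨hs.1, fun u hu hA => ?_, fun u hu hA => ?_⟩
  · rw [(hs.2 u hu).1 hA, Set.indicator_of_mem hA, Pi.one_apply]
  · rw [(hs.2 u hu).2 hA, Set.indicator_of_notMem hA]

theorem killedHit_nonneg (A : Set V) (u : V) : 0 ≤ G.killedHit W lam A u := by
  obtain ⟨h2, h3, h4⟩ := G.killedHit_spec (W := W) hG h0 h1 A
  exact G.nonneg_of_killedLap_nonneg hG W h0 h1 (A := A) (fun u hu => (h2 u hu).ge)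
    (fun u hu hA => by rw [h3 u hu hA]; exact zero_le_one) (fun u hu hA => (h4 u hu hA).ge) u

/-- The killed hitting probability is the least supersolution of its Dirichlet problem. -/
theorem killedHit_le {A : Set V} {f : V → ℝ} (hf : ∀ u, 0 ≤ f u) (hA : ∀ u ∈ A, 1 ≤ f u)
    (hQ : ∀ u ∈ W, u ∉ A → 0 ≤ G.killedLap lam f u) (u : V) : G.killedHit W lam A u ≤ f u := by
  obtain ⟨h2, h3, h4⟩ := G.killedHit_spec (W := W) hG h0 h1 A
  have := G.nonneg_of_killedLap_nonneg hG W h0 h1 (A := A)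
    (f := fun u => f u - G.killedHit W lam A u)
    (fun u hu => by rw [h2 u hu, sub_zero]; exact hf u)
    (fun u hu huA => by rw [h3 u hu huA]; linarith [hA u huA])
    (fun u hu huA => by rw [killedLap_sub, h4 u hu huA, sub_zero]; exact hQ u hu huA) u
  linarith

theorem killedHit_le_one (A : Set V) (u : V) : G.killedHit W lam A u ≤ 1 := by
  refine G.killedHit_le hG h0 h1 (fun _ => zero_le_one) (fun _ _ => le_rfl) (fun u _ _ => ?_) u
  simp only [killedLap, mul_one]
  change 0 ≤ G.vertexCond u - lam * G.vertexCond u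
  nlinarith [G.vertexCond_nonneg u]

/-- These values are the masses of the equilibrium measure of `A` in `W`. On `A` the sign comes from
0 ≤ `killedHit` ≤ 1; off `A` the function is harmonic for the killed walk. -/
theorem killedLap_killedHit_nonneg (A : Set V) {u : V} (hu : u ∈ W) :
    0 ≤ G.killedLap lam (G.killedHit W lam A) u := by
  obtain ⟨h2, h3, h4⟩ := G.killedHit_spec (W := W) hG h0 h1 A
  by_cases hA : u ∈ A
  · have h5 : ∑ e ∈ G.out u, G.cond e * G.killedHit W lam A (G.tgt e) ≤ G.vertexCond u := by
      refine Finset.sum_le_sum fun e _ => ?_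
      exact mul_le_of_le_one_right (G.cond_pos e).le (G.killedHit_le_one hG h0 h1 A _)
    have h6 : 0 ≤ ∑ e ∈ G.out u, G.cond e * G.killedHit W lam A (G.tgt e) :=
      Finset.sum_nonneg fun e _ => mul_nonneg (G.cond_pos e).le
        (G.killedHit_nonneg hG h0 h1 A _)
    rw [killedLap, h3 u hu hA]
    nlinarith
  · rw [h4 u hu hA]

theorem killedLap_killedHit_le (A : Set V) (u : V) :
    G.killedLap lam (G.killedHit W lam A) u ≤ G.vertexCond u := by
  have h6 : 0 ≤ ∑ e ∈ G.out u, G.cond e * G.killedHit W lam A (G.tgt e) :=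
    Finset.sum_nonneg fun e _ => mul_nonneg (G.cond_pos e).le (G.killedHit_nonneg hG h0 h1 A _)
  have h7 := G.killedHit_le_one (W := W) hG h0 h1 A u
  have h8 := G.vertexCond_nonneg u
  rw [killedLap]
  nlinarith [mul_nonneg h0 h6]

theorem dirForm_killedHit (f : V → ℝ) {A : Finset V} (hA : A ⊆ W) :
    G.dirForm W lam f (G.killedHit W lam A) =
      ∑ u ∈ A, f u * G.killedLap lam (G.killedHit W lam A) u := by
  obtain ⟨h2, h3, h4⟩ := G.killedHit_spec (W := W) hG h0 h1 (A : Set V)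
  rw [dirForm]
  refine (Finset.sum_subset hA fun u hu huA => ?_).symm
  rw [h4 u hu (by simpa using huA), mul_zero]

theorem killedCap_eq {A : Finset V} (hA : A ⊆ W) :
    G.killedCap W lam A = ∑ u ∈ A, G.killedLap lam (G.killedHit W lam A) u := by
  obtain ⟨h2, h3, h4⟩ := G.killedHit_spec (W := W) hG h0 h1 (A : Set V)
  rw [killedCap, G.dirForm_killedHit hG h0 h1 _ hA]
  exact Finset.sum_congr rfl fun u hu => by rw [h3 u (hA hu) (by simpa using hu), one_mul]

/-- The lower bound on the capacity of a set by the energy of a measure that it carries: `ψ` is the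
potential of the measure. -/
theorem le_killedCap {A : Set V} {ψ : V → ℝ} (hψ : ∀ u ∉ W, ψ u = 0) (t : ℝ) :
    2 * t * G.dirForm W lam (G.killedHit W lam A) ψ - t ^ 2 * G.dirForm W lam ψ ψ ≤
      G.killedCap W lam A := by
  have := G.two_mul_dirForm_le W h0 h1.le (G.killedHit_spec (W := W) hG h0 h1 A).1 hψ t
  rw [killedCap]; linarith

end Potentials

end Network

/-! ### Loop-erasure of a deterministic path and of its continuation -/

section LoopErasure

variable {V : Type*}

theorem le_lastVisit (w : ℕ → V) {m i : ℕ} (hi : i ≤ m) : i ≤ lastVisit w m i := by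
  classical exact Nat.le_findGreatest hi rfl

theorem lastVisit_le (w : ℕ → V) (m i : ℕ) : lastVisit w m i ≤ m := by
  classical exact Nat.findGreatest_le m

theorem apply_lastVisit (w : ℕ → V) {m i : ℕ} (hi : i ≤ m) : w (lastVisit w m i) = w i := by
  classical exact Nat.findGreatest_spec (P := fun k => w k = w i) hi rfl

theorem lastVisit_congr {w w' : ℕ → V} {m i : ℕ} (hi : i ≤ m) (h : ∀ j ≤ m, w j = w' j) :
    lastVisit w m i = lastVisit w' m i := by
  have key : ∀ {w w' : ℕ → V}, (∀ j ≤ m, w j = w' j) → lastVisit w m i ≤ lastVisit w' m i := by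
    classical
    intro w w' h
    refine Nat.le_findGreatest (lastVisit_le w m i) ?_
    rw [← h _ (lastVisit_le w m i), ← h i hi]
    exact apply_lastVisit w hi
  exact le_antisymm (key h) (key fun j hj => (h j hj).symm)

theorem lastVisit_eq_of_notMem {w : ℕ → V} {m n i : ℕ} (hmn : m ≤ n) (hi : i ≤ m)
    (h : ∀ t, m ≤ t → t ≤ n → w t ≠ w i) : lastVisit w n i = lastVisit w m i := by
  classical
  refine le_antisymm ?_ ?_
  · refine Nat.le_findGreatest ?_ (apply_lastVisit w (hi.trans hmn))
    by_contra! hlt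
    exact h _ hlt.le (lastVisit_le w n i) (apply_lastVisit w (hi.trans hmn))
  · exact Nat.le_findGreatest ((lastVisit_le w m i).trans hmn) (apply_lastVisit w hi)

theorem loopErasureTime_succ {w : ℕ → V} {m k l : ℕ} (h : loopErasureTime w m k = some l) :
    loopErasureTime w m (k + 1) =
      if lastVisit w m l = m then none else some (1 + lastVisit w m l) := by
  rw [loopErasureTime, h, Option.bind_some]

theorem loopErasureTime_le {w : ℕ → V} {m k l : ℕ} (h : loopErasureTime w m k = some l) :
    l ≤ m := by
  induction k generalizing l with
  | zero => rw [loopErasureTime, Option.some.injEq] at h; omega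
  | succ k ih =>
    cases hk : loopErasureTime w m k with
    | none => rw [loopErasureTime, hk] at h; simp at h
    | some l' =>
      rw [loopErasureTime_succ hk] at h
      have := lastVisit_le w m l'
      split_ifs at h with h'
      rw [Option.some.injEq] at h
      omega

theorem loopErasureTime_congr {w w' : ℕ → V} {m : ℕ} (h : ∀ j ≤ m, w j = w' j) (k : ℕ) :
    loopErasureTime w m k = loopErasureTime w' m k := by
  induction k with
  | zero => rfl
  | succ k ih =>
    cases hk : loopErasureTime w m k with
    | none => rw [loopErasureTime, loopErasureTime, ← ih, hk]; rfl
    | some l =>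
      rw [loopErasureTime_succ hk, loopErasureTime_succ (ih ▸ hk),
        lastVisit_congr (loopErasureTime_le hk) h]

theorem loopErasure_congr {w w' : ℕ → V} {m : ℕ} (h : ∀ j ≤ m, w j = w' j) (k : ℕ) :
    loopErasure w m k = loopErasure w' m k := by
  rw [loopErasure, loopErasure, ← loopErasureTime_congr h]
  cases hk : loopErasureTime w m k with
  | none => rfl
  | some l => rw [Option.map_some, Option.map_some, h l (loopErasureTime_le hk)]

/-- The loop-erasure ends where the path ends. -/
theorem exists_loopErasure_eq_end (w : ℕ → V) (m : ℕ) : ∃ k, loopErasure w m k = some (w m) := by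
  have key : ∀ d k l, loopErasureTime w m k = some l → m - l ≤ d →
      ∃ k, loopErasure w m k = some (w m) := by
    intro d
    induction d with
    | zero =>
      intro k l hk hd
      have := loopErasureTime_le hk
      obtain rfl : l = m := by omega
      exact ⟨k, by rw [loopErasure, hk, Option.map_some]⟩
    | succ d ih =>
      intro k l hk hd
      have hl := loopErasureTime_le hk
      by_cases h : lastVisit w m l = m
      · refine ⟨k, ?_⟩
        have := apply_lastVisit w hl
        rw [h] at this
        rw [loopErasure, hk, Option.map_some, this]
      · refine ih (k + 1) (1 + lastVisit w m l) ?_ ?_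
        · rw [loopErasureTime_succ hk, if_neg h]
        · have := le_lastVisit w hl
          omega
  exact key m 0 0 rfl (by omega)

/-- The first `k + 1` vertices of the loop-erasure of `w` stopped at time `m`. -/
def loopErasurePrefix (w : ℕ → V) (m k : ℕ) : Set V :=
  {v | ∃ i ≤ k, loopErasure w m i = some v}

theorem loopErasurePrefix_mono (w : ℕ → V) (m : ℕ) : Monotone (loopErasurePrefix w m) :=
  fun _ _ hkl _ ⟨i, hi, h⟩ => ⟨i, hi.trans hkl, h⟩

theorem loopErasurePrefix_congr {w w' : ℕ → V} {m : ℕ} (h : ∀ j ≤ m, w j = w' j) :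
    loopErasurePrefix w m = loopErasurePrefix w' m := by
  funext k
  simp only [loopErasurePrefix, loopErasure_congr h]

/-- The least index on the loop-erasure of `w` stopped at time `m` that is visited by `w` between
the times `m` and `n`. -/
noncomputable def survivingIndex (w : ℕ → V) (m n : ℕ) : ℕ :=
  sInf {k | ∃ t, m ≤ t ∧ t ≤ n ∧ w t ∈ loopErasurePrefix w m k}

theorem survivingIndex_le_iff (w : ℕ → V) {m n : ℕ} (hmn : m ≤ n) (k : ℕ) :
    survivingIndex w m n ≤ k ↔ ∃ t, m ≤ t ∧ t ≤ n ∧ w t ∈ loopErasurePrefix w m k := by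
  constructor
  · intro h
    -- The time `t = m` itself is allowed, and the loop-erasure ends at `w m`; so the set is never
    -- empty and `sInf` does not take its default value.
    have hne : {k | ∃ t, m ≤ t ∧ t ≤ n ∧ w t ∈ loopErasurePrefix w m k}.Nonempty := by
      obtain ⟨k, hk⟩ := exists_loopErasure_eq_end w m
      exact ⟨k, m, le_rfl, hmn, k, le_rfl, hk⟩
    obtain ⟨t, h1, h2, h3⟩ := Nat.sInf_mem hne
    exact ⟨t, h1, h2, loopErasurePrefix_mono w m h h3⟩
  · intro h
    exact Nat.sInf_le h

/-- The loop-erasure of a path up to the index that the continuation of the path reaches stays in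
the loop-erasure of the continued path. -/
theorem loopErasurePrefix_survivingIndex_subset (w : ℕ → V) {m n : ℕ} (hmn : m ≤ n) :
    loopErasurePrefix w m (survivingIndex w m n) ⊆ loopErasureVertices w n := by
  classical
  -- A vertex strictly below the surviving index is not visited between `m` and `n`, so its last
  -- visit, and with it the next loop-erasure time, is unchanged by the continuation.
  have key : ∀ i ≤ survivingIndex w m n, loopErasureTime w n i = loopErasureTime w m i := by
    intro i
    induction i with
    | zero => intro _; rfl
    | succ i ih =>
      intro hi
      have ih := ih (by omega)
      cases hk : loopErasureTime w m i with
      | none => rw [loopErasureTime, loopErasureTime, ih, hk]; rfl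
      | some l =>
        have hl := loopErasureTime_le hk
        have hno : ∀ t, m ≤ t → t ≤ n → w t ≠ w l := by
          intro t h1 h2 h3
          have : survivingIndex w m n ≤ i := (survivingIndex_le_iff w hmn i).2
            ⟨t, h1, h2, i, le_rfl, by rw [loopErasure, hk, Option.map_some, h3]⟩
          omega
        -- A last visit at `m` would itself be a visit in the window, so neither loop-erasure stops
        -- at this index.
        have hlt : lastVisit w m l ≠ m := fun h => by
          have := apply_lastVisit w hl
          rw [h] at this
          exact hno m le_rfl hmn this
        have hlt' := lastVisit_le w m l
        rw [loopErasureTime_succ hk, loopErasureTime_succ (ih.trans hk),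
          lastVisit_eq_of_notMem hmn hl hno, if_neg hlt, if_neg (by omega)]
  rintro v ⟨i, hi, hv⟩
  have hv' : loopErasure w n i = some v := by rw [loopErasure, key i hi]; exact hv
  obtain ⟨l, hl, hlv⟩ := Option.map_eq_some_iff.1 hv'
  rw [SetLike.mem_coe, loopErasureVertices, Finset.mem_filter]
  refine ⟨Finset.mem_image.2 ⟨l, ?_, hlv⟩, i, hv'⟩
  rw [Finset.mem_range]
  exact Nat.lt_succ_of_le (loopErasureTime_le hl)

theorem mem_pathVertices {w : ℕ → V} {n : ℕ} {v : V} :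
    v ∈ pathVertices w n ↔ ∃ i ≤ n, w i = v := by
  classical
  simp [pathVertices]

theorem loopErasureVertices_subset (w : ℕ → V) (n : ℕ) :
    loopErasureVertices w n ⊆ pathVertices w n := by
  classical exact Finset.filter_subset _ _

theorem pathVertices_congr {w w' : ℕ → V} {n : ℕ} (h : ∀ j ≤ n, w j = w' j) :
    pathVertices w n = pathVertices w' n := by
  ext v
  simp only [mem_pathVertices]
  exact exists_congr fun i => and_congr_right fun hi => by rw [h i hi]

theorem loopErasureVertices_congr {w w' : ℕ → V} {n : ℕ} (h : ∀ j ≤ n, w j = w' j) :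
    loopErasureVertices w n = loopErasureVertices w' n := by
  classical
  simp only [loopErasureVertices, pathVertices_congr h, loopErasure_congr h]

open Classical in
/-- A sum over the vertices of a path, as a sum over the times of their first visits. -/
theorem sum_pathVertices (w : ℕ → V) (n : ℕ) (f : V → ℝ) :
    ∑ v ∈ pathVertices w n, f v =
      ∑ m ∈ Finset.range (n + 1), if ∀ i < m, w i ≠ w m then f (w m) else 0 := by
  induction n with
  | zero => simp [pathVertices]
  | succ n ih =>
    have e : pathVertices w (n + 1) = insert (w (n + 1)) (pathVertices w n) := by
      rw [pathVertices, Finset.range_add_one, Finset.image_insert]; rfl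
    rw [Finset.sum_range_succ, ← ih, e]
    by_cases h : w (n + 1) ∈ pathVertices w n
    · rw [Finset.insert_eq_of_mem h, if_neg, add_zero]
      obtain ⟨i, hi, hw⟩ := mem_pathVertices.1 h
      exact fun h' => h' i (by omega) hw
    · rw [Finset.sum_insert h, if_pos, add_comm]
      exact fun i hi hw => h (mem_pathVertices.2 ⟨i, by omega, hw⟩)

end LoopErasure

/-! ### Comparison of the killed walk with the free walk -/

namespace Network

variable {V E : Type*} (G : Network V E)

/-- The probability that the walk ever visits `A`. -/
noncomputable def hitEver (A : Set V) (v : V) : ℝ := ⨆ N, G.hitProb A N v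

section

variable (hG : ∀ v, (G.out v).Nonempty)
include hG

theorem tendsto_hitProb (A : Set V) (v : V) :
    Filter.Tendsto (fun N => G.hitProb A N v) Filter.atTop (nhds (G.hitEver A v)) :=
  tendsto_atTop_ciSup (G.hitProb_mono_steps A v)
    ⟨1, by rintro _ ⟨N, rfl⟩; exact G.hitProb_le_one hG A N v⟩

theorem tendsto_avg_hitProb (A : Set V) (v : V) :
    Filter.Tendsto (fun N => G.avg (G.hitProb A N) v) Filter.atTop
      (nhds (G.avg (G.hitEver A) v)) := by
  unfold avg
  exact (tendsto_finsetSum _ fun e _ => (G.tendsto_hitProb hG A _).const_mul _).div_const _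

theorem hitEver_of_mem {A : Set V} {v : V} (h : v ∈ A) : G.hitEver A v = 1 :=
  tendsto_nhds_unique (G.tendsto_hitProb hG A v)
    (by simp only [G.hitProb_of_mem _ h]; exact tendsto_const_nhds)

theorem hitEver_of_notMem {A : Set V} {v : V} (h : v ∉ A) :
    G.hitEver A v = G.avg (G.hitEver A) v := by
  refine tendsto_nhds_unique
    ((Filter.tendsto_add_atTop_iff_nat 1).2 (G.tendsto_hitProb hG A v)) ?_
  simp only [G.hitProb_succ_of_notMem _ h]
  exact G.tendsto_avg_hitProb hG A v

theorem hitEver_nonneg (A : Set V) (v : V) : 0 ≤ G.hitEver A v :=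
  ge_of_tendsto' (G.tendsto_hitProb hG A v) fun N => G.hitProb_nonneg A N v

theorem hitEver_le_one (A : Set V) (v : V) : G.hitEver A v ≤ 1 :=
  le_of_tendsto' (G.tendsto_hitProb hG A v) fun N => G.hitProb_le_one hG A N v

theorem escapeProb_eq [MeasurableSpace V] [DiscreteMeasurableSpace V] (A : Set V) (v : V) :
    G.escapeProb A v = 1 - G.avg (G.hitEver A) v :=
  tendsto_nhds_unique (G.tendsto_escapeProb hG A v)
    (tendsto_const_nhds.sub (G.tendsto_avg_hitProb hG A v))

theorem killedLap_eq_avg (lam : ℝ) (f : V → ℝ) (u : V) :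
    G.killedLap lam f u = G.vertexCond u * (f u - lam * G.avg f u) := by
  rw [killedLap, ← G.vertexCond_mul_avg hG]; ring

variable {W : Finset V} {lam : ℝ} (h0 : 0 ≤ lam) (h1 : lam < 1)
include h0 h1

/-- Off `A`, `hitEver` is harmonic and nonnegative, hence a supersolution for the killed walk, of
which `killedHit` is the least. -/
theorem killedHit_le_hitEver (A : Set V) (u : V) : G.killedHit W lam A u ≤ G.hitEver A u := by
  refine G.killedHit_le hG h0 h1 (G.hitEver_nonneg hG A)
    (fun u hu => (G.hitEver_of_mem hG hu).ge) (fun u _ huA => ?_) u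
  rw [G.killedLap_eq_avg hG, ← G.hitEver_of_notMem hG huA]
  exact mul_nonneg (G.vertexCond_nonneg u) (by nlinarith [G.hitEver_nonneg hG A u])

/-- Killing and stopping at the boundary of `W` only lower the chance of returning to `A`. -/
theorem capacity_le_killedCap [MeasurableSpace V] [DiscreteMeasurableSpace V] {A : Finset V}
    (hA : A ⊆ W) : G.capacity A ≤ G.killedCap W lam A := by
  rw [capacity, G.killedCap_eq hG h0 h1 hA]
  refine Finset.sum_le_sum fun u hu => ?_
  rw [G.killedLap_eq_avg hG, (G.killedHit_spec hG h0 h1 _).2.1 u (hA hu) (by simpa using hu),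
    G.escapeProb_eq hG]
  refine mul_le_mul_of_nonneg_left ?_ (G.vertexCond_nonneg u)
  have h2 : G.avg (G.killedHit W lam A) u ≤ G.avg (G.hitEver A) u :=
    G.avg_le_avg fun e _ => G.killedHit_le_hitEver hG h0 h1 _ _
  have h3 : 0 ≤ G.avg (G.killedHit W lam A) u := G.avg_nonneg (G.killedHit_nonneg hG h0 h1 _) u
  nlinarith

/-- During `N` steps from `v` the walk cannot leave `W`, and it survives them with probability `lam
^ N`. -/
theorem pow_mul_hitProb_le {x : V} {A : Set V} {N j : ℕ} (hW : G.ball x (j + N) ⊆ W) {v : V}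
    (hv : v ∈ G.ball x j) : lam ^ N * G.hitProb A N v ≤ G.killedHit W lam A v := by
  obtain ⟨-, h3, h4⟩ := G.killedHit_spec (W := W) hG h0 h1 A
  have hvW : v ∈ W := hW (G.ball_mono x (by omega) hv)
  by_cases hA : v ∈ A
  · rw [h3 v hvW hA, G.hitProb_of_mem N hA, mul_one]
    exact pow_le_one₀ h0 h1.le
  induction N generalizing j v with
  | zero => rw [G.hitProb_zero_of_notMem hA, mul_zero]; exact G.killedHit_nonneg hG h0 h1 A v
  | succ N ih =>
    have hl := h4 v hvW hA
    rw [G.killedLap_eq_avg hG, mul_eq_zero] at hl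
    have hl' := hl.resolve_left (G.vertexCond_pos (hG v)).ne'
    rw [G.hitProb_succ_of_notMem N hA, pow_succ', mul_assoc, ← avg_const_mul]
    have : G.avg (fun u => lam ^ N * G.hitProb A N u) v ≤ G.avg (G.killedHit W lam A) v := by
      refine G.avg_le_avg fun e he => ?_
      have hW' : G.ball x (j + 1 + N) ⊆ W := by rwa [add_right_comm]
      have ht := G.tgt_mem_ball_succ hv he
      have htW : G.tgt e ∈ W := hW' (G.ball_mono x (by omega) ht)
      by_cases hA' : G.tgt e ∈ A
      · rw [h3 _ htW hA', G.hitProb_of_mem N hA', mul_one]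
        exact pow_le_one₀ h0 h1.le
      · exact ih hW' ht htW hA'
    nlinarith

/-- The first step and the `k` steps after it stay in `W`, so the return probability loses at most
the factor `lam ^ (k + 1)`. This is the converse of `capacity_le_killedCap` once `lam` → 1 and `k` →
∞. -/
theorem killedCap_le {x : V} {n k : ℕ} {A : Finset V} (hA : A ⊆ G.ball x n)
    (hW : G.ball x (n + 1 + k) ⊆ W) : G.killedCap W lam A ≤
      ∑ u ∈ A, G.vertexCond u * (1 - lam ^ (k + 1) * G.avg (G.hitProb A k) u) := by
  have hAW : A ⊆ W := hA.trans ((G.ball_mono x (by omega)).trans hW)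
  rw [G.killedCap_eq hG h0 h1 hAW]
  refine Finset.sum_le_sum fun u hu => ?_
  rw [G.killedLap_eq_avg hG, (G.killedHit_spec hG h0 h1 _).2.1 u (hAW hu) (by simpa using hu)]
  refine mul_le_mul_of_nonneg_left ?_ (G.vertexCond_nonneg u)
  have : G.avg (fun z => lam ^ k * G.hitProb A k z) u ≤ G.avg (G.killedHit W lam A) u :=
    G.avg_le_avg fun e he =>
      G.pow_mul_hitProb_le hG h0 h1 hW (G.tgt_mem_ball_succ (hA hu) he)
  rw [avg_const_mul] at this
  rw [pow_succ', mul_assoc]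
  nlinarith

end

/-! ### Balayage of point masses -/

section Sweep

variable (W : Finset V) (lam : ℝ)

open Classical in
/-- The potential of the hitting law of `A` by the killed walk in `W` from `v` within `N` steps. -/
noncomputable def sweep (A : Set V) : ℕ → V → V → ℝ
  | 0, v => if v ∈ W ∧ v ∈ A then G.green W lam v else 0
  | N + 1, v => if v ∈ W then
      if v ∈ A then G.green W lam v else fun z => lam * G.avg (fun u => sweep A N u z) v
    else 0

variable {W lam} (hG : ∀ v, (G.out v).Nonempty) (h0 : 0 ≤ lam) (h1 : lam < 1)
include hG h0 h1

theorem sweep_off (A : Set V) (N : ℕ) (v : V) {z : V} (hz : z ∉ W) :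
    G.sweep W lam A N v z = 0 := by
  induction N generalizing v with
  | zero => rw [sweep]; split_ifs; exacts [G.green_off hG h0 h1 v hz, rfl]
  | succ N ih =>
    rw [sweep]
    split_ifs
    · exact G.green_off hG h0 h1 v hz
    · simp only [ih]; rw [avg_zero, mul_zero]
    · rfl

omit hG h0 h1 in
theorem killedLap_const_mul_avg (c : ℝ) (h : V → V → ℝ) (v z : V) :
    G.killedLap lam (fun z => c * G.avg (fun u => h u z) v) z =
      c * G.avg (fun u => G.killedLap lam (h u) z) v := by
  rw [killedLap_const_mul]
  congr 1
  simp only [avg, Finset.sum_div]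
  rw [killedLap_sum]
  refine Finset.sum_congr rfl fun e _ => ?_
  simp only [mul_div_right_comm]
  rw [killedLap_const_mul]

theorem killedLap_sweep_nonneg (A : Set V) (N : ℕ) (v : V) {z : V} (hz : z ∈ W) :
    0 ≤ G.killedLap lam (G.sweep W lam A N v) z := by
  induction N generalizing v with
  | zero =>
    rw [sweep]
    split_ifs
    exacts [G.killedLap_green_nonneg hG h0 h1 v hz, (G.killedLap_zero lam z).ge]
  | succ N ih =>
    rw [sweep]
    split_ifs
    · exact G.killedLap_green_nonneg hG h0 h1 v hz
    · rw [killedLap_const_mul_avg]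
      exact mul_nonneg h0 (G.avg_nonneg (fun u => ih u) v)
    · exact (G.killedLap_zero lam z).ge

omit hG h0 h1 in
theorem dirForm_const_mul_avg_right (f : V → ℝ) (c : ℝ) (h : V → V → ℝ) (v : V) :
    G.dirForm W lam f (fun z => c * G.avg (fun u => h u z) v) =
      c * G.avg (fun u => G.dirForm W lam f (h u)) v := by
  rw [← G.dirForm_avg_right W lam f h v]
  simp only [dirForm, killedLap_const_mul, Finset.mul_sum]
  exact Finset.sum_congr rfl fun u _ => by ring

omit hG h0 h1 in
theorem dirForm_zero_right (f : V → ℝ) : G.dirForm W lam f 0 = 0 :=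
  Finset.sum_eq_zero fun u _ => by
    change f u * G.killedLap lam (fun _ => 0) u = 0
    rw [killedLap_zero, mul_zero]

/-- The left side is the integral of `f` against the swept point mass. A nonnegative superharmonic
function does not increase in the mean up to the hitting time, and paths that miss `A` contribute
nothing. Hence sweeping cannot raise energy. -/
theorem dirForm_sweep_le (A : Set V) {f : V → ℝ} (hf : ∀ u, 0 ≤ f u)
    (hQ : ∀ u ∈ W, 0 ≤ G.killedLap lam f u) (N : ℕ) (v : V) :
    G.dirForm W lam f (G.sweep W lam A N v) ≤ f v := by
  induction N generalizing v with
  | zero =>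
    rw [sweep]
    split_ifs with h
    · exact (G.dirForm_green hG h0 h1 f h.1).le
    · rw [dirForm_zero_right]; exact hf v
  | succ N ih =>
    rw [sweep]
    split_ifs with h hA
    · exact (G.dirForm_green hG h0 h1 f h).le
    · rw [G.dirForm_const_mul_avg_right]
      have h2 := hQ v h
      rw [G.killedLap_eq_avg hG] at h2
      have h3 := nonneg_of_mul_nonneg_right h2 (G.vertexCond_pos (hG v))
      have h4 := mul_le_mul_of_nonneg_left (G.avg_le_avg (v := v)
        (f := fun u => G.dirForm W lam f (G.sweep W lam A N u)) fun e _ => ih (G.tgt e)) h0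
      linarith
    · rw [dirForm_zero_right]; exact hf v

/-- With `f = 1` on `A` the pairing is the mass of the swept measure, the killed hitting probability
within `N` steps. -/
theorem le_dirForm_sweep {A : Set V} {f : V → ℝ} (hf : ∀ u ∈ W, u ∈ A → f u = 1) {x : V}
    {N j : ℕ} (hW : G.ball x (j + N) ⊆ W) {v : V} (hv : v ∈ G.ball x j) :
    lam ^ N * G.hitProb A N v ≤ G.dirForm W lam f (G.sweep W lam A N v) := by
  have hvW : v ∈ W := hW (G.ball_mono x (by omega) hv)
  induction N generalizing j v with
  | zero =>
    rw [sweep]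
    split_ifs with h
    · rw [G.dirForm_green hG h0 h1 f h.1, hf v h.1 h.2, G.hitProb_of_mem _ h.2]; simp
    · rw [dirForm_zero_right, G.hitProb_zero_of_notMem fun hA => h ⟨hvW, hA⟩, mul_zero]
  | succ N ih =>
    rw [sweep, if_pos hvW]
    split_ifs with hA
    · rw [G.dirForm_green hG h0 h1 f hvW, hf v hvW hA, G.hitProb_of_mem _ hA, mul_one]
      exact pow_le_one₀ h0 h1.le
    · rw [G.dirForm_const_mul_avg_right, G.hitProb_succ_of_notMem N hA, pow_succ',
        mul_assoc, ← avg_const_mul]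
      refine mul_le_mul_of_nonneg_left (G.avg_le_avg fun e he => ?_) h0
      have hW' : G.ball x (j + 1 + N) ⊆ W := by rwa [add_right_comm]
      have ht := G.tgt_mem_ball_succ hv he
      exact ih hW' ht (hW' (G.ball_mono x (by omega) ht))

theorem sweep_nonneg (A : Set V) (N : ℕ) (v z : V) : 0 ≤ G.sweep W lam A N v z :=
  G.nonneg_of_killedLap_nonneg hG W h0 h1 (A := ∅)
    (fun _ hu => (G.sweep_off hG h0 h1 A N v hu).ge) (fun _ _ h => h.elim)
    (fun _ hu _ => G.killedLap_sweep_nonneg hG h0 h1 A N v hu) z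

end Sweep

theorem pathExp_split {m n : ℕ} (hmn : m ≤ n) (F : (ℕ → V) → ℝ) :
    G.pathExp 0 n F = G.pathExp 0 m (G.pathExp m (n - m) F) := by
  have := G.pathExp_add_steps 0 m (n - m) F
  rwa [Nat.add_sub_cancel' hmn, zero_add] at this

/-- Replacing a function by its conditional expectation given the walk up to time `m`, next to a
function of the walk up to time `m`. -/
theorem pathExp_mul_pathExp (hG : ∀ v, (G.out v).Nonempty) {m n : ℕ} (hmn : m ≤ n)
    {H F : (ℕ → V) → ℝ} (hH : DependsBetween 0 m H) (hF : DependsBetween 0 n F) (w : ℕ → V) :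
    G.pathExp 0 n (fun w => H w * F w) w =
      G.pathExp 0 n (fun w => H w * G.pathExp m (n - m) F w) w := by
  rw [G.pathExp_split hmn, G.pathExp_split hmn]
  refine G.pathExp_congr fun w' _ _ => ?_
  have hd : DependsBetween 0 m (G.pathExp m (n - m) F) :=
    DependsBetween.pathExp G (by rwa [Nat.add_sub_cancel' hmn]) m.zero_le
  rw [G.pathExp_mul_left hH, G.pathExp_mul_left hH, G.pathExp_of_dependsBetween hG hd]

/-- Two independent continuations of a path are equally likely to reach lower on its loop-erasure:
the second one reaches at least as low as the first with probability at least `1 / 2`. -/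
theorem half_le_pathExp_hitProb (hG : ∀ v, (G.out v).Nonempty) {m n : ℕ} (hmn : m ≤ n)
    (w : ℕ → V) : 1 / 2 ≤ G.pathExp m (n - m) (fun w' => G.hitProb
      (loopErasurePrefix w' m (survivingIndex w' m n)) (n - m) (w' m)) w := by
  classical
  obtain ⟨K, hK⟩ := exists_loopErasure_eq_end w m
  let q : ℕ → ℝ := fun k => G.hitProb (loopErasurePrefix w m k) (n - m) (w m)
  have hqK : q K = 1 := G.hitProb_of_mem _ ⟨K, le_rfl, hK⟩
  have hq0 : ∀ k, 0 ≤ q k := fun k => G.hitProb_nonneg _ _ _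
  -- The actual continuation and the independent copy have the same law, so one function `q` is both
  -- the distribution function of the surviving index and the hitting probability of the prefix.
  have hq : ∀ k, G.pathExp m (n - m) (fun w' => if survivingIndex w' m n ≤ k then 1 else 0) w =
      q k := by
    intro k
    change _ = G.hitProb _ _ (w m)
    rw [← G.pathExp_hit hG]
    refine G.pathExp_congr fun w' hw' _ => ?_
    rw [Nat.add_sub_cancel' hmn]
    simp only [survivingIndex_le_iff w' hmn, loopErasurePrefix_congr hw']
  -- Abel summation makes the random index enter only through the events J ≤ k, whose probabilities
  -- are `q k`.
  have htel : ∀ J ≤ K, q J =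
      1 - ∑ k ∈ Finset.range K, (q (k + 1) - q k) * (if J ≤ k then 1 else 0) := by
    intro J hJ
    have hsum : ∀ L, J ≤ L →
        ∑ k ∈ Finset.range L, (q (k + 1) - q k) * (if J ≤ k then (1 : ℝ) else 0) =
          q L - q J := by
      intro L hL
      induction L, hL using Nat.le_induction with
      | base =>
        rw [sub_self]
        exact Finset.sum_eq_zero fun k hk => by
          rw [if_neg (by simpa using hk), mul_zero]
      | succ L hL ih => rw [Finset.sum_range_succ, ih, if_pos hL]; ring
    rw [hsum K hJ, hqK]; ring
  have hE : G.pathExp m (n - m) (fun w' => G.hitProb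
      (loopErasurePrefix w' m (survivingIndex w' m n)) (n - m) (w' m)) w =
      1 - ∑ k ∈ Finset.range K, (q (k + 1) - q k) * q k := by
    rw [G.pathExp_congr (F' := fun w' => 1 - ∑ k ∈ Finset.range K,
      (q (k + 1) - q k) * (if survivingIndex w' m n ≤ k then 1 else 0)),
      pathExp_sub, G.pathExp_const hG, pathExp_sum]
    · simp only [pathExp_const_mul, hq]
    · intro w' hw' _
      rw [loopErasurePrefix_congr hw', hw' m le_rfl]
      refine htel _ ((survivingIndex_le_iff w' hmn K).2 ⟨m, le_rfl, hmn, ?_⟩)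
      rw [loopErasurePrefix_congr hw', hw' m le_rfl]
      exact ⟨K, le_rfl, hK⟩
  rw [hE]
  -- This is (a - b)² ≥ 0; the sum then telescopes to (1 - q(0)²)/2, leaving at least 1/2.
  have hle : ∀ k ∈ Finset.range K, (q (k + 1) - q k) * q k ≤
      (q (k + 1) ^ 2 - q k ^ 2) / 2 := fun k _ => by nlinarith [sq_nonneg (q (k + 1) - q k)]
  have h2 := Finset.sum_le_sum hle
  rw [← Finset.sum_div, Finset.sum_range_sub (fun k => q k ^ 2), hqK] at h2
  nlinarith [hq0 0]

/-! ### The averaged equilibrium measure and its potential -/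

section

variable (W : Finset V) (lam : ℝ) (x : V) (n : ℕ)

open Classical in
/-- The charge that the killed equilibrium measure of the path up to time `n` puts on the vertex
visited at time `m`, if this is the first visit. -/
noncomputable def charge (m : ℕ) (w : ℕ → V) : ℝ :=
  if ∀ i < m, w i ≠ w m then
    G.killedLap lam (G.killedHit W lam (pathVertices w n)) (w m) else 0

open Classical in
/-- The conditional expectation of the charge at time `m` given the position at time `m`. -/
noncomputable def meanCharge (m : ℕ) (v : V) : ℝ :=
  G.pathExp 0 n (fun w => G.charge W lam n m w * if w m = v then 1 else 0) (fun _ => x) /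
    G.pathExp 0 n (fun w => if w m = v then 1 else 0) (fun _ => x)

/-- The potential of the measure with charges `meanCharge` along the path. -/
noncomputable def meanPotential (w : ℕ → V) (v : V) : ℝ :=
  ∑ m ∈ Finset.range (n + 1), G.meanCharge W lam x n m (w m) * G.green W lam (w m) v

variable {W lam x n} (hG : ∀ v, (G.out v).Nonempty) (h0 : 0 ≤ lam) (h1 : lam < 1)
  (hW : G.ball x n ⊆ W)

theorem IsPath.mem_of_le {G : Network V E} {w : ℕ → V} (hw : ∀ i ≤ 0, w i = x)
    (hp : G.IsPath 0 n w) (hW : G.ball x n ⊆ W) {m : ℕ} (hm : m ≤ n) : w m ∈ W := by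
  have := hp.mem_ball hm
  rw [hw 0 le_rfl] at this
  exact hW (G.ball_mono x hm this)

theorem IsPath.pathVertices_subset {G : Network V E} {w : ℕ → V} (hw : ∀ i ≤ 0, w i = x)
    (hp : G.IsPath 0 n w) (hW : G.ball x n ⊆ W) : pathVertices w n ⊆ W := by
  intro v hv
  obtain ⟨i, hi, rfl⟩ := mem_pathVertices.1 hv
  exact hp.mem_of_le hw hW hi

theorem dependsBetween_meanPotential (v : V) :
    DependsBetween 0 n fun w => G.meanPotential W lam x n w v := by
  intro w w' h
  refine Finset.sum_congr rfl fun m hm => ?_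
  rw [h m m.zero_le (by simpa [Nat.lt_succ_iff] using hm)]

include hG h0 h1

theorem charge_nonneg {w : ℕ → V} {m : ℕ} (hm : w m ∈ W) : 0 ≤ G.charge W lam n m w := by
  rw [charge]
  split_ifs
  · exact G.killedLap_killedHit_nonneg hG h0 h1 _ hm
  · exact le_rfl

theorem charge_le (w : ℕ → V) (m : ℕ) : G.charge W lam n m w ≤ G.vertexCond (w m) := by
  rw [charge]
  split_ifs
  · exact G.killedLap_killedHit_le hG h0 h1 _ _
  · exact G.vertexCond_nonneg _

include hW

/-- First-visit times list each vertex of the path once, so the charges add up to the equilibrium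
measure, against which `dirForm` with `killedHit` integrates. -/
theorem sum_charge_mul {w : ℕ → V} (hw : ∀ i ≤ 0, w i = x) (hp : G.IsPath 0 n w) (f : V → ℝ) :
    ∑ m ∈ Finset.range (n + 1), G.charge W lam n m w * f (w m) =
      G.dirForm W lam f (G.killedHit W lam (pathVertices w n)) := by
  classical
  rw [G.dirForm_killedHit hG h0 h1 f (hp.pathVertices_subset hw hW), sum_pathVertices]
  refine Finset.sum_congr rfl fun m _ => ?_
  rw [charge]
  split_ifs <;> ring

theorem sum_charge {w : ℕ → V} (hw : ∀ i ≤ 0, w i = x) (hp : G.IsPath 0 n w) :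
    ∑ m ∈ Finset.range (n + 1), G.charge W lam n m w =
      G.killedCap W lam (pathVertices w n) := by
  classical
  rw [G.killedCap_eq hG h0 h1 (hp.pathVertices_subset hw hW), sum_pathVertices]
  exact Finset.sum_congr rfl fun m _ => by rw [charge]

theorem meanCharge_nonneg {m : ℕ} (hm : m ≤ n) (v : V) : 0 ≤ G.meanCharge W lam x n m v := by
  classical
  refine div_nonneg (G.pathExp_nonneg fun w hw hp => mul_nonneg
    (G.charge_nonneg hG h0 h1 (hp.mem_of_le hw hW hm)) ?_) (G.pathExp_nonneg fun w _ _ => ?_)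
  all_goals split_ifs <;> norm_num

/-- The tower property: next to a function of the position at time `m`, the charge and its
conditional expectation given that position have the same mean. It is used in both directions. -/
theorem pathExp_meanCharge_mul {m : ℕ} (hm : m ≤ n) (U : V → ℝ) :
    G.pathExp 0 n (fun w => G.meanCharge W lam x n m (w m) * U (w m)) (fun _ => x) =
      G.pathExp 0 n (fun w => G.charge W lam n m w * U (w m)) (fun _ => x) := by
  classical
  have e1 : G.pathExp 0 n (fun w => G.meanCharge W lam x n m (w m) * U (w m)) (fun _ => x) =
      ∑ v ∈ W, G.meanCharge W lam x n m v * U v *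
        G.pathExp 0 n (fun w => if w m = v then 1 else 0) (fun _ => x) := by
    simp only [← pathExp_const_mul]
    rw [← pathExp_sum]
    refine G.pathExp_congr fun w hw hp => ?_
    simp [hp.mem_of_le hw hW hm]
  have e2 : G.pathExp 0 n (fun w => G.charge W lam n m w * U (w m)) (fun _ => x) =
      ∑ v ∈ W, U v * G.pathExp 0 n
        (fun w => G.charge W lam n m w * if w m = v then 1 else 0) (fun _ => x) := by
    simp only [← pathExp_const_mul]
    rw [← pathExp_sum]
    refine G.pathExp_congr fun w hw hp => ?_
    simp [hp.mem_of_le hw hW hm, mul_comm]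
  rw [e1, e2]
  refine Finset.sum_congr rfl fun v hv => ?_
  -- If `v` has probability 0 at time `m`, `meanCharge` is a division by 0; the other side vanishes
  -- too because the charge is at most c(v).
  rcases eq_or_ne (G.pathExp 0 n (fun w => if w m = v then 1 else 0) (fun _ => x)) 0 with h | h
  · rw [h, mul_zero]
    have h2 : G.pathExp 0 n (fun w => G.charge W lam n m w * if w m = v then 1 else 0)
        (fun _ => x) = 0 := by
      refine le_antisymm ?_ (G.pathExp_nonneg fun w hw hp => mul_nonneg
        (G.charge_nonneg hG h0 h1 (hp.mem_of_le hw hW hm)) (by split_ifs <;> norm_num))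
      refine (G.pathExp_le (F' := fun w => G.vertexCond v * if w m = v then 1 else 0)
        fun w _ _ => ?_).trans (by rw [pathExp_const_mul, h, mul_zero])
      split_ifs with hv
      · rw [← hv]; simpa using G.charge_le hG h0 h1 w m
      · simp
    rw [h2, mul_zero]
  · rw [meanCharge]; field_simp

theorem pathExp_sum_meanCharge :
    ∑ m ∈ Finset.range (n + 1),
      G.pathExp 0 n (fun w => G.meanCharge W lam x n m (w m)) (fun _ => x) =
      G.pathExp 0 n (fun w => G.killedCap W lam (pathVertices w n)) (fun _ => x) := by
  rw [← G.pathExp_congr (F := fun w => ∑ m ∈ Finset.range (n + 1), G.charge W lam n m w)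
    fun w hw hp => G.sum_charge hG h0 h1 hW hw hp, pathExp_sum]
  refine Finset.sum_congr rfl fun m hm => ?_
  have hm' : m ≤ n := by simpa [Nat.lt_succ_iff] using hm
  simpa using G.pathExp_meanCharge_mul hG h0 h1 hW hm' fun _ => 1

omit hW in
theorem meanPotential_off (w : ℕ → V) {v : V} (hv : v ∉ W) :
    G.meanPotential W lam x n w v = 0 :=
  Finset.sum_eq_zero fun m _ => by rw [G.green_off hG h0 h1 _ hv, mul_zero]

theorem meanPotential_nonneg (w : ℕ → V) (v : V) : 0 ≤ G.meanPotential W lam x n w v :=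
  Finset.sum_nonneg fun m hm => mul_nonneg
    (G.meanCharge_nonneg hG h0 h1 hW (by simpa [Nat.lt_succ_iff] using hm) _)
    (G.green_nonneg hG h0 h1 _ _)

theorem dirForm_meanPotential {w : ℕ → V} (hw : ∀ i ≤ 0, w i = x) (hp : G.IsPath 0 n w)
    (f : V → ℝ) : G.dirForm W lam f (G.meanPotential W lam x n w) =
      ∑ m ∈ Finset.range (n + 1), G.meanCharge W lam x n m (w m) * f (w m) := by
  unfold meanPotential
  rw [dirForm_sum_right]
  refine Finset.sum_congr rfl fun m hm => ?_
  rw [G.dirForm_green hG h0 h1 _ (hp.mem_of_le hw hW (by simpa [Nat.lt_succ_iff] using hm))]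

theorem killedLap_meanPotential_nonneg (w : ℕ → V) {u : V} (hu : u ∈ W) :
    0 ≤ G.killedLap lam (G.meanPotential W lam x n w) u := by
  unfold meanPotential
  rw [killedLap_sum]
  refine Finset.sum_nonneg fun m hm => ?_
  rw [killedLap_const_mul]
  exact mul_nonneg (G.meanCharge_nonneg hG h0 h1 hW (by simpa [Nat.lt_succ_iff] using hm) _)
    (G.killedLap_green_nonneg hG h0 h1 _ hu)

end

/-! ### Doob's inequality for the Dirichlet energy -/

section

variable (W : Finset V) (lam : ℝ) (x : V) (n : ℕ)

/-- The maximal function of the martingale of conditional expectations of the potential. -/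
noncomputable def maxPotential (w : ℕ → V) (v : V) : ℝ :=
  (Finset.range (n + 1)).sup' Finset.nonempty_range_add_one fun m =>
    |G.pathExp m (n - m) (fun w => G.meanPotential W lam x n w v) w|

variable {W lam x n} (hG : ∀ v, (G.out v).Nonempty) (h0 : 0 ≤ lam) (h1 : lam < 1)
include hG h0 h1

theorem maxPotential_off (w : ℕ → V) {v : V} (hv : v ∉ W) :
    G.maxPotential W lam x n w v = 0 := by
  simp only [maxPotential, G.meanPotential_off hG h0 h1 _ hv, pathExp_zero_fun, abs_zero,
    Finset.sup'_const]

/-- By `dirForm_eq` the energy is a positive combination of squares of values and of differences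
along edges. Doob applies to the values; it also applies to the differences, since two maxima differ
by at most the maximal absolute difference of their martingales. -/
theorem pathExp_dirForm_maxPotential_le :
    G.pathExp 0 n (fun w => G.dirForm W lam (G.maxPotential W lam x n w)
      (G.maxPotential W lam x n w)) (fun _ => x) ≤
    4 * G.pathExp 0 n (fun w => G.dirForm W lam (G.meanPotential W lam x n w)
      (G.meanPotential W lam x n w)) (fun _ => x) := by
  have hmax := fun w => G.dirForm_eq W lam (f := G.maxPotential W lam x n w)
    (h := G.maxPotential W lam x n w) fun u hu => G.maxPotential_off hG h0 h1 w hu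
  have hmean := fun w => G.dirForm_eq W lam (f := G.meanPotential W lam x n w)
    (h := G.meanPotential W lam x n w) fun u hu => G.meanPotential_off hG h0 h1 w hu
  simp only [hmax, hmean, pathExp_add, pathExp_sum, pathExp_const_mul]
  rw [mul_add]
  refine add_le_add ?_ ?_
  · rw [Finset.mul_sum]
    refine Finset.sum_le_sum fun u _ => ?_
    rw [mul_left_comm]
    refine mul_le_mul_of_nonneg_left ?_ (G.killRate_nonneg W h1.le u)
    have := G.pathExp_iSup_sq_le hG (G.dependsBetween_meanPotential (W := W) (lam := lam) (x := x)
      (n := n) u) fun _ => x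
    simp only [sq] at this
    exact this
  · rw [mul_left_comm]
    refine mul_le_mul_of_nonneg_left ?_ (div_nonneg h0 zero_le_two)
    rw [Finset.mul_sum]
    refine Finset.sum_le_sum fun e _ => ?_
    rw [mul_left_comm]
    refine mul_le_mul_of_nonneg_left ?_ (G.cond_pos e).le
    have hd : DependsBetween 0 n fun w => G.meanPotential W lam x n w (G.src e) -
        G.meanPotential W lam x n w (G.tgt e) := fun w w' h =>
      congrArg₂ (· - ·) (G.dependsBetween_meanPotential _ w w' h)
        (G.dependsBetween_meanPotential _ w w' h)
    have := G.pathExp_iSup_sq_le hG hd fun _ => x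
    simp only [← sq] at this ⊢
    refine le_trans (G.pathExp_le fun w _ _ => ?_) this
    refine sq_le_sq' ?_ ?_
    · rw [neg_le, neg_sub, sub_le_iff_le_add']
      refine Finset.sup'_le _ _ fun m hm => ?_
      have a1 := Finset.le_sup' (fun m => |G.pathExp m (n - m)
        (fun w => G.meanPotential W lam x n w (G.src e)) w|) hm
      have a2 := Finset.le_sup' (fun m => |G.pathExp m (n - m)
        (fun w => G.meanPotential W lam x n w (G.src e) -
          G.meanPotential W lam x n w (G.tgt e)) w|) hm
      refine le_trans ?_ (add_le_add a1 a2)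
      rw [pathExp_sub, abs_sub_comm]
      linarith [abs_sub_abs_le_abs_sub
        (G.pathExp m (n - m) (fun w => G.meanPotential W lam x n w (G.tgt e)) w)
        (G.pathExp m (n - m) (fun w => G.meanPotential W lam x n w (G.src e)) w)]
    · rw [sub_le_iff_le_add']
      refine Finset.sup'_le _ _ fun m hm => ?_
      have a1 := Finset.le_sup' (fun m => |G.pathExp m (n - m)
        (fun w => G.meanPotential W lam x n w (G.tgt e)) w|) hm
      have a2 := Finset.le_sup' (fun m => |G.pathExp m (n - m)
        (fun w => G.meanPotential W lam x n w (G.src e) -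
          G.meanPotential W lam x n w (G.tgt e)) w|) hm
      refine le_trans ?_ (add_le_add a1 a2)
      rw [pathExp_sub]
      linarith [abs_sub_abs_le_abs_sub
        (G.pathExp m (n - m) (fun w => G.meanPotential W lam x n w (G.src e)) w)
        (G.pathExp m (n - m) (fun w => G.meanPotential W lam x n w (G.tgt e)) w)]

end

theorem sum_sum_le_two_mul_of_symm (n : ℕ) {a : ℕ → ℕ → ℝ} (ha : ∀ i < n, ∀ j < n, 0 ≤ a i j)
    (hs : ∀ i < n, ∀ j < n, a i j = a j i) :
    ∑ i ∈ Finset.range n, ∑ j ∈ Finset.range n, a i j ≤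
      2 * ∑ i ∈ Finset.range n, ∑ j ∈ Finset.range n, if i ≤ j then a i j else 0 := by
  have h1 : ∑ i ∈ Finset.range n, ∑ j ∈ Finset.range n, a i j ≤
      ∑ i ∈ Finset.range n, ∑ j ∈ Finset.range n,
        ((if i ≤ j then a i j else 0) + if j ≤ i then a j i else 0) := by
    refine Finset.sum_le_sum fun i hi => Finset.sum_le_sum fun j hj => ?_
    rw [Finset.mem_range] at hi hj
    have p := ha i hi j hj
    have q := hs i hi j hj
    rcases lt_trichotomy i j with h | rfl | h
    · simp [h.le, not_le.2 h]
    · simp [p]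
    · simp [h.le, not_le.2 h, q]
  simp only [Finset.sum_add_distrib] at h1
  rw [Finset.sum_comm (f := fun i j => if j ≤ i then a j i else 0)] at h1
  linarith

/-! ### Energy bound and comparison of capacities for the killed walk -/

section

variable {W : Finset V} {lam : ℝ} {x : V} {n : ℕ} (hG : ∀ v, (G.out v).Nonempty) (h0 : 0 ≤ lam)
  (h1 : lam < 1) (hW : G.ball x n ⊆ W)
include hG h0 h1 hW

/-- The mean energy that the walk after time `m` creates with its position at time `m`. -/
theorem pathExp_meanCharge_mul_sum_le {m : ℕ} (hm : m ≤ n) :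
    G.pathExp 0 n (fun w => G.meanCharge W lam x n m (w m) *
      ∑ j ∈ Finset.range (n + 1), if m ≤ j then
        G.meanCharge W lam x n j (w j) * G.green W lam (w j) (w m) else 0) (fun _ => x) ≤
    G.pathExp 0 n (fun w => G.charge W lam n m w * G.maxPotential W lam x n w (w m))
      (fun _ => x) := by
  let T : (ℕ → V) → ℝ := fun w => ∑ j ∈ Finset.range (n + 1), if m ≤ j then
    G.meanCharge W lam x n j (w j) * G.green W lam (w j) (w m) else 0
  have hT : DependsBetween m n T := by
    intro w w' h
    refine Finset.sum_congr rfl fun j hj => ?_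
    split_ifs with hmj
    · rw [h j hmj (by simpa [Nat.lt_succ_iff] using hj), h m le_rfl hm]
    · rfl
  -- The Markov property: the conditional mean of `T` is a function of `w m` alone.
  have hU : ∀ w, G.pathExp m (n - m) T w = G.pathExp m (n - m) T (fun _ => w m) := fun w =>
    DependsBetween.pathExp G (k := n - m) (a := m) (by rwa [Nat.add_sub_cancel' hm]) le_rfl _ _
      fun i h2 h3 => by rw [le_antisymm h3 h2]
  have hH : DependsBetween 0 m fun w => G.meanCharge W lam x n m (w m) := fun w w' h => by
    simp only [h m m.zero_le le_rfl]
  change G.pathExp 0 n (fun w => G.meanCharge W lam x n m (w m) * T w) (fun _ => x) ≤ _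
  rw [G.pathExp_mul_pathExp hG hm hH (hT.mono m.zero_le le_rfl)]
  simp only [hU]
  -- Here the averaged charge is turned back into the true one, which may now stand beside a maximal
  -- function of the whole path.
  rw [G.pathExp_meanCharge_mul hG h0 h1 hW hm fun v => G.pathExp m (n - m) T fun _ => v]
  simp only [← hU]
  refine G.pathExp_le fun w hw hp => mul_le_mul_of_nonneg_left ?_
    (G.charge_nonneg hG h0 h1 (hp.mem_of_le hw hW hm))
  refine le_trans ?_ (Finset.le_sup' (fun j => |G.pathExp j (n - j)
    (fun w' => G.meanPotential W lam x n w' (w m)) w|) (b := m)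
      (Finset.mem_range.2 (Nat.lt_succ_of_le hm)))
  -- Restoring the nonnegative terms `j < m` turns `T` into the full potential at `w m`.
  refine le_trans (G.pathExp_le fun w' hw' _ => ?_) (le_abs_self _)
  simp only [T, meanPotential, hw' m le_rfl]
  refine Finset.sum_le_sum fun j hj => ?_
  split_ifs
  · exact le_rfl
  · exact mul_nonneg (G.meanCharge_nonneg hG h0 h1 hW (by simpa [Nat.lt_succ_iff] using hj) _)
      (G.green_nonneg hG h0 h1 _ _)

/-- The energy of the averaged equilibrium measure is at most a constant times the capacity. -/
theorem pathExp_dirForm_meanPotential_le :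
    G.pathExp 0 n (fun w => G.dirForm W lam (G.meanPotential W lam x n w)
      (G.meanPotential W lam x n w)) (fun _ => x) ≤
    16 * G.pathExp 0 n (fun w => G.killedCap W lam (pathVertices w n)) (fun _ => x) := by
  have hlt : ∀ {m}, m ∈ Finset.range (n + 1) → m ≤ n := fun hm => by
    simpa [Nat.lt_succ_iff] using hm
  have hA : G.pathExp 0 n (fun w => G.dirForm W lam (G.meanPotential W lam x n w)
      (G.meanPotential W lam x n w)) (fun _ => x) ≤
      2 * ∑ m ∈ Finset.range (n + 1), G.pathExp 0 n (fun w => G.meanCharge W lam x n m (w m) *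
        ∑ j ∈ Finset.range (n + 1), if m ≤ j then
          G.meanCharge W lam x n j (w j) * G.green W lam (w j) (w m) else 0) (fun _ => x) := by
    rw [← pathExp_sum, ← pathExp_const_mul]
    refine G.pathExp_le fun w hw hp => ?_
    rw [G.dirForm_meanPotential hG h0 h1 hW hw hp]
    have := sum_sum_le_two_mul_of_symm (n + 1) (a := fun i j => G.meanCharge W lam x n i (w i) *
      (G.meanCharge W lam x n j (w j) * G.green W lam (w j) (w i)))
      (fun i hi j hj => mul_nonneg (G.meanCharge_nonneg hG h0 h1 hW (by omega) _)
        (mul_nonneg (G.meanCharge_nonneg hG h0 h1 hW (by omega) _)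
          (G.green_nonneg hG h0 h1 _ _)))
      (fun i hi j hj => by
        rw [G.green_comm hG h0 h1 (hp.mem_of_le hw hW (by omega))
          (hp.mem_of_le hw hW (by omega))]
        ring)
    simp only [meanPotential, Finset.mul_sum, mul_ite, mul_zero] at this ⊢
    exact this
  have hB : ∑ m ∈ Finset.range (n + 1), G.pathExp 0 n (fun w => G.meanCharge W lam x n m (w m) *
        ∑ j ∈ Finset.range (n + 1), if m ≤ j then
          G.meanCharge W lam x n j (w j) * G.green W lam (w j) (w m) else 0) (fun _ => x) ≤
      G.pathExp 0 n (fun w => G.dirForm W lam (G.killedHit W lam (pathVertices w n))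
        (G.maxPotential W lam x n w)) (fun _ => x) := by
    refine (Finset.sum_le_sum fun m hm =>
      G.pathExp_meanCharge_mul_sum_le hG h0 h1 hW (hlt hm)).trans ?_
    rw [← pathExp_sum]
    refine G.pathExp_le fun w hw hp => ?_
    rw [G.sum_charge_mul hG h0 h1 hW hw hp, G.dirForm_comm W lam
      (fun u hu => G.maxPotential_off hG h0 h1 w hu) (G.killedHit_spec hG h0 h1 _).1]
  -- The weight 1/8 makes Doob's factor 4 into half of the energy: I ≤ 8C + I/2.
  have hC : 2 * G.pathExp 0 n (fun w => G.dirForm W lam (G.killedHit W lam (pathVertices w n))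
        (G.maxPotential W lam x n w)) (fun _ => x) ≤
      G.pathExp 0 n (fun w => 8 * G.killedCap W lam (pathVertices w n) + 1 / 8 *
        G.dirForm W lam (G.maxPotential W lam x n w) (G.maxPotential W lam x n w))
          (fun _ => x) := by
    rw [← pathExp_const_mul]
    refine G.pathExp_le fun w hw hp => ?_
    have := G.two_mul_dirForm_le W h0 h1.le
      (G.killedHit_spec (W := W) hG h0 h1 (pathVertices w n : Set V)).1
      (fun u hu => G.maxPotential_off hG h0 h1 (x := x) (n := n) w hu) (1 / 8)
    rw [killedCap]; linarith
  have hD := G.pathExp_dirForm_maxPotential_le (W := W) (x := x) (n := n) hG h0 h1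
  rw [pathExp_add, pathExp_const_mul, pathExp_const_mul] at hC
  linarith

/-- The comparison of the mean capacities of the loop-erasure and of the path, for the killed
walk. -/
theorem le_pathExp_killedCap_loopErasure :
    lam ^ (2 * n) / 64 *
      G.pathExp 0 n (fun w => G.killedCap W lam (pathVertices w n)) (fun _ => x) ≤
    G.pathExp 0 n (fun w => G.killedCap W lam (loopErasureVertices w n)) (fun _ => x) := by
  have hlt : ∀ {m}, m ∈ Finset.range (n + 1) → m ≤ n := fun hm => by
    simpa [Nat.lt_succ_iff] using hm
  let B : ℕ → (ℕ → V) → Set V := fun m w => loopErasurePrefix w m (survivingIndex w m n)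
  let hit : ℕ → (ℕ → V) → ℝ := fun m w => G.hitProb (B m w) (n - m) (w m)
  have hhit : ∀ m ≤ n, DependsBetween 0 n (hit m) := by
    intro m hm w w' h
    have e : B m w = B m w' := by
      have e1 := loopErasurePrefix_congr (m := m) fun j hj => h j j.zero_le (hj.trans hm)
      have e2 : survivingIndex w m n = survivingIndex w' m n := by
        unfold survivingIndex
        congr 1
        ext k
        refine exists_congr fun t => and_congr_right fun _ => and_congr_right fun ht => ?_
        rw [h t t.zero_le ht, e1]
      simp only [B, e1, e2]
    simp only [hit, e, h m m.zero_le hm]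
  -- The swept measure has mean mass at least `lam ^ n` C/2 and mean energy at most 16C, so this `t`
  -- maximises `t * lam ^ n` C - 16t²C, with value `lam ^ (2 * n)` C/64.
  set t : ℝ := lam ^ n / 32 with ht
  have ht0 : 0 ≤ t := by positivity
  have hpt : ∀ w, (∀ i ≤ 0, w i = x) → G.IsPath 0 n w →
      2 * t * (lam ^ n * ∑ m ∈ Finset.range (n + 1), G.meanCharge W lam x n m (w m) * hit m w) -
        t ^ 2 * G.dirForm W lam (G.meanPotential W lam x n w) (G.meanPotential W lam x n w) ≤
      G.killedCap W lam (loopErasureVertices w n) := by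
    intro w hw hp
    -- The potential of the measure obtained by sweeping the charge at each time `m` onto the
    -- surviving prefix `B m w`.
    let ψ : V → ℝ := fun v => ∑ m ∈ Finset.range (n + 1),
      G.meanCharge W lam x n m (w m) * G.sweep W lam (B m w) (n - m) (w m) v
    have hm0 : ∀ m ∈ Finset.range (n + 1), 0 ≤ G.meanCharge W lam x n m (w m) := fun m hm =>
      G.meanCharge_nonneg hG h0 h1 hW (hlt hm) _
    have hψoff : ∀ u ∉ W, ψ u = 0 := fun u hu => Finset.sum_eq_zero fun m _ => by
      rw [G.sweep_off hG h0 h1 _ _ _ hu, mul_zero]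
    have hψ0 : ∀ u, 0 ≤ ψ u := fun u => Finset.sum_nonneg fun m hm =>
      mul_nonneg (hm0 m hm) (G.sweep_nonneg hG h0 h1 _ _ _ _)
    have hψQ : ∀ u ∈ W, 0 ≤ G.killedLap lam ψ u := by
      intro u hu
      simp only [ψ]
      rw [killedLap_sum]
      refine Finset.sum_nonneg fun m hm => ?_
      rw [killedLap_const_mul]
      exact mul_nonneg (hm0 m hm) (G.killedLap_sweep_nonneg hG h0 h1 _ _ _ hu)
    -- Sweeping is undone in one argument of the energy at a time; this uses that `ψ`, and then
    -- `meanPotential`, is superharmonic.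
    have hE1 : G.dirForm W lam ψ ψ ≤ G.dirForm W lam ψ (G.meanPotential W lam x n w) := by
      rw [G.dirForm_meanPotential hG h0 h1 hW hw hp]
      conv_lhs => simp only [ψ]
      rw [dirForm_sum_right]
      exact Finset.sum_le_sum fun m hm => mul_le_mul_of_nonneg_left
        (G.dirForm_sweep_le hG h0 h1 _ hψ0 hψQ _ _) (hm0 m hm)
    have hE2 : G.dirForm W lam ψ (G.meanPotential W lam x n w) ≤
        G.dirForm W lam (G.meanPotential W lam x n w) (G.meanPotential W lam x n w) := by
      rw [G.dirForm_comm W lam hψoff fun u hu => G.meanPotential_off hG h0 h1 w hu]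
      conv_rhs => rw [G.dirForm_meanPotential hG h0 h1 hW hw hp]
      simp only [ψ]
      rw [dirForm_sum_right]
      exact Finset.sum_le_sum fun m hm => mul_le_mul_of_nonneg_left
        (G.dirForm_sweep_le hG h0 h1 _ (G.meanPotential_nonneg hG h0 h1 hW w)
          (fun u hu => G.killedLap_meanPotential_nonneg hG h0 h1 hW w hu) _ _) (hm0 m hm)
    have hM : lam ^ n * ∑ m ∈ Finset.range (n + 1), G.meanCharge W lam x n m (w m) * hit m w ≤
        G.dirForm W lam (G.killedHit W lam (loopErasureVertices w n)) ψ := by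
      simp only [ψ]
      rw [dirForm_sum_right, Finset.mul_sum]
      refine Finset.sum_le_sum fun m hm => ?_
      rw [mul_left_comm]
      refine mul_le_mul_of_nonneg_left ?_ (hm0 m hm)
      have hb : G.ball x (m + (n - m)) ⊆ W := by rwa [Nat.add_sub_cancel' (hlt hm)]
      have hv : w m ∈ G.ball x m := by
        have := hp.mem_ball (hlt hm)
        rwa [hw 0 le_rfl] at this
      refine le_trans ?_ (G.le_dirForm_sweep hG h0 h1 (fun u hu huB =>
        (G.killedHit_spec hG h0 h1 _).2.1 u hu
          (loopErasurePrefix_survivingIndex_subset w (hlt hm) huB)) hb hv)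
      exact mul_le_mul_of_nonneg_right (pow_le_pow_of_le_one h0 h1.le (by omega))
        (G.hitProb_nonneg _ _ _)
    have hfin := G.le_killedCap hG h0 h1 (A := (loopErasureVertices w n : Set V)) hψoff t
    have h2t := mul_le_mul_of_nonneg_left hM (by positivity : 0 ≤ 2 * t)
    have h3t := mul_le_mul_of_nonneg_left (hE1.trans hE2) (sq_nonneg t)
    linarith
  -- The averaged charge is known at time `m`, so the conditional bound 1/2 applies beside it. This
  -- is a second reason for averaging: the true charge depends on the continuation.
  have hmass : G.pathExp 0 n (fun w => G.killedCap W lam (pathVertices w n)) (fun _ => x) / 2 ≤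
      G.pathExp 0 n (fun w => ∑ m ∈ Finset.range (n + 1),
        G.meanCharge W lam x n m (w m) * hit m w) (fun _ => x) := by
    rw [← G.pathExp_sum_meanCharge hG h0 h1 hW, pathExp_sum, Finset.sum_div]
    refine Finset.sum_le_sum fun m hm => ?_
    have hH : DependsBetween 0 m fun w => G.meanCharge W lam x n m (w m) := fun w w' h => by
      simp only [h m m.zero_le le_rfl]
    rw [G.pathExp_mul_pathExp hG (hlt hm) hH (hhit m (hlt hm)), div_eq_inv_mul,
      ← pathExp_const_mul]
    refine G.pathExp_le fun w _ _ => ?_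
    rw [mul_comm]
    refine mul_le_mul_of_nonneg_left ?_ (G.meanCharge_nonneg hG h0 h1 hW (hlt hm) _)
    have := G.half_le_pathExp_hitProb hG (hlt hm) w
    rw [one_div] at this
    exact this
  have hE := G.pathExp_dirForm_meanPotential_le hG h0 h1 hW
  have hfin := G.pathExp_le (m := 0) (k := n) (w := fun _ => x) hpt
  simp only [pathExp_sub, pathExp_const_mul] at hfin
  have e1 := mul_le_mul_of_nonneg_left hmass (by positivity : 0 ≤ 2 * t * lam ^ n)
  have e2 := mul_le_mul_of_nonneg_left hE (sq_nonneg t)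
  have e3 : lam ^ (2 * n) = lam ^ n * lam ^ n := by rw [two_mul, pow_add]
  have e4 : lam ^ n = 32 * t := by rw [ht]; ring
  rw [e4] at e1 e3 hfin
  rw [e3]
  nlinarith

end

/-! ### Removing the killing -/

theorem tendsto_pathExp {F : ℕ → (ℕ → V) → ℝ} {F' : (ℕ → V) → ℝ}
    (h : ∀ w, Filter.Tendsto (fun k => F k w) Filter.atTop (nhds (F' w))) (m N : ℕ) (w : ℕ → V) :
    Filter.Tendsto (fun k => G.pathExp m N (F k) w) Filter.atTop (nhds (G.pathExp m N F' w)) := by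
  induction N generalizing m w with
  | zero => exact h w
  | succ N ih =>
    simp only [pathExp_succ, stepExp, avg]
    exact (tendsto_finsetSum _ fun e _ => (ih _ _).const_mul _).div_const _

variable [MeasurableSpace V] [DiscreteMeasurableSpace V] (hG : ∀ v, (G.out v).Nonempty)
include hG

/-- A lower bound on the mean killed capacity of random sets, uniform in the killed walks, is a
lower bound on the mean capacity. -/
theorem le_pathExp_capacity {x : V} {n r p : ℕ} {A : (ℕ → V) → Finset V}
    (hA : ∀ w, (∀ i ≤ 0, w i = x) → G.IsPath 0 n w → A w ⊆ G.ball x r) {B : ℝ}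
    (h : ∀ (lam : ℝ) (W : Finset V), 0 ≤ lam → lam < 1 → G.ball x r ⊆ W →
      lam ^ p * B ≤ G.pathExp 0 n (fun w => G.killedCap W lam (A w)) (fun _ => x)) :
    B ≤ G.pathExp 0 n (fun w => G.capacity (A w)) (fun _ => x) := by
  let a : ℝ := G.pathExp 0 n (fun w => ∑ u ∈ A w, G.vertexCond u) fun _ => x
  let b : ℕ → ℝ := fun k => G.pathExp 0 n
    (fun w => ∑ u ∈ A w, G.vertexCond u * G.avg (G.hitProb (A w) k) u) fun _ => x
  have h1 : ∀ k (lam : ℝ), 0 ≤ lam → lam < 1 → lam ^ p * B ≤ a - lam ^ (k + 1) * b k := by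
    intro k lam h0 h1
    refine (h lam (G.ball x (r + 1 + k)) h0 h1 (G.ball_mono x (by omega))).trans ?_
    simp only [a, b]
    rw [← pathExp_const_mul, ← pathExp_sub]
    refine G.pathExp_le fun w hw hp =>
      (G.killedCap_le hG h0 h1 (hA w hw hp) subset_rfl).trans (le_of_eq ?_)
    rw [Finset.mul_sum, ← Finset.sum_sub_distrib]
    exact Finset.sum_congr rfl fun u _ => by ring
  -- First `lam` ↑ 1 with the number `k` of steps fixed, by continuity of polynomials; then `k` → ∞
  -- below.
  have h2 : ∀ k, B ≤ a - b k := by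
    intro k
    have c1 : ContinuousWithinAt (fun lam : ℝ => lam ^ p * B) (Set.Iio 1) 1 := by fun_prop
    have c2 : ContinuousWithinAt (fun lam : ℝ => a - lam ^ (k + 1) * b k) (Set.Iio 1) 1 := by
      fun_prop
    have := le_of_tendsto_of_tendsto c1.tendsto c2.tendsto ?_
    · simpa using this
    · filter_upwards [self_mem_nhdsWithin,
        mem_nhdsWithin_of_mem_nhds (Ioi_mem_nhds (zero_lt_one' ℝ))] with lam hl hl'
      exact h1 k lam (le_of_lt hl') hl
  have h3 : Filter.Tendsto (fun k => a - b k) Filter.atTop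
      (nhds (G.pathExp 0 n (fun w => G.capacity (A w)) fun _ => x)) := by
    have e : (fun k => a - b k) = fun k => G.pathExp 0 n (fun w => ∑ u ∈ A w,
        G.vertexCond u * (1 - G.avg (G.hitProb (A w) k) u)) fun _ => x := by
      funext k
      simp only [a, b]
      rw [← pathExp_sub]
      refine G.pathExp_congr fun w _ _ => ?_
      rw [← Finset.sum_sub_distrib]
      exact Finset.sum_congr rfl fun u _ => by ring
    rw [e]
    refine G.tendsto_pathExp (fun w => ?_) _ _ _
    exact tendsto_finsetSum _ fun u _ => (G.tendsto_escapeProb hG _ u).const_mul _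
  exact ge_of_tendsto' h3 h2

theorem le_pathExp_capacity_loopErasure (x : V) (n : ℕ) :
    1 / 64 * G.pathExp 0 n (fun w => G.capacity (pathVertices w n)) (fun _ => x) ≤
      G.pathExp 0 n (fun w => G.capacity (loopErasureVertices w n)) (fun _ => x) := by
  refine G.le_pathExp_capacity hG (r := n) (p := 2 * n)
    (fun w hw hp => (loopErasureVertices_subset w n).trans
      (hp.pathVertices_subset hw subset_rfl)) fun lam W h0 h1 hW => ?_
  refine le_trans ?_ (G.le_pathExp_killedCap_loopErasure hG h0 h1 hW)
  have := G.pathExp_le (m := 0) (k := n) (w := fun _ => x)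
    (F := fun w => G.capacity (pathVertices w n))
    (F' := fun w => G.killedCap W lam (pathVertices w n))
    fun w hw hp => G.capacity_le_killedCap hG h0 h1 (hp.pathVertices_subset hw hW)
  have h2 := mul_le_mul_of_nonneg_left this (by positivity : 0 ≤ lam ^ (2 * n) / 64)
  linarith

/-- The capacity of a set is bounded below by the energies of the measures that it carries. -/
theorem le_capacity {ι : Type*} (s : Finset ι) (v : ι → V) {x : V} {r : ℕ} {A : Finset V}
    (hA : A ⊆ G.ball x r) (hv : ∀ i ∈ s, v i ∈ A) {f : V → ℝ} (hf : ∀ u, 0 ≤ f u)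
    (hQ : ∀ u, ∑ i ∈ s, Set.indicator {v i} (fun _ => (1 : ℝ)) u ≤
      G.vertexCond u * (f u - G.avg f u)) (t : ℝ) :
    2 * t * s.card - t ^ 2 * ∑ i ∈ s, f (v i) ≤ G.capacity A := by
  refine G.le_pathExp_capacity hG (x := x) (n := 0) (r := r) (p := 0) (A := fun _ => A)
    (fun _ _ _ => hA) fun lam W h0 h1 hW => ?_
  rw [pow_zero, one_mul, pathExp_zero]
  have hAW : A ⊆ W := hA.trans hW
  let ψ : V → ℝ := fun u => ∑ i ∈ s, 1 * G.green W lam (v i) u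
  have hψoff : ∀ u ∉ W, ψ u = 0 := fun u hu => Finset.sum_eq_zero fun i _ => by
    rw [G.green_off hG h0 h1 _ hu, mul_zero]
  have hψ : ∀ h : V → ℝ, G.dirForm W lam h ψ = ∑ i ∈ s, h (v i) := fun h => by
    simp only [ψ]
    rw [dirForm_sum_right]
    exact Finset.sum_congr rfl fun i hi => by
      rw [one_mul, G.dirForm_green hG h0 h1 _ (hAW (hv i hi))]
  -- The maximum principle: `f` is a supersolution for the killed Green potential of the counting
  -- measure, so energies may be estimated with `f`, uniformly in `lam` and `W`.
  have hle : ∀ u, ψ u ≤ f u := by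
    intro u
    refine sub_nonneg.1 (G.nonneg_of_killedLap_nonneg hG W h0 h1 (A := ∅)
      (f := fun u => f u - ψ u) (fun u hu => ?_) (fun _ _ h => h.elim) (fun u hu _ => ?_) u)
    · rw [hψoff u hu, sub_zero]; exact hf u
    · rw [killedLap_sub]
      have e1 : G.killedLap lam ψ u ≤ ∑ i ∈ s, Set.indicator {v i} (fun _ => (1 : ℝ)) u := by
        simp only [ψ]
        rw [killedLap_sum]
        refine Finset.sum_le_sum fun i _ => ?_
        rw [killedLap_const_mul, one_mul]
        obtain ⟨-, g1, g2⟩ := G.green_spec (W := W) hG h0 h1 (v i)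
        rcases eq_or_ne u (v i) with rfl | hne
        · rw [g2 hu]; simp
        · rw [g1 u hu hne]; simp [hne]
      have e2 : G.vertexCond u * (f u - G.avg f u) ≤ G.killedLap lam f u := by
        rw [G.killedLap_eq_avg hG]
        refine mul_le_mul_of_nonneg_left ?_ (G.vertexCond_nonneg u)
        nlinarith [G.avg_nonneg hf u]
      linarith [hQ u]
  have hmain := G.le_killedCap hG h0 h1 (A := (A : Set V)) hψoff t
  rw [hψ, hψ, Finset.sum_congr rfl fun i hi => (G.killedHit_spec hG h0 h1 _).2.1 (v i)
    (hAW (hv i hi)) (by simpa using hv i hi)] at hmain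
  have h3 : ∑ i ∈ s, ψ (v i) ≤ ∑ i ∈ s, f (v i) := Finset.sum_le_sum fun i _ => hle _
  have h4 := mul_le_mul_of_nonneg_left h3 (sq_nonneg t)
  simp only [Finset.sum_const, nsmul_eq_mul, mul_one] at hmain
  linarith

omit hG in
theorem dependsBetween_capacity_pathVertices (n : ℕ) :
    DependsBetween 0 n fun w => G.capacity (pathVertices w n) := fun w w' h => by
  simp only [pathVertices_congr fun j hj => h j j.zero_le hj]

omit hG in
theorem dependsBetween_capacity_loopErasureVertices (n : ℕ) :
    DependsBetween 0 n fun w => G.capacity (loopErasureVertices w n) := fun w w' h => by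
  simp only [loopErasureVertices_congr fun j hj => h j j.zero_le hj]

omit hG in
theorem capacity_nonneg (A : Finset V) : 0 ≤ G.capacity A :=
  Finset.sum_nonneg fun u _ => mul_nonneg (G.vertexCond_nonneg u) (G.escapeProb_nonneg _ u)

theorem integral_capacity_loopErasure_ge {x : V} {Ω : Type*} [MeasurableSpace Ω] {P : Measure Ω}
    {X : ℕ → Ω → V} (hX : HasLaw (fun ω t => X t ω) (G.walkLaw x) P) (n : ℕ) :
    1 / 256 * ∫ ω, G.capacity (pathVertices (fun t => X t ω) n) ∂P ≤
      ∫ ω, G.capacity (loopErasureVertices (fun t => X t ω) n) ∂P := by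
  rw [G.integral_eq_pathExp hG hX (G.dependsBetween_capacity_pathVertices n),
    G.integral_eq_pathExp hG hX (G.dependsBetween_capacity_loopErasureVertices n)]
  refine le_trans ?_ (G.le_pathExp_capacity_loopErasure hG x n)
  have : 0 ≤ G.pathExp 0 n (fun w => G.capacity (pathVertices w n)) (fun _ => x) :=
    G.pathExp_nonneg fun w _ _ => G.capacity_nonneg _
  linarith

end Network

/-! ### Iterates of the transition operator -/

namespace Network

variable {V E : Type*} (G : Network V E)

theorem iterate_avg_le {f g : V → ℝ} (h : ∀ v, f v ≤ g v) (k : ℕ) (v : V) :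
    (G.avg^[k] f) v ≤ (G.avg^[k] g) v := by
  induction k generalizing v with
  | zero => exact h v
  | succ k ih =>
    rw [Function.iterate_succ_apply', Function.iterate_succ_apply']
    exact G.avg_le_avg fun e _ => ih _

theorem iterate_avg_const_mul (c : ℝ) (f : V → ℝ) (k : ℕ) (v : V) :
    (G.avg^[k] fun u => c * f u) v = c * (G.avg^[k] f) v := by
  induction k generalizing v with
  | zero => rfl
  | succ k ih =>
    rw [Function.iterate_succ_apply', Function.iterate_succ_apply', ← avg_const_mul]
    exact G.avg_congr fun e _ => ih _

theorem iterate_avg_sum {ι : Type*} (s : Finset ι) (f : ι → V → ℝ) (k : ℕ) (v : V) :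
    (G.avg^[k] fun u => ∑ i ∈ s, f i u) v = ∑ i ∈ s, (G.avg^[k] (f i)) v := by
  induction k generalizing v with
  | zero => rfl
  | succ k ih =>
    simp only [Function.iterate_succ_apply']
    rw [← avg_sum]
    exact G.avg_congr fun e _ => ih _

theorem iterate_avg_const (hG : ∀ v, (G.out v).Nonempty) (c : ℝ) (k : ℕ) (v : V) :
    (G.avg^[k] fun _ => c) v = c := by
  induction k generalizing v with
  | zero => rfl
  | succ k ih =>
    rw [Function.iterate_succ_apply']
    exact (G.avg_congr fun e _ => ih _).trans (G.avg_const hG c v)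

theorem iterate_avg_nonneg {f : V → ℝ} (h : ∀ v, 0 ≤ f v) (k : ℕ) (v : V) :
    0 ≤ (G.avg^[k] f) v := by
  induction k generalizing v with
  | zero => exact h v
  | succ k ih => rw [Function.iterate_succ_apply']; exact G.avg_nonneg ih v

theorem hasSum_iterate_avg {f : ℕ → V → ℝ} {F : V → ℝ} (h : ∀ v, HasSum (fun l => f l v) (F v))
    (k : ℕ) (v : V) : HasSum (fun l => (G.avg^[k] (f l)) v) ((G.avg^[k] F) v) := by
  induction k generalizing v with
  | zero => exact h v
  | succ k ih =>
    simp only [Function.iterate_succ_apply', avg]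
    exact (hasSum_sum fun e _ => (ih _).mul_left _).div_const _

end Network

/-! ### The one-dimensional kernel and central binomial coefficients -/

/-- The simple random walk step distribution in one dimension, iterated `n` times. -/
noncomputable def lineKernel : ℕ → ℤ → ℝ
  | 0, z => if z = 0 then 1 else 0
  | n + 1, z => (lineKernel n (z + 1) + lineKernel n (z - 1)) / 2

theorem lineKernel_of_lt {n : ℕ} {z : ℤ} (h : (n : ℤ) < z) : lineKernel n z = 0 := by
  induction n generalizing z with
  | zero => rw [lineKernel, if_neg (by push_cast at h; omega)]
  | succ n ih =>
    push_cast at h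
    rw [lineKernel, ih (by omega), ih (by omega)]; simp

theorem lineKernel_choose (n k : ℕ) : lineKernel n (n - 2 * k) = n.choose k / 2 ^ n := by
  induction n generalizing k with
  | zero =>
    cases k with
    | zero => simp [lineKernel]
    | succ k => rw [lineKernel, if_neg (by push_cast; omega)]; simp
  | succ n ih =>
    cases k with
    | zero =>
      have := ih 0
      simp only [Nat.cast_zero, mul_zero, sub_zero, Nat.choose_zero_right, Nat.cast_one] at this ⊢
      rw [lineKernel, lineKernel_of_lt (by push_cast; omega)]
      push_cast
      rw [add_sub_cancel_right, this, pow_succ]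
      ring
    | succ k =>
      have e1 : ((n + 1 : ℕ) : ℤ) - 2 * ((k + 1 : ℕ) : ℤ) + 1 = n - 2 * k := by push_cast; ring
      have e2 : ((n + 1 : ℕ) : ℤ) - 2 * ((k + 1 : ℕ) : ℤ) - 1 = n - 2 * ((k + 1 : ℕ) : ℤ) := by
        push_cast; ring
      rw [lineKernel, e1, e2, ih, ih, Nat.choose_succ_succ, pow_succ]
      push_cast
      ring

theorem lineKernel_odd (n : ℕ) (k : ℤ) : lineKernel n (n + 1 - 2 * k) = 0 := by
  induction n generalizing k with
  | zero => rw [lineKernel, if_neg (by push_cast; omega)]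
  | succ n ih =>
    have e1 : ((n + 1 : ℕ) : ℤ) + 1 - 2 * k + 1 = n + 1 - 2 * (k - 1) := by push_cast; ring
    have e2 : ((n + 1 : ℕ) : ℤ) + 1 - 2 * k - 1 = n + 1 - 2 * k := by push_cast; ring
    rw [lineKernel, e1, e2, ih, ih]; simp

/-- The quotient of consecutive terms is (2m+1)(2m+3)/(2m+2)² ≤ 1. -/
theorem centralBinom_sq_mul_le (m : ℕ) :
    ((m.centralBinom : ℝ) / 4 ^ m) ^ 2 * (2 * m + 1) ≤ 1 := by
  induction m with
  | zero => simp
  | succ m ih =>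
    have h := congrArg (Nat.cast (R := ℝ)) (Nat.succ_mul_centralBinom_succ m)
    push_cast at h
    have hm : (0 : ℝ) < m + 1 := by positivity
    have e : ((m + 1).centralBinom : ℝ) / 4 ^ (m + 1) =
        (m.centralBinom : ℝ) / 4 ^ m * ((2 * m + 1) / (2 * (m + 1))) := by
      have : ((m + 1).centralBinom : ℝ) = 2 * (2 * m + 1) * m.centralBinom / (m + 1) := by
        rw [eq_div_iff hm.ne']; linarith
      rw [this, pow_succ]
      field_simp
      ring
    rw [e]
    set c := (m.centralBinom : ℝ) / 4 ^ m
    have h2 : (c * ((2 * m + 1) / (2 * (m + 1)))) ^ 2 * (2 * ((m + 1 : ℕ) : ℝ) + 1) =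
        c ^ 2 * (2 * m + 1) * (((2 * m + 1) * (2 * m + 3)) / (2 * (m + 1)) ^ 2) := by
      push_cast
      field_simp
      ring
    rw [h2]
    refine mul_le_one₀ ih (by positivity) ?_
    rw [div_le_one (by positivity)]
    nlinarith

theorem choose_half_sq_mul_le (n : ℕ) :
    ((n.choose (n / 2) : ℝ) / 2 ^ n) ^ 2 * (n + 1) ≤ 1 := by
  rcases Nat.even_or_odd' n with ⟨m, rfl | rfl⟩
  · have := centralBinom_sq_mul_le m
    rw [Nat.centralBinom] at this
    rw [Nat.mul_div_cancel_left m two_pos, pow_mul]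
    norm_num at this ⊢
    exact this
  -- For odd n the middle coefficient is half of the central one in the next row, so the two
  -- normalised values agree.
  · have h := centralBinom_sq_mul_le (m + 1)
    have e : ((m + 1).centralBinom : ℝ) = 2 * (2 * m + 1).choose m := by
      have : (m + 1).centralBinom = 2 * (2 * m + 1).choose m := by
        rw [Nat.centralBinom, show 2 * (m + 1) = 2 * m + 1 + 1 by ring, Nat.choose_succ_succ,
          Nat.choose_symm_half]
        ring
      rw [this]; push_cast; ring
    have e2 : (2 * m + 1) / 2 = m := by omega
    rw [e2]
    have e3 : ((2 * m + 1).choose m : ℝ) / 2 ^ (2 * m + 1) =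
        ((m + 1).centralBinom : ℝ) / 4 ^ (m + 1) := by
      rw [e, pow_succ, pow_mul, pow_succ]
      norm_num
      field_simp
      ring
    rw [e3]
    refine le_trans (mul_le_mul_of_nonneg_left ?_ (sq_nonneg _)) h
    push_cast
    linarith

theorem lineKernel_sq_mul_le (n : ℕ) (z : ℤ) : lineKernel n z ^ 2 * (n + 1) ≤ 1 := by
  have hz : lineKernel n z = 0 ∨ ∃ k : ℕ, lineKernel n z = n.choose k / 2 ^ n := by
    rcases lt_or_ge (n : ℤ) z with h | h
    · exact Or.inl (lineKernel_of_lt h)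
    · rcases Int.even_or_odd' ((n : ℤ) - z) with ⟨k, hk | hk⟩
      · refine Or.inr ⟨k.toNat, ?_⟩
        rw [← lineKernel_choose]
        congr 1
        omega
      · refine Or.inl ?_
        have : z = n + 1 - 2 * (k + 1) := by linarith
        rw [this, lineKernel_odd]
  rcases hz with h | ⟨k, h⟩
  · rw [h]; norm_num
  · rw [h]
    refine le_trans ?_ (choose_half_sq_mul_le n)
    have : (n.choose k : ℝ) ≤ n.choose (n / 2) := by exact_mod_cast Nat.choose_le_middle k n
    gcongr

/-! ### Heat kernel of ℤ⁴: upper bound -/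

section Lattice

/-- The lattice `ℤ⁴`. -/
local notation "L4" => latticeNetwork 4

theorem latticeNetwork_out {d : ℕ} (v : Fin d → ℤ) :
    (latticeNetwork d).out v = Finset.univ.image fun p : Fin d × Bool => (v, p) := by
  ext ⟨u, p⟩
  rw [Network.mem_out]
  simp [latticeNetwork, eq_comm]

theorem latticeNetwork_sum_out {d : ℕ} (v : Fin d → ℤ) (φ : (Fin d → ℤ) × Fin d × Bool → ℝ) :
    ∑ e ∈ (latticeNetwork d).out v, φ e = ∑ i, (φ (v, i, true) + φ (v, i, false)) := by
  rw [latticeNetwork_out, Finset.sum_image (fun p _ q _ h => (Prod.mk.inj h).2),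
    Fintype.sum_prod_type]
  simp

theorem latticeNetwork_out_nonempty (v : Fin 4 → ℤ) : ((L4).out v).Nonempty := by
  rw [latticeNetwork_out]; exact Finset.univ_nonempty.image _

theorem latticeNetwork_vertexCond (v : Fin 4 → ℤ) : (L4).vertexCond v = 8 := by
  rw [Network.vertexCond, latticeNetwork_sum_out]
  simp only [latticeNetwork, Finset.sum_const, Finset.card_univ, Fintype.card_fin]
  norm_num

theorem lattice_avg (f : (Fin 4 → ℤ) → ℝ) (v : Fin 4 → ℤ) : (L4).avg f v =
    (∑ i, (f (v + Pi.single i 1) + f (v - Pi.single i 1))) / 8 := by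
  rw [Network.avg, latticeNetwork_vertexCond, latticeNetwork_sum_out]
  simp [latticeNetwork, latticeStep, Pi.single_neg, sub_eq_add_neg]

theorem lattice_iterate_avg_sub (f : (Fin 4 → ℤ) → ℝ) (z : Fin 4 → ℤ) (k : ℕ) (u : Fin 4 → ℤ) :
    ((L4).avg^[k] fun y => f (z - y)) u = ((L4).avg^[k] f) (z - u) := by
  induction k generalizing u with
  | zero => rfl
  | succ k ih =>
    rw [Function.iterate_succ_apply', Function.iterate_succ_apply', lattice_avg, lattice_avg]
    congr 1
    refine Finset.sum_congr rfl fun i _ => ?_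
    rw [ih, ih, add_comm, sub_add_eq_sub_sub, sub_sub_eq_add_sub, add_sub_right_comm]

/-- The transition probabilities of the simple random walk on `ℤ⁴`. -/
noncomputable def heat (l : ℕ) : (Fin 4 → ℤ) → ℝ := (L4).avg^[l] fun z => if z = 0 then 1 else 0

theorem heat_nonneg (l : ℕ) (z : Fin 4 → ℤ) : 0 ≤ heat l z :=
  (L4).iterate_avg_nonneg (fun z => by split_ifs <;> norm_num) l z

theorem heat_succ (l : ℕ) : heat (l + 1) = (L4).avg (heat l) := Function.iterate_succ_apply' ..

theorem iterate_avg_heat (k l : ℕ) : (L4).avg^[k] (heat l) = heat (k + l) := by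
  rw [heat, heat, ← Function.iterate_add_apply]

theorem heat_neg (l : ℕ) (z : Fin 4 → ℤ) : heat l (-z) = heat l z := by
  have := lattice_iterate_avg_sub (fun z => if z = 0 then 1 else 0) 0 l z
  simp only [zero_sub, neg_eq_zero] at this
  exact this.symm

/-- Summing over z moves one step from the kernel onto `F`: this expresses the iterated average as
the mean of `F` over the l-step distribution. -/
theorem hasSum_heat_mul (l : ℕ) (F : (Fin 4 → ℤ) → ℝ) (u : Fin 4 → ℤ) :
    HasSum (fun z => heat l z * F (u + z)) (((L4).avg^[l] F) u) := by
  induction l generalizing F u with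
  | zero =>
    have := hasSum_single (f := fun z => heat 0 z * F (u + z)) 0 fun z hz => by simp [heat, hz]
    simpa [heat] using this
  | succ l ih =>
    rw [Function.iterate_succ_apply]
    have h1 := ih ((L4).avg F) u
    have h2 : ∀ i : Fin 4, HasSum (fun z => heat l (z - Pi.single i 1) * F (u + z))
        (((L4).avg^[l] fun y => F (y + Pi.single i 1)) u) := fun i => by
      have := ih (fun y => F (y + Pi.single i 1)) u
      rw [← (Equiv.addRight (Pi.single i 1 : Fin 4 → ℤ)).hasSum_iff]
      convert this using 2 with z
      simp [add_assoc]
    have h3 : ∀ i : Fin 4, HasSum (fun z => heat l (z + Pi.single i 1) * F (u + z))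
        (((L4).avg^[l] fun y => F (y - Pi.single i 1)) u) := fun i => by
      have := ih (fun y => F (y - Pi.single i 1)) u
      rw [← (Equiv.subRight (Pi.single i 1 : Fin 4 → ℤ)).hasSum_iff]
      convert this using 2 with z
      simp [add_sub_assoc]
    have h4 := (hasSum_sum fun i (_ : i ∈ Finset.univ) => (h2 i).add (h3 i)).mul_left (1 / 8)
    have e1 : (fun z => heat (l + 1) z * F (u + z)) = fun z => 1 / 8 * ∑ i : Fin 4,
        (heat l (z - Pi.single i 1) * F (u + z) + heat l (z + Pi.single i 1) * F (u + z)) := by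
      funext z
      rw [heat_succ, lattice_avg, div_mul_eq_mul_div, div_eq_inv_mul, Finset.sum_mul, one_div]
      exact congrArg _ (Finset.sum_congr rfl fun i _ => by ring)
    have e2 : ((L4).avg^[l] ((L4).avg F)) u = 1 / 8 * ∑ i : Fin 4,
        (((L4).avg^[l] fun y => F (y + Pi.single i 1)) u +
          ((L4).avg^[l] fun y => F (y - Pi.single i 1)) u) := by
      -- The sum over `Bool` writes two terms as a finite sum, the form that `iterate_avg_sum`
      -- handles.
      have e : (L4).avg F = fun y => 1 / 8 * ∑ i : Fin 4, ∑ b : Bool,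
          F (if b then y + Pi.single i 1 else y - Pi.single i 1) := by
        funext y
        rw [lattice_avg]
        simp [div_eq_inv_mul]
      rw [e, Network.iterate_avg_const_mul, Network.iterate_avg_sum]
      congr 1
      refine Finset.sum_congr rfl fun i _ => ?_
      rw [Network.iterate_avg_sum]
      simp
    rw [e1, e2]
    exact h4

/-- Both sides are inner products of `heat l` with its translates, so this is Cauchy–Schwarz. It
holds only at even times, which is why even times are singled out below. -/
theorem heat_two_mul_le (l : ℕ) (u : Fin 4 → ℤ) : heat (2 * l) u ≤ heat (2 * l) 0 := by
  have h1 := hasSum_heat_mul l (heat l) u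
  have h2 := hasSum_heat_mul l (heat l) 0
  rw [iterate_avg_heat, ← two_mul] at h1 h2
  simp only [zero_add] at h2
  have h3 : HasSum (fun z => heat l (u + z) * heat l (u + z)) (heat (2 * l) 0) :=
    ((Equiv.addLeft u).hasSum_iff (f := fun z => heat l z * heat l z)).2 h2
  have h4 := (h2.add h3).mul_left (1 / 2)
  refine (hasSum_le (fun z => ?_) h1 h4).trans (by linarith)
  nlinarith [sq_nonneg (heat l z - heat l (u + z))]

/-- A step in ℤ⁴ is a step of one coordinate chosen uniformly. Iterating writes `heat` as a mixture
of products of line kernels. -/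
theorem prod_lineKernel_avg (n : Fin 4 → ℕ) (z : Fin 4 → ℤ) :
    (L4).avg (fun z => ∏ i, lineKernel (n i) (z i)) z =
      1 / 4 * ∑ j, ∏ i, lineKernel (Function.update n j (n j + 1) i) (z i) := by
  rw [lattice_avg]
  simp only [Fin.sum_univ_four, Fin.prod_univ_four, Pi.add_apply, Pi.sub_apply, Pi.single_apply,
    Function.update_apply]
  simp [lineKernel]
  ring

/-- A coordinate clock advances with probability 1/4; for the mean of 1/s² this is at least as good
as a sure advance by 1/16. -/
theorem inv_sq_step {s : ℝ} (hs : 1 ≤ s) :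
    1 / 4 * (1 / (s + 1) ^ 2) + 3 / 4 * (1 / s ^ 2) ≤ 1 / (s + 1 / 16) ^ 2 := by
  have e : 1 / 4 * (1 / (s + 1) ^ 2) + 3 / 4 * (1 / s ^ 2) =
      (s ^ 2 + 3 * (s + 1) ^ 2) / (4 * (s ^ 2 * (s + 1) ^ 2)) := by
    field_simp
  rw [e, div_le_div_iff₀ (by positivity) (by positivity)]
  nlinarith [mul_nonneg (sub_nonneg.2 hs) (sub_nonneg.2 hs),
    mul_nonneg (mul_nonneg (sub_nonneg.2 hs) (sub_nonneg.2 hs)) (sub_nonneg.2 hs)]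

/-- AM–GM separates the four factors into fourth powers, each at most the inverse square of its
clock; `inv_sq_step` then follows the clocks through the `l` random choices. -/
theorem iterate_avg_prod_lineKernel_le (l : ℕ) (n : Fin 4 → ℕ) (z : Fin 4 → ℤ) :
    ((L4).avg^[l] fun z => ∏ i, lineKernel (n i) (z i)) z ≤
      1 / 4 * ∑ i, 1 / ((n i : ℝ) + 1 + l / 16) ^ 2 := by
  induction l generalizing n with
  | zero =>
    have h1 : ∀ i, lineKernel (n i) (z i) ^ 4 ≤ 1 / ((n i : ℝ) + 1) ^ 2 := fun i => by
      have := lineKernel_sq_mul_le (n i) (z i)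
      rw [le_div_iff₀ (by positivity)]
      have h2 : 0 ≤ lineKernel (n i) (z i) ^ 2 * (n i + 1) := by positivity
      nlinarith
    simp only [Function.iterate_zero, id, Nat.cast_zero, zero_div, add_zero, Fin.sum_univ_four,
      Fin.prod_univ_four]
    have a := h1 0
    have b := h1 1
    have c := h1 2
    have d := h1 3
    generalize lineKernel (n 0) (z 0) = p0 at *
    generalize lineKernel (n 1) (z 1) = p1 at *
    generalize lineKernel (n 2) (z 2) = p2 at *
    generalize lineKernel (n 3) (z 3) = p3 at *
    nlinarith [sq_nonneg (p0 * p1 - p2 * p3), sq_nonneg (p0 ^ 2 - p1 ^ 2),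
      sq_nonneg (p2 ^ 2 - p3 ^ 2)]
  | succ l ih =>
    rw [Function.iterate_succ_apply, show (L4).avg (fun z => ∏ i, lineKernel (n i) (z i)) = _ from
      funext fun z => prod_lineKernel_avg n z, Network.iterate_avg_const_mul,
      Network.iterate_avg_sum]
    refine (mul_le_mul_of_nonneg_left (Finset.sum_le_sum fun j _ => ih _)
      (by norm_num)).trans ?_
    have h1 : ∀ i, 1 / 4 * (1 / ((n i : ℝ) + 1 + 1 + l / 16) ^ 2) +
        3 / 4 * (1 / ((n i : ℝ) + 1 + l / 16) ^ 2) ≤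
        1 / ((n i : ℝ) + 1 + ((l + 1 : ℕ) : ℝ) / 16) ^ 2 := fun i => by
      have := inv_sq_step (s := (n i : ℝ) + 1 + l / 16)
        (by have : (0 : ℝ) ≤ n i := by positivity
            have : (0 : ℝ) ≤ l := by positivity
            linarith)
      convert this using 3 <;> push_cast <;> ring
    have a := h1 0
    have b := h1 1
    have c := h1 2
    have d := h1 3
    simp only [Fin.sum_univ_four, Function.update_apply]
    simp only [reduceIte, Fin.reduceEq, Nat.cast_add, Nat.cast_one] at a b c d ⊢
    linarith

theorem heat_le (l : ℕ) (z : Fin 4 → ℤ) : heat l z ≤ 256 / ((l : ℝ) + 1) ^ 2 := by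
  have h := iterate_avg_prod_lineKernel_le l 0 z
  have e : (fun z : Fin 4 → ℤ => ∏ i, lineKernel ((0 : Fin 4 → ℕ) i) (z i)) =
      fun z => if z = 0 then 1 else 0 := by
    funext z
    simp only [lineKernel]
    by_cases hz : z = 0
    · simp [hz]
    · rw [if_neg hz]
      obtain ⟨i, hi⟩ := Function.ne_iff.1 hz
      exact Finset.prod_eq_zero (Finset.mem_univ i) (if_neg hi)
  rw [e] at h
  refine h.trans ?_
  simp only [Pi.zero_apply, Nat.cast_zero, zero_add, Finset.sum_const, Finset.card_univ,
    Fintype.card_fin, nsmul_eq_mul]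
  have : (0 : ℝ) ≤ l := by positivity
  rw [show (1 : ℝ) / 4 * (((4 : ℕ) : ℝ) * (1 / (1 + (l : ℝ) / 16) ^ 2)) =
    256 / ((l : ℝ) + 16) ^ 2 by push_cast; field_simp; ring]
  gcongr
  norm_num

end Lattice

/-! ### Two-time correlations and elementary sums -/

namespace Network

variable {V E : Type*} (G : Network V E)

theorem pathExp_apply (hG : ∀ v, (G.out v).Nonempty) {i j N : ℕ} (hij : i ≤ j) (hj : j ≤ i + N)
    (f : V → ℝ) (w : ℕ → V) :
    G.pathExp i N (fun w => f (w j)) w = (G.avg^[j - i] f) (w i) := by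
  have e : N = (j - i) + (i + N - j) := by omega
  rw [e, pathExp_add_steps, ← pathExp_comp_apply, Nat.add_sub_cancel' hij]
  refine G.pathExp_congr fun w' _ _ => G.pathExp_of_dependsBetween hG (fun u u' h => ?_) w'
  rw [h j j.zero_le le_rfl]

theorem pathExp_apply_mul_apply (hG : ∀ v, (G.out v).Nonempty) {i j k N : ℕ} (hij : i ≤ j)
    (hjk : j ≤ k) (hk : k ≤ i + N) (f h : V → ℝ) (w : ℕ → V) :
    G.pathExp i N (fun w => f (w j) * h (w k)) w =
      (G.avg^[j - i] fun v => f v * (G.avg^[k - j] h) v) (w i) := by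
  have e : N = (j - i) + (i + N - j) := by omega
  rw [← G.pathExp_apply hG hij (by omega : j ≤ i + (j - i)), e, pathExp_add_steps,
    Nat.add_sub_cancel' hij]
  refine G.pathExp_congr fun w' _ _ => ?_
  rw [G.pathExp_mul_left (fun u u' hu => by rw [hu j j.zero_le le_rfl]),
    G.pathExp_apply hG hjk (by omega)]

end Network

theorem sum_inv_sq_le (k N : ℕ) :
    ∑ l ∈ Finset.range N, 1 / (((l + k : ℕ) : ℝ) + 1) ^ 2 ≤ 2 / ((k : ℝ) + 1) := by
  have h : ∑ l ∈ Finset.range N, 1 / (((l + k : ℕ) : ℝ) + 1) ^ 2 ≤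
      2 / ((k : ℝ) + 1) - 2 / ((N : ℝ) + k + 1) := by
    induction N with
    | zero => simp
    | succ N ih =>
      rw [Finset.sum_range_succ]
      have : 1 / (((N + k : ℕ) : ℝ) + 1) ^ 2 ≤
          2 / ((N : ℝ) + k + 1) - 2 / (((N + 1 : ℕ) : ℝ) + k + 1) := by
        push_cast
        rw [div_sub_div _ _ (by positivity) (by positivity),
          div_le_div_iff₀ (by positivity) (by positivity)]
        have : (0 : ℝ) ≤ N + k := by positivity
        nlinarith
      linarith
  have : (0 : ℝ) ≤ 2 / ((N : ℝ) + k + 1) := by positivity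
  linarith

theorem summable_of_le_inv_sq {f : ℕ → ℝ} {C : ℝ} (hf : ∀ l, 0 ≤ f l)
    (hC : ∀ l : ℕ, f l ≤ C / ((l : ℝ) + 1) ^ 2) (k : ℕ) :
    Summable (fun l => f (l + k)) ∧ ∑' l, f (l + k) ≤ 2 * C / ((k : ℝ) + 1) := by
  have hC0 : 0 ≤ C := by simpa using (hf 0).trans (hC 0)
  have h : ∀ N, ∑ l ∈ Finset.range N, f (l + k) ≤ 2 * C / ((k : ℝ) + 1) := fun N => by
    calc ∑ l ∈ Finset.range N, f (l + k)
        ≤ ∑ l ∈ Finset.range N, C * (1 / (((l + k : ℕ) : ℝ) + 1) ^ 2) :=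
          Finset.sum_le_sum fun l _ => (hC _).trans (by rw [mul_one_div])
      _ ≤ C * (2 / ((k : ℝ) + 1)) := by
          rw [← Finset.mul_sum]
          exact mul_le_mul_of_nonneg_left (sum_inv_sq_le k N) hC0
      _ = 2 * C / ((k : ℝ) + 1) := by ring
  exact ⟨summable_of_sum_range_le (fun l => hf _) h,
    Real.tsum_le_of_sum_range_le (fun l => hf _) h⟩

theorem harmonic_pos_real (n : ℕ) : (1 : ℝ) ≤ ((harmonic (n + 1) : ℚ) : ℝ) := by
  have : (1 : ℚ) ≤ harmonic (n + 1) := by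
    rw [harmonic, Finset.sum_range_succ']
    simp only [zero_add, Nat.cast_one, inv_one]
    have : (0 : ℚ) ≤ ∑ k ∈ Finset.range n, ((k + 1 + 1 : ℕ) : ℚ)⁻¹ :=
      Finset.sum_nonneg fun _ _ => by positivity
    linarith
  exact_mod_cast this

theorem sum_inv_eq_harmonic (n : ℕ) :
    ∑ k ∈ Finset.range n, 1 / ((k : ℝ) + 1) = ((harmonic n : ℚ) : ℝ) := by
  rw [harmonic]
  push_cast
  exact Finset.sum_congr rfl fun k _ => by rw [one_div]

theorem harmonic_le_mul_log {n : ℕ} (hn : 2 ≤ n) :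
    ((harmonic (n + 1) : ℚ) : ℝ) ≤ 4 * Real.log n := by
  have h1 := harmonic_le_one_add_log (n + 1)
  have hn' : (2 : ℝ) ≤ n := by exact_mod_cast hn
  have h2 : Real.log ((n + 1 : ℕ) : ℝ) ≤ 2 * Real.log n := by
    rw [← Real.log_rpow (by positivity)]
    refine Real.log_le_log (by positivity) ?_
    push_cast
    norm_num
    nlinarith
  have h3 : Real.log 2 ≤ Real.log n := Real.log_le_log (by norm_num) hn'
  have h4 := Real.log_two_gt_d9
  linarith

/-! ### Green function of ℤ⁴ and the capacity of the walk from below -/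

section Lattice

local notation "L4" => latticeNetwork 4

/-- The Green function of the simple random walk on `ℤ⁴`. -/
noncomputable def latticeGreen (z : Fin 4 → ℤ) : ℝ := ∑' l, heat l z

theorem hasSum_latticeGreen (z : Fin 4 → ℤ) : HasSum (fun l => heat l z) (latticeGreen z) :=
  (summable_of_le_inv_sq (fun l => heat_nonneg l z) (fun l => heat_le l z) 0).1.hasSum

theorem latticeGreen_nonneg (z : Fin 4 → ℤ) : 0 ≤ latticeGreen z :=
  tsum_nonneg fun l => heat_nonneg l z

theorem latticeGreen_neg (z : Fin 4 → ℤ) : latticeGreen (-z) = latticeGreen z := by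
  simp only [latticeGreen, heat_neg]

/-- Averaging k times drops the first k terms of the Green series, whose terms are O(1/l²). -/
theorem iterate_avg_latticeGreen_le (k : ℕ) (z : Fin 4 → ℤ) :
    ((L4).avg^[k] latticeGreen) z ≤ 512 / ((k : ℝ) + 1) := by
  have h := (L4).hasSum_iterate_avg hasSum_latticeGreen k z
  simp only [iterate_avg_heat, add_comm k] at h
  rw [← h.tsum_eq]
  refine (summable_of_le_inv_sq (fun l => heat_nonneg l z) (fun l => heat_le l z) k).2.trans ?_
  norm_num

theorem latticeGreen_sub_avg (z : Fin 4 → ℤ) :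
    latticeGreen z - (L4).avg latticeGreen z = if z = 0 then 1 else 0 := by
  have h := (L4).hasSum_iterate_avg hasSum_latticeGreen 1 z
  simp only [iterate_avg_heat, add_comm 1] at h
  have h2 := (hasSum_nat_add_iff (f := fun l => heat l z) 1).1 h
  rw [(hasSum_latticeGreen z).unique h2]
  simp [heat]

/-- The lower bound on the mean capacity of the simple random walk path. -/
theorem le_pathExp_capacity_lattice (x : Fin 4 → ℤ) (n : ℕ) :
    ((n : ℝ) + 1) / (128 * ((harmonic (n + 1) : ℚ) : ℝ)) ≤
      (L4).pathExp 0 n (fun w => (L4).capacity (pathVertices w n)) (fun _ => x) := by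
  have hG := latticeNetwork_out_nonempty
  set H : ℝ := ((harmonic (n + 1) : ℚ) : ℝ) with hH
  have hH1 : 1 ≤ H := harmonic_pos_real n
  -- The maximiser of 2t(n+1) - 128 t²(n+1)H, with value t(n+1).
  set t : ℝ := 1 / (128 * H) with ht
  have hpt : ∀ w : ℕ → Fin 4 → ℤ, (∀ i ≤ 0, w i = x) → (L4).IsPath 0 n w →
      2 * t * (n + 1) - t ^ 2 * (∑ i ∈ Finset.range (n + 1), ∑ j ∈ Finset.range (n + 1),
        1 / 8 * latticeGreen (w j - w i)) ≤ (L4).capacity (pathVertices w n) := by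
    intro w hw hp
    have := (L4).le_capacity hG (Finset.range (n + 1)) w (x := x) (r := n)
      (hp.pathVertices_subset hw subset_rfl)
      (fun i hi => mem_pathVertices.2 ⟨i, by simpa [Nat.lt_succ_iff] using hi, rfl⟩)
      (f := fun u => ∑ j ∈ Finset.range (n + 1), 1 / 8 * latticeGreen (w j - u))
      (fun u => Finset.sum_nonneg fun j _ => mul_nonneg (by norm_num) (latticeGreen_nonneg _))
      (fun u => ?_) t
    · simpa using this
    · rw [latticeNetwork_vertexCond, Network.avg_sum, ← Finset.sum_sub_distrib, Finset.mul_sum]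
      refine Finset.sum_le_sum fun j _ => ?_
      have h1 := lattice_iterate_avg_sub latticeGreen (w j) 1 u
      simp only [Function.iterate_one] at h1
      rw [Network.avg_const_mul, h1, ← mul_sub, latticeGreen_sub_avg]
      by_cases h : u = w j
      · simp [h]
      · rw [Set.indicator_of_notMem (s := {w j}) h, if_neg (by rw [sub_eq_zero]; exact Ne.symm h)]; simp
  -- For i ≤ j the Markov property gives a mean at most 512/(j-i+1), hence a harmonic sum for each
  -- i. The constant is 128 = 2 · 512/8, where 1/8 normalises the Green kernel by the vertex
  -- conductance 8.
  have hE : (L4).pathExp 0 n (fun w => ∑ i ∈ Finset.range (n + 1), ∑ j ∈ Finset.range (n + 1),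
      1 / 8 * latticeGreen (w j - w i)) (fun _ => x) ≤ 128 * (n + 1) * H := by
    have h1 : (L4).pathExp 0 n (fun w => ∑ i ∈ Finset.range (n + 1), ∑ j ∈ Finset.range (n + 1),
        1 / 8 * latticeGreen (w j - w i)) (fun _ => x) ≤
        (L4).pathExp 0 n (fun w => 2 * ∑ i ∈ Finset.range (n + 1), ∑ j ∈ Finset.range (n + 1),
          (if i ≤ j then 1 / 8 else 0) * latticeGreen (w j - w i)) (fun _ => x) := by
      refine (L4).pathExp_le fun w _ _ => ?_
      have := Network.sum_sum_le_two_mul_of_symm (n + 1)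
        (a := fun i j => 1 / 8 * latticeGreen (w j - w i))
        (fun i _ j _ => mul_nonneg (by norm_num) (latticeGreen_nonneg _))
        (fun i _ j _ => by rw [← neg_sub, latticeGreen_neg])
      simpa only [ite_mul, zero_mul] using this
    refine h1.trans ?_
    simp only [Network.pathExp_const_mul, Network.pathExp_sum]
    have h2 : ∀ i ∈ Finset.range (n + 1), ∑ j ∈ Finset.range (n + 1),
        (if i ≤ j then 1 / 8 else 0) *
          (L4).pathExp 0 n (fun w => latticeGreen (w j - w i)) (fun _ => x) ≤ 64 * H := by
      intro i hi
      have hi' : i ≤ n := by simpa [Nat.lt_succ_iff] using hi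
      have h3 : ∀ j ∈ Finset.range (n + 1), (if i ≤ j then 1 / 8 else 0) *
          (L4).pathExp 0 n (fun w => latticeGreen (w j - w i)) (fun _ => x) ≤
          if i ≤ j then 64 * (1 / (((j - i : ℕ) : ℝ) + 1)) else 0 := by
        intro j hj
        have hj' : j ≤ n := by simpa [Nat.lt_succ_iff] using hj
        split_ifs with hij
        · have : (L4).pathExp 0 n (fun w => latticeGreen (w j - w i)) (fun _ => x) ≤
              512 / (((j - i : ℕ) : ℝ) + 1) := by
            rw [(L4).pathExp_split hi']
            refine ((L4).pathExp_le (F' := fun _ => 512 / (((j - i : ℕ) : ℝ) + 1))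
              fun w _ _ => ?_).trans ((L4).pathExp_const hG ..).le
            rw [(L4).pathExp_congr
              (F' := fun w' => (fun y => latticeGreen (w i - y)) (w' j))
              fun w' hw' _ => by rw [hw' i le_rfl, ← neg_sub, latticeGreen_neg],
              (L4).pathExp_apply hG hij (by omega) (fun y => latticeGreen (w i - y)),
              lattice_iterate_avg_sub]
            exact iterate_avg_latticeGreen_le _ _
          calc _ ≤ 1 / 8 * (512 / (((j - i : ℕ) : ℝ) + 1)) :=
                mul_le_mul_of_nonneg_left this (by norm_num)
            _ = _ := by ring
        · simp
      refine (Finset.sum_le_sum h3).trans ?_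
      rw [← Finset.sum_filter, hH, ← sum_inv_eq_harmonic, Finset.mul_sum]
      have himg : ((Finset.range (n + 1)).filter fun j => i ≤ j).image (fun j => j - i) ⊆
          Finset.range (n + 1) := by
        intro k hk
        simp only [Finset.mem_image, Finset.mem_filter, Finset.mem_range] at hk ⊢
        omega
      refine le_trans (le_of_eq ?_) (Finset.sum_le_sum_of_subset_of_nonneg himg
        fun _ _ _ => by positivity)
      rw [Finset.sum_image]
      intro a ha b hb hab
      simp only [Finset.coe_filter, Finset.mem_range, Set.mem_ofPred_eq] at ha hb hab
      omega
    calc _ ≤ 2 * ∑ i ∈ Finset.range (n + 1), 64 * H :=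
          mul_le_mul_of_nonneg_left (Finset.sum_le_sum h2) (by norm_num)
      _ = 128 * (n + 1) * H := by simp; ring
  have hfin := (L4).pathExp_le (m := 0) (k := n) (w := fun _ => x) hpt
  rw [Network.pathExp_sub, (L4).pathExp_const hG, Network.pathExp_const_mul] at hfin
  have h2 := mul_le_mul_of_nonneg_left hE (sq_nonneg t)
  have h3 : t ^ 2 * (128 * (n + 1) * H) = t * (n + 1) := by rw [ht]; field_simp
  have h4 : ((n : ℝ) + 1) / (128 * H) = t * (n + 1) := by rw [ht]; field_simp
  rw [h4]
  linarith

theorem iterate_avg_sum_sq (l : ℕ) (z : Fin 4 → ℤ) :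
    ((L4).avg^[l] fun z => ∑ i, (z i : ℝ) ^ 2) z = ∑ i, (z i : ℝ) ^ 2 + l := by
  induction l generalizing z with
  | zero => simp
  | succ l ih =>
    rw [Function.iterate_succ_apply', show (L4).avg^[l] (fun z => ∑ i, (z i : ℝ) ^ 2) = _ from
      funext ih, Network.avg_add, (L4).avg_const latticeNetwork_out_nonempty, lattice_avg]
    simp only [Fin.sum_univ_four, Pi.add_apply, Pi.sub_apply, Pi.single_apply]
    simp
    ring

/-- `heat (2 * l) 0` is the sum of the squares of `heat l`. Since the l-step walk has mean squared
norm l, half of the mass of `heat l` sits in a box with O((l+1)²) points, and Cauchy–Schwarz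
concludes. -/
theorem heat_two_mul_zero_ge (l : ℕ) : 1 / 5184 / ((l : ℝ) + 1) ^ 2 ≤ heat (2 * l) 0 := by
  classical
  set s := Nat.sqrt (2 * l) with hs
  set M : ℕ := s + 1 with hM
  have hs1 : s * s ≤ 2 * l := Nat.sqrt_le _
  have hM1 : 2 * l < M * M := Nat.lt_succ_sqrt _
  set B : Finset (Fin 4 → ℤ) := Fintype.piFinset fun _ => Finset.Icc (-(M : ℤ)) M with hB
  have hcard : (B.card : ℝ) ≤ 1296 * ((l : ℝ) + 1) ^ 2 := by
    have e : B.card = (2 * M + 1) ^ 4 := by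
      rw [hB, Fintype.card_piFinset]
      simp only [Int.card_Icc, Finset.prod_const, Finset.card_univ, Fintype.card_fin]
      congr 1
      omega
    have h1 : (2 * M + 1) ^ 2 ≤ 36 * (l + 1) := by
      rw [hM]
      nlinarith [sq_nonneg ((s : ℤ) - 1)]
    have h2 : (2 * M + 1) ^ 4 ≤ 1296 * (l + 1) ^ 2 :=
      calc (2 * M + 1) ^ 4 = ((2 * M + 1) ^ 2) ^ 2 := by ring
        _ ≤ (36 * (l + 1)) ^ 2 := Nat.pow_le_pow_left h1 2
        _ = _ := by ring
    rw [e]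
    exact_mod_cast h2
  have hMpos : (0 : ℝ) < (M : ℝ) ^ 2 := by positivity
  have hmass : 1 / 2 ≤ ∑ z ∈ B, heat l z := by
    have h1 := hasSum_heat_mul l (fun _ => 1) 0
    have h2 := hasSum_heat_mul l (fun z => ∑ i, (z i : ℝ) ^ 2) 0
    rw [(L4).iterate_avg_const latticeNetwork_out_nonempty] at h1
    rw [iterate_avg_sum_sq] at h2
    have h3 := h1.sub (h2.mul_left (1 / (M : ℝ) ^ 2))
    have h4 : HasSum (fun z => if z ∈ B then heat l z else 0) (∑ z ∈ B, heat l z) := by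
      rw [← Finset.sum_congr rfl (fun z hz => if_pos hz : ∀ z ∈ B,
        (if z ∈ B then heat l z else 0) = heat l z)]
      exact hasSum_sum_of_ne_finset_zero fun z hz => if_neg hz
    have h5 := hasSum_le (fun z => ?_) h3 h4
    · refine le_trans ?_ h5
      have : 2 * (l : ℝ) ≤ (M : ℝ) ^ 2 := by
        have : 2 * l ≤ M ^ 2 := by rw [sq]; exact hM1.le
        exact_mod_cast this
      simp only [Pi.zero_apply, Int.cast_zero, ne_eq, OfNat.ofNat_ne_zero, not_false_eq_true,
        zero_pow, Finset.sum_const_zero, zero_add]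
      rw [one_div_mul_eq_div, le_sub_iff_add_le, ← le_sub_iff_add_le', div_le_iff₀ hMpos]
      linarith
    · have hh := heat_nonneg l z
      simp only [zero_add, mul_one]
      split_ifs with hz
      · have : 0 ≤ 1 / (M : ℝ) ^ 2 * (heat l z * ∑ i, (z i : ℝ) ^ 2) := by positivity
        linarith
      · have : ∃ i, (M : ℤ) ^ 2 ≤ z i ^ 2 := by
          simp only [hB, Fintype.mem_piFinset, Finset.mem_Icc, not_forall] at hz
          obtain ⟨i, hi⟩ := hz
          refine ⟨i, sq_le_sq.2 ?_⟩
          rw [abs_of_nonneg (Int.natCast_nonneg M), le_abs]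
          omega
        obtain ⟨i, hi⟩ := this
        have hi' : (M : ℝ) ^ 2 ≤ (z i : ℝ) ^ 2 := by exact_mod_cast hi
        have h6 : (M : ℝ) ^ 2 ≤ ∑ i, (z i : ℝ) ^ 2 :=
          hi'.trans (Finset.single_le_sum (f := fun i => (z i : ℝ) ^ 2)
            (fun i _ => sq_nonneg _) (Finset.mem_univ i))
        rw [sub_nonpos, one_div_mul_eq_div, le_div_iff₀ hMpos]
        exact mul_le_mul_of_nonneg_left h6 hh
  have hsq : ∑ z ∈ B, heat l z ^ 2 ≤ heat (2 * l) 0 := by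
    have h := hasSum_heat_mul l (heat l) 0
    rw [iterate_avg_heat, ← two_mul] at h
    simp only [zero_add, ← sq] at h
    exact sum_le_hasSum B (fun z _ => sq_nonneg _) h
  have hCS := sq_sum_le_card_mul_sum_sq (s := B) (f := heat l)
  have h0 := heat_nonneg (2 * l) 0
  have h7 : (1 / 2 : ℝ) ^ 2 ≤ 1296 * ((l : ℝ) + 1) ^ 2 * heat (2 * l) 0 :=
    calc (1 / 2 : ℝ) ^ 2 ≤ (∑ z ∈ B, heat l z) ^ 2 := by gcongr
      _ ≤ _ := hCS
      _ ≤ _ := by gcongr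
  rw [div_le_iff₀ (by positivity)]
  linarith

/-! ### The Green function summed along the future: mean and variance -/

theorem heat_two_mul_le_inv_sq (l : ℕ) (z : Fin 4 → ℤ) :
    heat (2 * l) z ≤ 256 / ((l : ℝ) + 1) ^ 2 := by
  refine (heat_le _ _).trans ?_
  have : (0 : ℝ) ≤ l := by positivity
  gcongr
  linarith

/-- The expected number of visits at even times. -/
noncomputable def evenGreen (z : Fin 4 → ℤ) : ℝ := ∑' l, heat (2 * l) z

/-- The expected number of returns to the origin at even times not before `2 * t`. -/
noncomputable def returnTail (t : ℕ) : ℝ := ∑' l, heat (2 * (l + t)) 0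

theorem summable_heat_two_mul (t : ℕ) (z : Fin 4 → ℤ) :
    Summable (fun l => heat (2 * (l + t)) z) ∧
      ∑' l, heat (2 * (l + t)) z ≤ 512 / ((t : ℝ) + 1) := by
  have := summable_of_le_inv_sq (f := fun l => heat (2 * l) z) (fun _ => heat_nonneg _ z)
    (fun l => heat_two_mul_le_inv_sq l z) t
  norm_num at this ⊢
  exact this

theorem hasSum_evenGreen (z : Fin 4 → ℤ) : HasSum (fun l => heat (2 * l) z) (evenGreen z) :=
  (summable_heat_two_mul 0 z).1.hasSum

theorem evenGreen_nonneg (z : Fin 4 → ℤ) : 0 ≤ evenGreen z :=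
  tsum_nonneg fun _ => heat_nonneg _ z

theorem evenGreen_le_latticeGreen (z : Fin 4 → ℤ) : evenGreen z ≤ latticeGreen z :=
  hasSum_le_inj (fun l => 2 * l) (fun a b h => by simpa using h) (fun l _ => heat_nonneg l z)
    (fun _ => le_rfl) (hasSum_evenGreen z) (hasSum_latticeGreen z)

theorem returnTail_nonneg (t : ℕ) : 0 ≤ returnTail t := tsum_nonneg fun _ => heat_nonneg _ _

theorem returnTail_le (t : ℕ) : returnTail t ≤ 512 / ((t : ℝ) + 1) := (summable_heat_two_mul t 0).2

/-- The first t + 1 terms are each at least 1/(5184(2t+1)²), and 20736 = 4 · 5184. -/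
theorem returnTail_ge (t : ℕ) : 1 / 20736 * (1 / ((t : ℝ) + 1)) ≤ returnTail t := by
  have h := (summable_heat_two_mul t 0).1.sum_le_tsum (Finset.range (t + 1))
    fun l _ => heat_nonneg _ _
  refine le_trans ?_ h
  have h2 : ∀ l ∈ Finset.range (t + 1), 1 / 20736 * (1 / ((t : ℝ) + 1) ^ 2) ≤
      heat (2 * (l + t)) 0 := fun l hl => by
    refine le_trans ?_ (heat_two_mul_zero_ge (l + t))
    have hl' : (l : ℝ) ≤ t := by exact_mod_cast (by simpa [Nat.lt_succ_iff] using hl : l ≤ t)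
    rw [div_mul_div_comm, div_div, div_le_div_iff₀ (by positivity) (by positivity)]
    push_cast
    have : ((l : ℝ) + t + 1) ^ 2 ≤ (2 * ((t : ℝ) + 1)) ^ 2 := by gcongr; linarith
    linarith
  refine le_trans (le_of_eq ?_) (Finset.card_nsmul_le_sum _ _ _ h2)
  simp only [Finset.card_range, nsmul_eq_mul]
  push_cast
  field_simp

theorem iterate_avg_evenGreen (t : ℕ) (z : Fin 4 → ℤ) :
    ((L4).avg^[2 * t] evenGreen) z = ∑' l, heat (2 * (l + t)) z := by
  have h := (L4).hasSum_iterate_avg hasSum_evenGreen (2 * t) z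
  rw [← h.tsum_eq]
  simp only [iterate_avg_heat, ← mul_add, add_comm t]

theorem iterate_avg_evenGreen_zero (t : ℕ) : ((L4).avg^[2 * t] evenGreen) 0 = returnTail t :=
  iterate_avg_evenGreen t 0

theorem iterate_avg_evenGreen_le (t : ℕ) (z : Fin 4 → ℤ) :
    ((L4).avg^[2 * t] evenGreen) z ≤ returnTail t := by
  rw [iterate_avg_evenGreen]
  exact (summable_heat_two_mul t z).1.tsum_le_tsum (fun l => heat_two_mul_le _ _)
    (summable_heat_two_mul t 0).1

/-- The correlation of the even Green function at the times `2 * j` and `2 * (j + t)`. -/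
noncomputable def greenCorr (j t : ℕ) : ℝ :=
  ((L4).avg^[2 * j] fun v => evenGreen v * ((L4).avg^[2 * t] evenGreen) v) 0

/-- The later factor is at most `returnTail t` from any position. This is sharp enough for `t > j`,
where the products assemble into the square of the mean. -/
theorem greenCorr_le_mul (j t : ℕ) : greenCorr j t ≤ returnTail j * returnTail t := by
  rw [mul_comm, ← iterate_avg_evenGreen_zero j, ← Network.iterate_avg_const_mul]
  refine (L4).iterate_avg_le (fun v => ?_) _ _
  rw [mul_comm]
  exact mul_le_mul_of_nonneg_right (iterate_avg_evenGreen_le t v) (evenGreen_nonneg v)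

/-- The two kernels exchange roles: the 2j-step one is bounded by its value at 0, and the 2l-step
one becomes the transition. -/
theorem iterate_avg_heat_mul_le (j l : ℕ) {h : (Fin 4 → ℤ) → ℝ} (hh : ∀ v, 0 ≤ h v) :
    ((L4).avg^[2 * j] fun v => heat (2 * l) v * h v) 0 ≤
      heat (2 * j) 0 * ((L4).avg^[2 * l] h) 0 := by
  refine hasSum_le (fun z => ?_) (hasSum_heat_mul (2 * j) _ 0)
    ((hasSum_heat_mul (2 * l) h 0).mul_left _)
  rw [zero_add]
  exact mul_le_mul_of_nonneg_right (heat_two_mul_le j z) (mul_nonneg (heat_nonneg _ _) (hh z))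

/-- Needed for `t ≤ j`. The Green series is cut at j: its tail is at most `returnTail j`, and each
earlier term is handled by the exchange of kernels. -/
theorem greenCorr_le (j t : ℕ) : greenCorr j t ≤ 262144 / ((j : ℝ) + 1) ^ 2 +
    131072 / ((j : ℝ) + 1) ^ 2 * ∑ l ∈ Finset.range j, 1 / ((l : ℝ) + t + 1) := by
  set h := (L4).avg^[2 * t] evenGreen with hh
  have h0 : ∀ v, 0 ≤ h v := fun v => (L4).iterate_avg_nonneg evenGreen_nonneg _ v
  have hit : ∀ l, ((L4).avg^[2 * l] h) 0 = returnTail (l + t) := fun l => by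
    rw [hh, ← Function.iterate_add_apply, ← mul_add, iterate_avg_evenGreen_zero]
  have hg : ∀ v, evenGreen v ≤ ∑ l ∈ Finset.range j, heat (2 * l) v + returnTail j := fun v => by
    have e := (hasSum_evenGreen v).summable.sum_add_tsum_nat_add j
    rw [evenGreen, ← e]
    exact add_le_add_right ((iterate_avg_evenGreen j v).symm.le.trans
      (iterate_avg_evenGreen_le j v)) _
  have h1 : greenCorr j t ≤ ∑ l ∈ Finset.range j, ((L4).avg^[2 * j] fun v =>
      heat (2 * l) v * h v) 0 + returnTail j * ((L4).avg^[2 * j] h) 0 := by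
    rw [← Network.iterate_avg_const_mul, ← Network.iterate_avg_sum]
    refine ((L4).iterate_avg_le (g := fun v => ∑ b : Bool, if b then
      ∑ l ∈ Finset.range j, heat (2 * l) v * h v else returnTail j * h v) (fun v => ?_) _ _).trans ?_
    · simp only [Fintype.sum_bool, reduceIte, Bool.false_eq_true, ← Finset.sum_mul, ← add_mul]
      exact mul_le_mul_of_nonneg_right (hg v) (h0 v)
    · rw [Network.iterate_avg_sum]
      simp
  refine h1.trans ?_
  rw [add_comm]
  refine add_le_add ?_ ?_
  · rw [hit]
    have hj := returnTail_le j
    have hjt : returnTail (j + t) ≤ 512 / ((j : ℝ) + 1) := by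
      refine (returnTail_le _).trans ?_
      have : (0 : ℝ) ≤ t := by positivity
      push_cast
      gcongr
      linarith
    calc _ ≤ 512 / ((j : ℝ) + 1) * (512 / ((j : ℝ) + 1)) :=
          mul_le_mul hj hjt (returnTail_nonneg _) (by positivity)
      _ = _ := by field_simp; norm_num
  · rw [Finset.mul_sum]
    refine Finset.sum_le_sum fun l _ => (iterate_avg_heat_mul_le j l h0).trans ?_
    rw [hit]
    calc _ ≤ 256 / ((j : ℝ) + 1) ^ 2 * (512 / (((l + t : ℕ) : ℝ) + 1)) :=
          mul_le_mul (heat_two_mul_le_inv_sq j 0) (returnTail_le _) (returnTail_nonneg _)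
            (by positivity)
      _ = _ := by push_cast; rw [div_mul_div_comm, div_mul_div_comm]; norm_num

theorem sum_sum_inv_add_le (N : ℕ) :
    ∑ t ∈ Finset.range N, ∑ l ∈ Finset.range N, 1 / ((l : ℝ) + t + 1) ≤ 2 * N := by
  induction N with
  | zero => simp
  | succ N ih =>
    have h1 : ∑ l ∈ Finset.range N, 1 / ((l : ℝ) + N + 1) ≤ N * (1 / ((N : ℝ) + 1)) := by
      have := Finset.sum_le_card_nsmul (Finset.range N) (fun l => 1 / ((l : ℝ) + N + 1))
        (1 / ((N : ℝ) + 1)) fun l _ => by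
          have : (0 : ℝ) ≤ l := by positivity
          gcongr
          linarith
      simpa using this
    have h2 : ∑ t ∈ Finset.range N, 1 / ((N : ℝ) + t + 1) =
        ∑ l ∈ Finset.range N, 1 / ((l : ℝ) + N + 1) :=
      Finset.sum_congr rfl fun l _ => by rw [add_comm (N : ℝ)]
    have h3 : 1 / ((N : ℝ) + N + 1) ≤ 1 / ((N : ℝ) + 1) := by
      have : (0 : ℝ) ≤ N := by positivity
      gcongr
      linarith
    have h4 : (N : ℝ) * (1 / ((N : ℝ) + 1)) + 1 / ((N : ℝ) + 1) = 1 := by field_simp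
    have h5 : 0 ≤ 1 / ((N : ℝ) + 1) := by positivity
    simp only [Finset.sum_range_succ, Finset.sum_add_distrib]
    rw [h2]
    push_cast
    linarith

theorem sum_greenCorr_le (j : ℕ) :
    ∑ t ∈ Finset.range (j + 1), greenCorr j t ≤ 524288 * (1 / ((j : ℝ) + 1)) := by
  refine (Finset.sum_le_sum fun t _ => greenCorr_le j t).trans ?_
  rw [Finset.sum_add_distrib, ← Finset.mul_sum]
  have h1 : ∑ t ∈ Finset.range (j + 1), ∑ l ∈ Finset.range j, 1 / ((l : ℝ) + t + 1) ≤
      2 * ((j + 1 : ℕ) : ℝ) := by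
    refine le_trans (Finset.sum_le_sum fun t _ => ?_) (sum_sum_inv_add_le (j + 1))
    exact Finset.sum_le_sum_of_subset_of_nonneg (Finset.range_mono j.le_succ)
      fun _ _ _ => by positivity
  have h2 := mul_le_mul_of_nonneg_left h1
    (by positivity : (0 : ℝ) ≤ 131072 / ((j : ℝ) + 1) ^ 2)
  refine (add_le_add_right h2 _).trans (le_of_eq ?_)
  simp only [Finset.sum_const, Finset.card_range, nsmul_eq_mul]
  push_cast
  field_simp
  norm_num

/-- The sum of the even Green function, seen from the walk at time `m`, along the even steps of the
walk after time `m`. -/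
noncomputable def greenAlong (n m : ℕ) (w : ℕ → Fin 4 → ℤ) : ℝ :=
  ∑ k ∈ Finset.range (n + 1), evenGreen (w m - w (m + 2 * k))

/-- The mean of `greenAlong n m`. -/
noncomputable def meanGreenAlong (n : ℕ) : ℝ := ∑ k ∈ Finset.range (n + 1), returnTail k

theorem meanGreenAlong_ge (n : ℕ) :
    1 / 20736 * ((harmonic (n + 1) : ℚ) : ℝ) ≤ meanGreenAlong n := by
  rw [← sum_inv_eq_harmonic, Finset.mul_sum]
  exact Finset.sum_le_sum fun k _ => returnTail_ge k

theorem pathExp_greenAlong (n m : ℕ) (w : ℕ → Fin 4 → ℤ) :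
    (L4).pathExp m (2 * n) (greenAlong n m) w = meanGreenAlong n := by
  unfold greenAlong
  rw [Network.pathExp_sum, meanGreenAlong]
  refine Finset.sum_congr rfl fun k hk => ?_
  have hk' : k ≤ n := by simpa [Nat.lt_succ_iff] using hk
  rw [(L4).pathExp_congr (F' := fun w' => (fun y => evenGreen (w m - y)) (w' (m + 2 * k)))
    fun w' hw' _ => by rw [hw' m le_rfl], (L4).pathExp_apply latticeNetwork_out_nonempty
    (by omega) (by omega) fun y => evenGreen (w m - y), lattice_iterate_avg_sub, sub_self,
    Nat.add_sub_cancel_left, iterate_avg_evenGreen_zero]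

theorem pathExp_evenGreen_mul {n m i k : ℕ} (hik : i ≤ k) (hk : k ≤ n) (w : ℕ → Fin 4 → ℤ) :
    (L4).pathExp m (2 * n) (fun w => evenGreen (w m - w (m + 2 * i)) *
      evenGreen (w m - w (m + 2 * k))) w = greenCorr i (k - i) := by
  rw [(L4).pathExp_congr (F' := fun w' => (fun y => evenGreen (w m - y)) (w' (m + 2 * i)) *
      (fun y => evenGreen (w m - y)) (w' (m + 2 * k))) fun w' hw' _ => by rw [hw' m le_rfl],
    (L4).pathExp_apply_mul_apply latticeNetwork_out_nonempty (by omega) (by omega) (by omega)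
      (fun y => evenGreen (w m - y)) fun y => evenGreen (w m - y)]
  simp only [lattice_iterate_avg_sub]
  rw [lattice_iterate_avg_sub (fun v => evenGreen v * _), sub_self, Nat.add_sub_cancel_left,
    Nat.add_sub_add_left, ← Nat.mul_sub, greenCorr]

/-- With gap t = k - i, the terms t > i are at most r_i r_t and, doubled, fit into (∑ r_i)²; the
terms t ≤ i sum to O(1/(i+1)) for each i. So the variance is of the order of the mean, not of its
square. -/
theorem sum_sum_greenCorr_le (n : ℕ) :
    2 * ∑ i ∈ Finset.range (n + 1), ∑ k ∈ Finset.range (n + 1),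
      (if i ≤ k then greenCorr i (k - i) else 0) ≤
    meanGreenAlong n ^ 2 + 1048576 * ((harmonic (n + 1) : ℚ) : ℝ) := by
  have hpos : ∀ i t, 0 ≤ greenCorr i t := fun i t => (L4).iterate_avg_nonneg (fun v =>
    mul_nonneg (evenGreen_nonneg v) ((L4).iterate_avg_nonneg evenGreen_nonneg _ v)) _ _
  have h1 : ∀ i ∈ Finset.range (n + 1), ∑ k ∈ Finset.range (n + 1),
      (if i ≤ k then greenCorr i (k - i) else 0) ≤ 524288 * (1 / ((i : ℝ) + 1)) +
      ∑ t ∈ Finset.range (n + 1), if i < t then returnTail i * returnTail t else 0 := by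
    intro i _
    have h2 : ∑ k ∈ Finset.range (n + 1), (if i ≤ k then greenCorr i (k - i) else 0) ≤
        ∑ t ∈ Finset.range (n + 1), greenCorr i t := by
      rw [← Finset.sum_filter]
      have himg : ((Finset.range (n + 1)).filter fun k => i ≤ k).image (fun k => k - i) ⊆
          Finset.range (n + 1) := by
        intro k hk
        simp only [Finset.mem_image, Finset.mem_filter, Finset.mem_range] at hk ⊢
        omega
      refine le_trans (le_of_eq ?_) (Finset.sum_le_sum_of_subset_of_nonneg himg
        fun _ _ _ => hpos _ _)
      rw [Finset.sum_image]
      intro a ha b hb hab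
      simp only [Finset.coe_filter, Finset.mem_range, Set.mem_ofPred_eq] at ha hb hab
      omega
    refine h2.trans ?_
    calc ∑ t ∈ Finset.range (n + 1), greenCorr i t
        ≤ ∑ t ∈ Finset.range (n + 1), ((if t ≤ i then greenCorr i t else 0) +
          if i < t then returnTail i * returnTail t else 0) := by
          refine Finset.sum_le_sum fun t _ => ?_
          rcases le_or_gt t i with h | h
          · rw [if_pos h, if_neg (by omega), add_zero]
          · rw [if_neg (by omega), if_pos h, zero_add]
            exact greenCorr_le_mul i t
      _ ≤ _ := by
          rw [Finset.sum_add_distrib]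
          refine add_le_add_left (le_trans ?_ (sum_greenCorr_le i)) _
          rw [← Finset.sum_filter]
          refine Finset.sum_le_sum_of_subset_of_nonneg (fun t ht => ?_) fun _ _ _ => hpos _ _
          simp only [Finset.mem_filter, Finset.mem_range] at ht ⊢
          omega
  have h3 : 2 * ∑ i ∈ Finset.range (n + 1), ∑ t ∈ Finset.range (n + 1),
      (if i < t then returnTail i * returnTail t else 0) ≤ meanGreenAlong n ^ 2 := by
    have hc : ∑ i ∈ Finset.range (n + 1), ∑ t ∈ Finset.range (n + 1),
        (if i < t then returnTail i * returnTail t else 0) =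
        ∑ i ∈ Finset.range (n + 1), ∑ t ∈ Finset.range (n + 1),
        (if t < i then returnTail i * returnTail t else 0) := by
      rw [Finset.sum_comm]
      refine Finset.sum_congr rfl fun i _ => Finset.sum_congr rfl fun t _ => ?_
      rw [mul_comm]
    rw [two_mul]
    nth_rewrite 2 [hc]
    rw [← Finset.sum_add_distrib, meanGreenAlong, sq, Finset.sum_mul_sum]
    refine Finset.sum_le_sum fun i _ => ?_
    rw [← Finset.sum_add_distrib]
    refine Finset.sum_le_sum fun t _ => ?_
    have := mul_nonneg (returnTail_nonneg i) (returnTail_nonneg t)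
    split_ifs <;> first | omega | linarith
  have h4 := Finset.sum_le_sum h1
  rw [Finset.sum_add_distrib, ← Finset.mul_sum, sum_inv_eq_harmonic] at h4
  linarith

theorem pathExp_greenAlong_sub_sq_le (n m : ℕ) (w : ℕ → Fin 4 → ℤ) :
    (L4).pathExp m (2 * n) (fun w => (greenAlong n m w - meanGreenAlong n) ^ 2) w ≤
      1048576 * ((harmonic (n + 1) : ℚ) : ℝ) := by
  have h1 : (L4).pathExp m (2 * n) (fun w => greenAlong n m w ^ 2) w ≤
      meanGreenAlong n ^ 2 + 1048576 * ((harmonic (n + 1) : ℚ) : ℝ) := by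
    refine le_trans ?_ (sum_sum_greenCorr_le n)
    refine ((L4).pathExp_le (F' := fun w => 2 * ∑ i ∈ Finset.range (n + 1),
      ∑ k ∈ Finset.range (n + 1), (if i ≤ k then 1 else 0) * (evenGreen (w m - w (m + 2 * i)) *
        evenGreen (w m - w (m + 2 * k)))) fun w' _ _ => ?_).trans ?_
    · rw [greenAlong, sq, Finset.sum_mul_sum]
      simp only [ite_mul, zero_mul, one_mul]
      exact Network.sum_sum_le_two_mul_of_symm (n + 1)
        (a := fun i k => evenGreen (w' m - w' (m + 2 * i)) * evenGreen (w' m - w' (m + 2 * k)))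
        (fun i _ k _ => mul_nonneg (evenGreen_nonneg _) (evenGreen_nonneg _))
        fun i _ k _ => mul_comm _ _
    · simp only [Network.pathExp_const_mul, Network.pathExp_sum]
      refine mul_le_mul_of_nonneg_left (Finset.sum_le_sum fun i _ =>
        Finset.sum_le_sum fun k hk => ?_) zero_le_two
      split_ifs with hik
      · rw [one_mul, pathExp_evenGreen_mul hik (by simpa [Nat.lt_succ_iff] using hk)]
      · rw [zero_mul]
  have e : (fun w => (greenAlong n m w - meanGreenAlong n) ^ 2) = fun w =>
      greenAlong n m w ^ 2 - 2 * meanGreenAlong n * greenAlong n m w + meanGreenAlong n ^ 2 := by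
    funext w
    ring
  rw [e, Network.pathExp_add, Network.pathExp_sub, Network.pathExp_const_mul, pathExp_greenAlong,
    (L4).pathExp_const latticeNetwork_out_nonempty]
  linarith

open Classical in
/-- With high probability `greenAlong n m` is at least half its mean. -/
theorem pathExp_greenAlong_lt_le (n m : ℕ) (w : ℕ → Fin 4 → ℤ) :
    (L4).pathExp m (2 * n) (fun w => if greenAlong n m w < meanGreenAlong n / 2 then 1 else 0) w ≤
      4194304 * 20736 ^ 2 / ((harmonic (n + 1) : ℚ) : ℝ) := by
  set H : ℝ := ((harmonic (n + 1) : ℚ) : ℝ) with hH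
  have hH1 : 1 ≤ H := harmonic_pos_real n
  have hA : 1 / 20736 * H ≤ meanGreenAlong n := meanGreenAlong_ge n
  set A := meanGreenAlong n
  have hA0 : 0 < A := lt_of_lt_of_le (by positivity) hA
  -- Chebyshev's inequality for a deviation of at least A/2.
  refine ((L4).pathExp_le (F' := fun w => 4 / A ^ 2 * (greenAlong n m w - A) ^ 2)
    fun w' _ _ => ?_).trans ?_
  · split_ifs with h
    · rw [div_mul_eq_mul_div, le_div_iff₀ (by positivity)]
      nlinarith
    · positivity
  · rw [Network.pathExp_const_mul]
    calc _ ≤ 4 / A ^ 2 * (1048576 * H) :=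
          mul_le_mul_of_nonneg_left (pathExp_greenAlong_sub_sq_le n m w) (by positivity)
      _ ≤ 4 / (1 / 20736 * H) ^ 2 * (1048576 * H) := by gcongr
      _ = _ := by field_simp; norm_num

/-! ### Upper bound on the capacity through last exits -/

/-- The sum is the probability that the last exit from `A` occurs. Analytically, h = `hitEver`
solves h = q + Ph with q the escape probability on `A`; iterating leaves partial sums of the Green
series plus a nonnegative remainder, with total h ≤ 1. -/
theorem sum_escapeProb_mul_latticeGreen_le (A : Finset (Fin 4 → ℤ)) (u : Fin 4 → ℤ) :
    ∑ v ∈ A, (L4).escapeProb (A : Set (Fin 4 → ℤ)) v * latticeGreen (v - u) ≤ 1 := by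
  classical
  have hG := latticeNetwork_out_nonempty
  set h := (L4).hitEver (A : Set (Fin 4 → ℤ)) with hh
  set q : (Fin 4 → ℤ) → ℝ := fun y =>
    ∑ v ∈ A, (L4).escapeProb (A : Set (Fin 4 → ℤ)) v * heat 0 (v - y) with hq
  have hstep : ∀ y, h y = q y + (L4).avg h y := fun y => by
    have e : ∀ v, heat 0 (v - y) = if y = v then 1 else 0 := fun v => by
      simp [heat, sub_eq_zero, eq_comm]
    simp only [hq, e, mul_ite, mul_one, mul_zero, Finset.sum_ite_eq]
    split_ifs with hy
    · rw [(L4).escapeProb_eq hG, hh, (L4).hitEver_of_mem hG (by exact_mod_cast hy)]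
      ring
    · rw [zero_add]
      exact (L4).hitEver_of_notMem hG (by exact_mod_cast hy)
  have hiter : ∀ L y, ∑ l ∈ Finset.range L, ((L4).avg^[l] q) y + ((L4).avg^[L] h) y = h y := by
    intro L y
    induction L with
    | zero => simp
    | succ L ih =>
      have e : h = fun y => ∑ b : Bool, if b then q y else (L4).avg h y := by
        funext y
        simpa using hstep y
      have e2 : ((L4).avg^[L] h) y = ((L4).avg^[L] q) y + ((L4).avg^[L + 1] h) y := by
        conv_lhs => rw [e]
        rw [Network.iterate_avg_sum, Function.iterate_succ_apply]
        simp
      rw [Finset.sum_range_succ, add_assoc, ← e2, ih]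
  have hval : ∀ l, ((L4).avg^[l] q) u =
      ∑ v ∈ A, (L4).escapeProb (A : Set (Fin 4 → ℤ)) v * heat l (v - u) := fun l => by
    rw [hq, Network.iterate_avg_sum]
    refine Finset.sum_congr rfl fun v _ => ?_
    rw [Network.iterate_avg_const_mul, lattice_iterate_avg_sub, iterate_avg_heat, add_zero]
  have hsum : HasSum (fun l => ((L4).avg^[l] q) u)
      (∑ v ∈ A, (L4).escapeProb (A : Set (Fin 4 → ℤ)) v * latticeGreen (v - u)) := by
    simp only [hval]
    exact hasSum_sum fun v _ => (hasSum_latticeGreen _).mul_left _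
  refine le_of_tendsto' hsum.tendsto_sum_nat fun L => ?_
  have h1 := hiter L u
  have h2 := (L4).iterate_avg_nonneg ((L4).hitEver_nonneg hG (A : Set (Fin 4 → ℤ))) L u
  have h3 := (L4).hitEver_le_one hG (A : Set (Fin 4 → ℤ)) u
  linarith

open Classical in
/-- The capacity of a set of points of the path is controlled by the number of times at which
`greenAlong` is small. -/
theorem capacity_le_of_subset_pathVertices {n : ℕ} {w : ℕ → Fin 4 → ℤ} {A : Finset (Fin 4 → ℤ)}
    (hA : A ⊆ pathVertices w n) {θ : ℝ} (hθ : 0 < θ) :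
    (L4).capacity A ≤ 8 * ((3 * n + 1) / θ +
      ∑ m ∈ Finset.range (n + 1), if greenAlong n m w < θ then 1 else 0) := by
  have hm : ∀ v ∈ A, ∃ m ≤ n, w m = v := fun v hv => mem_pathVertices.1 (hA hv)
  -- One visit time per vertex suffices; distinct vertices have distinct times, so bad vertices are
  -- counted by bad times.
  choose! τ hτ hwτ using hm
  set esc := (L4).escapeProb (A : Set (Fin 4 → ℤ)) with hesc
  have hesc0 : ∀ v, 0 ≤ esc v := fun v => (L4).escapeProb_nonneg _ v
  have hesc1 : ∀ v, esc v ≤ 1 := fun v => (L4).escapeProb_le_one _ v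
  have e : (L4).capacity A = 8 * ∑ v ∈ A, esc v := by
    simp only [Network.capacity, latticeNetwork_vertexCond, Finset.mul_sum, hesc]
  -- The times `τ v + 2 * k` are distinct and at most 3n, so the future seen from any path vertex
  -- lies in one common window.
  have hgreen : ∀ v ∈ A, greenAlong n (τ v) w ≤
      ∑ s ∈ Finset.range (3 * n + 1), latticeGreen (v - w s) := fun v hv => by
    rw [greenAlong, hwτ v hv]
    have himg : (Finset.range (n + 1)).image (fun k => τ v + 2 * k) ⊆
        Finset.range (3 * n + 1) := by
      intro k hk
      have := hτ v hv
      simp only [Finset.mem_image, Finset.mem_range] at hk ⊢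
      omega
    refine le_trans ?_ (Finset.sum_le_sum_of_subset_of_nonneg himg
      fun _ _ _ => latticeGreen_nonneg _)
    rw [Finset.sum_image fun a _ b _ hab => by simpa using hab]
    exact Finset.sum_le_sum fun k _ => evenGreen_le_latticeGreen _
  have hgood : ∑ v ∈ A, esc v * greenAlong n (τ v) w ≤ 3 * n + 1 := by
    calc _ ≤ ∑ v ∈ A, ∑ s ∈ Finset.range (3 * n + 1), esc v * latticeGreen (v - w s) :=
          Finset.sum_le_sum fun v hv => by
            rw [← Finset.mul_sum]
            exact mul_le_mul_of_nonneg_left (hgreen v hv) (hesc0 v)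
      _ = ∑ s ∈ Finset.range (3 * n + 1), ∑ v ∈ A, esc v * latticeGreen (v - w s) :=
          Finset.sum_comm
      _ ≤ ∑ s ∈ Finset.range (3 * n + 1), 1 :=
          Finset.sum_le_sum fun s _ => sum_escapeProb_mul_latticeGreen_le A (w s)
      _ = _ := by simp
  have hbad : ∑ v ∈ A, (if greenAlong n (τ v) w < θ then (1 : ℝ) else 0) ≤
      ∑ m ∈ Finset.range (n + 1), if greenAlong n m w < θ then 1 else 0 := by
    have himg : A.image τ ⊆ Finset.range (n + 1) := by
      intro k hk
      obtain ⟨v, hv, rfl⟩ := Finset.mem_image.1 hk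
      exact Finset.mem_range.2 (Nat.lt_succ_of_le (hτ v hv))
    refine le_trans (le_of_eq ?_) (Finset.sum_le_sum_of_subset_of_nonneg himg
      fun _ _ _ => by split_ifs <;> norm_num)
    rw [Finset.sum_image]
    intro a ha b hb hab
    rw [← hwτ a ha, ← hwτ b hb, hab]
  -- At a good vertex the Green sum is at least θ and pays for the escape probability; at a bad one
  -- the trivial bound 1 is used.
  have hpt : ∀ v ∈ A, esc v ≤ esc v * greenAlong n (τ v) w / θ +
      if greenAlong n (τ v) w < θ then 1 else 0 := fun v _ => by
    have hZ : 0 ≤ greenAlong n (τ v) w := Finset.sum_nonneg fun _ _ => evenGreen_nonneg _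
    split_ifs with h
    · have : 0 ≤ esc v * greenAlong n (τ v) w / θ :=
        div_nonneg (mul_nonneg (hesc0 v) hZ) hθ.le
      linarith [hesc1 v]
    · rw [add_zero, le_div_iff₀ hθ]
      exact mul_le_mul_of_nonneg_left (not_lt.1 h) (hesc0 v)
  rw [e]
  refine mul_le_mul_of_nonneg_left ((Finset.sum_le_sum hpt).trans ?_) (by norm_num)
  rw [Finset.sum_add_distrib, ← Finset.sum_div]
  exact add_le_add (div_le_div_of_nonneg_right hgood hθ.le) hbad

/-- The upper bound on the mean capacity of the loop-erasure of the simple random walk path. -/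
theorem pathExp_capacity_loopErasure_lattice_le (x : Fin 4 → ℤ) (n : ℕ) :
    (L4).pathExp 0 n (fun w => (L4).capacity (loopErasureVertices w n)) (fun _ => x) ≤
      8 * (6 * 20736 + 4194304 * 20736 ^ 2) * (n + 1) / ((harmonic (n + 1) : ℚ) : ℝ) := by
  classical
  have hG := latticeNetwork_out_nonempty
  set H : ℝ := ((harmonic (n + 1) : ℚ) : ℝ) with hH
  have hH1 : 1 ≤ H := harmonic_pos_real n
  have hA : 1 / 20736 * H ≤ meanGreenAlong n := meanGreenAlong_ge n
  set A := meanGreenAlong n with hAdef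
  have hA0 : 0 < A := lt_of_lt_of_le (by positivity) hA
  -- The horizon is extended to 3n because `greenAlong` looks 2n steps beyond a time up to n.
  have e : (L4).pathExp 0 n (fun w => (L4).capacity (loopErasureVertices w n)) (fun _ => x) =
      (L4).pathExp 0 (3 * n) (fun w => (L4).capacity (loopErasureVertices w n)) (fun _ => x) := by
    rw [(L4).pathExp_split (by omega : n ≤ 3 * n)]
    exact (L4).pathExp_congr fun w _ _ => ((L4).pathExp_of_dependsBetween hG
      ((L4).dependsBetween_capacity_loopErasureVertices n) w).symm
  rw [e]
  refine ((L4).pathExp_le fun w _ _ => capacity_le_of_subset_pathVertices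
    (loopErasureVertices_subset w n) (half_pos hA0)).trans ?_
  rw [Network.pathExp_const_mul, Network.pathExp_add, (L4).pathExp_const hG, Network.pathExp_sum]
  have hbad : ∀ m ∈ Finset.range (n + 1), (L4).pathExp 0 (3 * n)
      (fun w => if greenAlong n m w < A / 2 then 1 else 0) (fun _ => x) ≤
      4194304 * 20736 ^ 2 / H := by
    intro m hm
    have hm' : m ≤ n := by simpa [Nat.lt_succ_iff] using hm
    rw [(L4).pathExp_split (by omega : m ≤ 3 * n)]
    refine ((L4).pathExp_le (F' := fun _ => 4194304 * 20736 ^ 2 / H)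
      fun w _ _ => ?_).trans ((L4).pathExp_const hG ..).le
    rw [show 3 * n - m = 2 * n + (n - m) by omega, (L4).pathExp_add_steps]
    refine le_trans (le_of_eq ?_) (pathExp_greenAlong_lt_le n m w)
    refine (L4).pathExp_congr fun w' _ _ => (L4).pathExp_of_dependsBetween hG ?_ w'
    intro u u' hu
    have : greenAlong n m u = greenAlong n m u' := Finset.sum_congr rfl fun k hk => by
      have hk' : k ≤ n := by simpa [Nat.lt_succ_iff] using hk
      rw [hu m m.zero_le (by omega), hu (m + 2 * k) (Nat.zero_le _) (by omega)]
    simp only [this]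
  have h1 : (3 * (n : ℝ) + 1) / (A / 2) ≤ 6 * 20736 * (n + 1) / H := by
    calc _ ≤ (3 * ((n : ℝ) + 1)) / (1 / 20736 * H / 2) := by gcongr; linarith
      _ = _ := by field_simp; norm_num
  have h2 := Finset.sum_le_sum hbad
  simp only [Finset.sum_const, Finset.card_range, nsmul_eq_mul] at h2
  push_cast at h2
  calc _ ≤ 8 * (6 * 20736 * (n + 1) / H + (n + 1) * (4194304 * 20736 ^ 2 / H)) :=
        mul_le_mul_of_nonneg_left (add_le_add h1 h2) (by norm_num)
    _ = _ := by ring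

end Lattice

/-! ### Conclusion -/

theorem mainTheorem5 :
    (∀ {V : Type*} {E : Type*} [MeasurableSpace V] [DiscreteMeasurableSpace V]
      (G : Network V E), G.IsTransient → ∀ (x : V)
      {Ω : Type*} [MeasurableSpace Ω] (P : Measure Ω) (X : ℕ → Ω → V),
      HasLaw (fun ω t => X t ω) (G.walkLaw x) P → ∀ n : ℕ,
      ∫ ω, G.capacity (loopErasureVertices (fun t => X t ω) n) ∂P ≥
        1 / 256 * ∫ ω, G.capacity (pathVertices (fun t => X t ω) n) ∂P) ∧
    (∃ c C : ℝ, 0 < c ∧ 0 < C ∧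
      ∀ (x : Fin 4 → ℤ) {Ω : Type*} [MeasurableSpace Ω] (P : Measure Ω)
        (X : ℕ → Ω → Fin 4 → ℤ),
      HasLaw (fun ω t => X t ω) ((latticeNetwork 4).walkLaw x) P → ∀ n : ℕ, 2 ≤ n →
      c * (n / Real.log n) ≤
          ∫ ω, (latticeNetwork 4).capacity (loopErasureVertices (fun t => X t ω) n) ∂P ∧
        ∫ ω, (latticeNetwork 4).capacity (loopErasureVertices (fun t => X t ω) n) ∂P ≤
          C * (n / Real.log n)) := by
  -- In the lower constant, 512 = 128 · 4, from `le_pathExp_capacity_lattice` and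
  -- `harmonic_le_mul_log`. The final factor 2 in the upper one is n + 1 ≤ 2n.
  refine ⟨fun G hT x _ _ P X hX n => G.integral_capacity_loopErasure_ge hT.out_nonempty hX n,
    1 / 256 * (1 / 512), 8 * (6 * 20736 + 4194304 * 20736 ^ 2) * 2, by norm_num, by norm_num,
    fun x _ _ P X hX n hn => ?_⟩
  have hG := latticeNetwork_out_nonempty
  have hn' : (2 : ℝ) ≤ n := by exact_mod_cast hn
  have hlog : 0 < Real.log n := Real.log_pos (by linarith)
  have hH0 : (0 : ℝ) < ((harmonic (n + 1) : ℚ) : ℝ) :=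
    zero_lt_one.trans_le (harmonic_pos_real n)
  constructor
  · refine le_trans ?_ ((latticeNetwork 4).integral_capacity_loopErasure_ge hG hX n)
    rw [mul_assoc]
    refine mul_le_mul_of_nonneg_left ?_ (by norm_num)
    rw [(latticeNetwork 4).integral_eq_pathExp hG hX
      ((latticeNetwork 4).dependsBetween_capacity_pathVertices n)]
    refine le_trans ?_ (le_pathExp_capacity_lattice x n)
    calc 1 / 512 * (n / Real.log n) = n / (128 * (4 * Real.log n)) := by field_simp; norm_num
      _ ≤ ((n : ℝ) + 1) / (128 * ((harmonic (n + 1) : ℚ) : ℝ)) := by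
          gcongr
          · linarith
          · exact harmonic_le_mul_log hn
  · rw [(latticeNetwork 4).integral_eq_pathExp hG hX
      ((latticeNetwork 4).dependsBetween_capacity_loopErasureVertices n)]
    refine (pathExp_capacity_loopErasure_lattice_le x n).trans ?_
    have hle : Real.log n ≤ ((harmonic (n + 1) : ℚ) : ℝ) := by
      refine le_trans (Real.log_le_log (by linarith) ?_) (log_add_one_le_harmonic (n + 1))
      push_cast
      linarith
    calc 8 * (6 * 20736 + 4194304 * 20736 ^ 2) * ((n : ℝ) + 1) / ((harmonic (n + 1) : ℚ) : ℝ)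
        ≤ 8 * (6 * 20736 + 4194304 * 20736 ^ 2) * (2 * (n : ℝ)) / Real.log n := by
          gcongr
          linarith
      _ = _ := by ring
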